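/- Let $\{\varepsilon(t,s)\}_{(t,s)\in\mathbb Z^2}$ be i.i.d. with $\mathbb E\varepsilon=0$, $\mathbb E\varepsilon^2=1$ and $\mathbb E|\varepsilon|^{2k}<\infty$, where $k\ge 1$ is an integer. Let $q_1,q_2>0$ satisfy $Q:=1/q_1+1/q_2\in(1,2)$, and put $p_i:=q_i(2-Q)$, $P:=1/p_1+1/p_2$, $\gamma_0:=q_1/q_2$ and $\rho(t,s):=(|t|^2+|s|^{2q_2/q_1})^{1/2}$. Let $L_0\ge 0$ be a bounded piecewise continuous function on $[-1,1]$ and let $a:\mathbb Z^2\to\mathbb R$ satisfy $$a(t,s)=\rho(t,s)^{-q_1}\big(L_0(t/\rho(t,s))+o(1)\big),\qquad |t|+|s|\to\infty .$$ Let $Y(t,s)=\sum_{(u,v)\in\mathbb Z^2}a(t-u,s-v)\varepsilon(u,v)$ (convergence in $L^2$) and $X(t,s)=A_k(Y(t,s))$. Here, for a random variable $\xi$ with $\mathbb E|\xi|^m<\infty$, $A_m(\xi)$ denotes the value at $x=\xi$ of the $m$-th Appell polynomial $A_m(x)=(-i)^m\frac{d^m}{du^m}\big(e^{iux}/\mathbb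 E e^{iu\xi}\big)\big|_{u=0}$ relative to the distribution of $\xi$. For a field $V$ write $r_V(t,s):=\mathbb E\,V(0,0)V(t,s)$. Put $$a_\infty(t,s):=\rho(t,s)^{-q_1}L_0(t/\rho(t,s)),\qquad (a_\infty\star a_\infty)(t,s):=\int_{\mathbb R^2}a_\infty(u,v)\,a_\infty(t+u,s+v)\,du\,dv,$$ $$L_X(z):=k!\,\big((a_\infty\star a_\infty)(z,(1-z^2)^{\gamma_0/2})\big)^k,\qquad z\in[-1,1].$$ Then $X(t,s)$ is square integrable with zero mean, and the following hold. (i) Let $1\le k<P$. Then $$r_X(t,s)=\rho(t,s)^{-kp_1}\big(L_X(t/\rho(t,s))+o(1)\big),\qquad |t|+|s|\to\infty,$$ and $L_X$ is continuous on $[-1,1]$; it is strictly positive on $[-1,1]$ provided that $L_0$ does not vanish almost everywhere on $[-1,1]$. Moreover, almost surely $X(t,s)=Y^{\bullet k}(t,s)+\mathcal Z(t,s)$, where the off-diagonal part $$Y^{\bullet k}(t,s)=\sum a(t-u_1,s-v_1)\cdots a(t-u_k,s-v_k)\,\varepsilon(u_1,v_1)\cdots\varepsilon(u_k,v_k)$$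 is the sum over all $k$-tuples of pairwise distinct points $(u_j,v_j)\in\mathbb Z^2$, and the diagonal part $$\mathcal Z(t,s)=\sum a(t-u_1,s-v_1)\cdots a(t-u_k,s-v_k)\,{:}\varepsilon(u_1,v_1)\cdots\varepsilon(u_k,v_k){:}$$ is the sum over all the other $k$-tuples of points of $\mathbb Z^2$; both series converge unconditionally in $L^2$. The Wick product ${:}\varepsilon(u_1,v_1)\cdots\varepsilon(u_k,v_k){:}$ is the product, over the distinct points $w$ among $(u_1,v_1),\dots,(u_k,v_k)$, of $A_{m}(\varepsilon(w))$, where $m$ is the number of times $w$ occurs. The field $\mathcal Z$ has zero mean and $$r_{\mathcal Z}(t,s)=O\big(\rho(t,s)^{-2q_1}\big)=o\big(\rho(t,s)^{-kp_1}\big),\qquad |t|+|s|\to\infty .$$ (ii) Let $k>P$. Then $$r_X(t,s)=O\big(\rho(t,s)^{-\min(kp_1,\,2q_1)}\big),\qquad |t|+|s|\to\infty .$$ -/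

import Mathlib

open MeasureTheory ProbabilityTheory Filter Topology Asymptotics
open scoped ENNReal

namespace AnisoField

noncomputable section

/-! ### Exponents, the anisotropic gauge and convolution -/

/-- `Q = 1/q₁ + 1/q₂`. -/
def bigQ (q₁ q₂ : ℝ) : ℝ := 1 / q₁ + 1 / q₂

/-- `p₁ = q₁ (2 - Q)`. -/
def p1 (q₁ q₂ : ℝ) : ℝ := q₁ * (2 - bigQ q₁ q₂)

/-- `p₂ = q₂ (2 - Q)`. -/
def p2 (q₁ q₂ : ℝ) : ℝ := q₂ * (2 - bigQ q₁ q₂)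

/-- `P = 1/p₁ + 1/p₂`. -/
def bigP (q₁ q₂ : ℝ) : ℝ := 1 / p1 q₁ q₂ + 1 / p2 q₁ q₂

/-- `γ₀ = q₁ / q₂`. -/
def gamma0 (q₁ q₂ : ℝ) : ℝ := q₁ / q₂

/-- `ρ(t,s) = (|t|² + |s|^{2 q₂/q₁})^{1/2}`. -/
def rho (q₁ q₂ t s : ℝ) : ℝ := (|t| ^ (2 : ℕ) + |s| ^ (2 * q₂ / q₁)) ^ (1 / 2 : ℝ)

/-- `ρ` at a lattice point. -/
def rhoZ (q₁ q₂ : ℝ) (z : ℤ × ℤ) : ℝ := rho q₁ q₂ (z.1 : ℝ) (z.2 : ℝ)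

/-- `a_∞(t,s) = ρ(t,s)^{-q₁} L₀(t/ρ(t,s))`. -/
def aInf (q₁ q₂ : ℝ) (L₀ : ℝ → ℝ) (x : ℝ × ℝ) : ℝ :=
  rho q₁ q₂ x.1 x.2 ^ (-q₁) * L₀ (x.1 / rho q₁ q₂ x.1 x.2)

/-- `(ψ₁ ⋆ ψ₂)(x) = ∫_{ℝ²} ψ₁(y) ψ₂(x + y) dy`. -/
def star (ψ₁ ψ₂ : ℝ × ℝ → ℝ) (x : ℝ × ℝ) : ℝ := ∫ y : ℝ × ℝ, ψ₁ y * ψ₂ (x + y)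

/-- The angular function
`L_X(x) = k! ((a_∞ ⋆ a_∞)(x, (1 - x²)^{γ₀/2}))^k`. -/
def LX (q₁ q₂ : ℝ) (L₀ : ℝ → ℝ) (k : ℕ) (x : ℝ) : ℝ :=
  (k.factorial : ℝ) *
    (star (aInf q₁ q₂ L₀) (aInf q₁ q₂ L₀) (x, (1 - x ^ 2) ^ (gamma0 q₁ q₂ / 2))) ^ k

/-- The filter `|t| + |s| → ∞` on `ℤ²`. -/
def atInfinity : Filter (ℤ × ℤ) := Filter.comap (fun z : ℤ × ℤ => |z.1| + |z.2|) atTop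

/-- `f(t,s) = ρ(t,s)^{-h} (L(t/ρ(t,s)) + o(1))` as `|t| + |s| → ∞`. -/
def HasAngularAsymptotics (q₁ q₂ : ℝ) (f : ℤ × ℤ → ℝ) (h : ℝ) (L : ℝ → ℝ) : Prop :=
  ∃ o : ℤ × ℤ → ℝ, Tendsto o atInfinity (𝓝 0) ∧
    ∀ᶠ z in atInfinity,
      f z = rhoZ q₁ q₂ z ^ (-h) * (L ((z.1 : ℝ) / rhoZ q₁ q₂ z) + o z)

/-! ### Assumptions on the noise and on the coefficients -/

/-- The noise is i.i.d. with mean `0` and variance `1`. -/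
structure IsStandardNoise {Ω : Type*} [MeasurableSpace Ω] (μ : Measure Ω)
    (ε : ℤ × ℤ → Ω → ℝ) : Prop where
  measurable : ∀ w, Measurable (ε w)
  indep : iIndepFun ε μ
  identDistrib : ∀ w, IdentDistrib (ε w) (ε 0) μ μ
  mean_zero : ∫ ω, ε 0 ω ∂μ = 0
  sq_integrable : Integrable (fun ω => ε 0 ω ^ 2) μ
  variance_one : ∫ ω, ε 0 ω ^ 2 ∂μ = 1

/-- Bounded, and continuous off a finite set, on `[-1,1]`. -/
def IsBddPiecewiseContinuous (L : ℝ → ℝ) : Prop :=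
  (∃ C : ℝ, ∀ u ∈ Set.Icc (-1 : ℝ) 1, |L u| ≤ C) ∧
    ∃ F : Set ℝ, F.Finite ∧ ContinuousOn L (Set.Icc (-1 : ℝ) 1 \ F)

/-- Regularly decaying moving-average coefficients with angular function `L₀`. -/
structure IsLRDCoefficient (q₁ q₂ : ℝ) (L₀ : ℝ → ℝ) (a : ℤ × ℤ → ℝ) : Prop where
  q₁_pos : 0 < q₁
  q₂_pos : 0 < q₂
  one_lt_Q : 1 < bigQ q₁ q₂
  Q_lt_two : bigQ q₁ q₂ < 2
  L₀_nonneg : ∀ u ∈ Set.Icc (-1 : ℝ) 1, 0 ≤ L₀ u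
  L₀_regular : IsBddPiecewiseContinuous L₀
  asymptotics : HasAngularAsymptotics q₁ q₂ a q₁ L₀

/-! ### Random series, Appell polynomials and Wick products -/

/-- `F = ∑ i, f i`, the series being unconditionally convergent in `L²(μ)`. This
determines `F` up to almost sure equality. -/
structure HasL2Sum {Ω ι : Type*} [MeasurableSpace Ω] (μ : Measure Ω)
    (f : ι → Ω → ℝ) (F : Ω → ℝ) : Prop where
  memLp_term : ∀ i, MemLp (f i) 2 μ
  memLp_sum : MemLp F 2 μ
  tendsto : Tendsto (fun S : Finset ι => eLpNorm (fun ω => F ω - ∑ i ∈ S, f i ω) 2 μ)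
    atTop (𝓝 0)

/-- The `k`-th Appell polynomial relative to a distribution `ν` on `ℝ`, evaluated at `x`:
`A_k(x) = (-i)^k d^k/du^k (e^{iux} / ∫ e^{iuy} ν(dy))` at `u = 0`. This number is real whenever
`ν` is a probability with a finite moment of order `k`; taking the real part only fixes
the type. -/
def appell (ν : Measure ℝ) (k : ℕ) (x : ℝ) : ℝ :=
  ((-Complex.I) ^ k *
    iteratedDeriv k (fun u : ℝ => Complex.exp (Complex.I * u * x) / charFun ν u) 0).re

/-- The random variable `A_k(ξ)`, with `A_k` relative to the distribution of `ξ`. -/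
def appellOf {Ω : Type*} [MeasurableSpace Ω] (μ : Measure Ω) (k : ℕ) (ξ : Ω → ℝ) : Ω → ℝ :=
  fun ω => appell (μ.map ξ) k (ξ ω)

/-- The Wick product `:ε(w₁) ⋯ ε(w_k):` of independent noise variables, i.e. the product over
the distinct points `p` among `w₁, …, w_k` of `A_m(ε(p))`, `m` being the multiplicity of `p`. -/
def wick {Ω : Type*} [MeasurableSpace Ω] (μ : Measure Ω) (ε : ℤ × ℤ → Ω → ℝ) {k : ℕ}
    (w : Fin k → ℤ × ℤ) : Ω → ℝ :=
  fun ω => ∏ p ∈ Finset.univ.image w,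
    appellOf μ (Finset.univ.filter (fun j => w j = p)).card (ε p) ω

/-- `Y(z) = ∑_w a(z - w) ε(w)`. -/
def IsMovingAverage {Ω : Type*} [MeasurableSpace Ω] (μ : Measure Ω)
    (a : ℤ × ℤ → ℝ) (ε Y : ℤ × ℤ → Ω → ℝ) : Prop :=
  ∀ z, HasL2Sum μ (fun (w : ℤ × ℤ) ω => a (z - w) * ε w ω) (Y z)

/-- The off-diagonal part: the sum over `k`-tuples of pairwise distinct points of
`a(z - w₁) ⋯ a(z - w_k) ε(w₁) ⋯ ε(w_k)`. -/
def IsOffDiagonalPart {Ω : Type*} [MeasurableSpace Ω] (μ : Measure Ω)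
    (a : ℤ × ℤ → ℝ) (ε : ℤ × ℤ → Ω → ℝ) (k : ℕ) (U : ℤ × ℤ → Ω → ℝ) : Prop :=
  ∀ z, HasL2Sum μ (fun (w : {w : Fin k → ℤ × ℤ // Function.Injective w}) ω =>
    (∏ j, a (z - w.1 j)) * ∏ j, ε (w.1 j) ω) (U z)

/-- The diagonal part: the sum over the remaining `k`-tuples of
`a(z - w₁) ⋯ a(z - w_k) :ε(w₁) ⋯ ε(w_k):`. -/
def IsDiagonalPart {Ω : Type*} [MeasurableSpace Ω] (μ : Measure Ω)
    (a : ℤ × ℤ → ℝ) (ε : ℤ × ℤ → Ω → ℝ) (k : ℕ) (Z : ℤ × ℤ → Ω → ℝ) : Prop :=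
  ∀ z, HasL2Sum μ (fun (w : {w : Fin k → ℤ × ℤ // ¬ Function.Injective w}) ω =>
    (∏ j, a (z - w.1 j)) * wick μ ε w.1 ω) (Z z)

/-- `r_X(t,s) = E X(0,0) X(t,s)`, the covariance function of a zero-mean stationary field. -/
def covFun {Ω : Type*} [MeasurableSpace Ω] (μ : Measure Ω) (X : ℤ × ℤ → Ω → ℝ)
    (z : ℤ × ℤ) : ℝ := ∫ ω, X 0 ω * X z ω ∂μ

end

end AnisoField

set_option linter.unusedSectionVars false

/-! Everything reduces to one estimate: `r_X(z) = k! r_Y(z)^k + O(ρ(z)^{-2q₁})`, where `r_Y(z) = ∑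
a(w) a(z+w)`. Together with the asymptotics of `r_Y` it gives both regimes.

Chaos expansion. For a finite linear combination of the noise, independence factorizes the
generating function `e^{iux}/E e^{iuξ}`. The Leibniz rule then writes `A_k` as a sum of Wick
products over `k`-tuples (`IsStandardNoise.appell_sum`). Wick products with different supports are
orthogonal and their covariances are bounded, so the series over all tuples converges in `L²` as
soon as `∑ a²` does. To pass to the limit on the left side, a `2k`-th moment bound uniform over
finite partial sums (`IsStandardNoise.moment_bound`) makes the moments, hence the coefficients of
`A_k`, converge (`IsStandardNoise.appellOf_ae_eq`). Splitting the series into injective and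
non-injective tuples gives the off-diagonal and the diagonal part, which are mutually orthogonal.

Covariance error. The quasi-triangle inequality for `ρ` shows that for every `w` one of `|a(-w)|`,
`|a(z-w)|` is at most `δ`, of order `ρ(z)^{-q₁}`. A pair of non-injective tuples with a common
support has a repeated index in each tuple, and each repetition gains a factor `δ`. Hence the
covariance of the diagonal part is `O(δ²)`, and replacing the sum over injective tuples by the full
power `r_Y^k` also costs `O(δ²)` (`IsStandardNoise.exists_covariance_bounds`).

Asymptotics of `r_Y`. With `r = ρ(z)`, the sum `r^{p₁} r_Y(z)` is exactly the integral of a rescaled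
step function against its translate by a point of the unit sphere of `ρ`. The step functions
converge to `a_∞` almost everywhere. The product is singular at two points; a partition of unity
moves both singularities to the origin, where `min(ρ^{-q₁}, ρ^{-2q₁})` dominates. This is integrable
precisely because `1 < Q < 2`. Compactness of the sphere makes the convergence uniform in the angle
(`IsLRDCoefficient.tendsto_rpow_mul_tsum`).

Finally `P p₁ = q₁ Q < 2 q₁`, so for `k < P` the error is negligible against `ρ^{-k p₁}`. Positivity
of `L_X` holds because the homogeneous set where `a_∞ > 0` contains an open set, and far out along
it a translate by `z` is invisible. -/

namespace AnisoField

/-! ### Appell polynomials -/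

/-- The coefficients of the reciprocal of the exponential generating series of `m`
(normalised by `m 0 = 1`). -/
noncomputable def appellCoeff (m : ℕ → ℝ) (n : ℕ) : ℝ :=
  if n = 0 then 1
  else -∑ j : Fin n, (n.choose j : ℝ) * appellCoeff m j * m (n - j)
termination_by n
decreasing_by exact j.2

theorem appellCoeff_zero (m : ℕ → ℝ) : appellCoeff m 0 = 1 := by
  rw [appellCoeff]; simp

theorem appellCoeff_of_ne_zero (m : ℕ → ℝ) {n : ℕ} (hn : n ≠ 0) :
    appellCoeff m n = -∑ j ∈ Finset.range n, (n.choose j : ℝ) * appellCoeff m j * m (n - j) := by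
  rw [appellCoeff, if_neg hn, Finset.sum_range]

/-- The coefficient of order `n ≥ 1` in the identity `M⁻¹ · M = 1` of exponential series. It is what
makes Appell polynomials have mean zero. -/
theorem sum_choose_appellCoeff_mul {m : ℕ → ℝ} (hm : m 0 = 1) {n : ℕ} (hn : n ≠ 0) :
    ∑ j ∈ Finset.range (n + 1), (n.choose j : ℝ) * appellCoeff m j * m (n - j) = 0 := by
  rw [Finset.sum_range_succ, appellCoeff_of_ne_zero m hn]
  simp [hm]

theorem appellCoeff_scale (m : ℕ → ℝ) (c : ℝ) (n : ℕ) :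
    appellCoeff (fun j => c ^ j * m j) n = c ^ n * appellCoeff m n := by
  induction n using Nat.strong_induction_on with
  | _ n ih =>
    rcases eq_or_ne n 0 with rfl | hn
    · simp [appellCoeff_zero]
    rw [appellCoeff_of_ne_zero _ hn, appellCoeff_of_ne_zero _ hn, mul_neg, Finset.mul_sum]
    congr 1
    refine Finset.sum_congr rfl fun j hj => ?_
    have hj' : j < n := Finset.mem_range.1 hj
    rw [ih j hj', ← Nat.add_sub_cancel' hj'.le, pow_add, Nat.add_sub_cancel_left]
    ring

/-- Each coefficient is a polynomial in the moments up to its order. This is the continuity that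
carries `A_k` through an `L²` limit, along which the law itself varies. -/
theorem tendsto_appellCoeff {α : Type*} {l : Filter α} {m : α → ℕ → ℝ} {m' : ℕ → ℝ} (n : ℕ)
    (h : ∀ j ≤ n, Tendsto (fun a => m a j) l (𝓝 (m' j))) :
    Tendsto (fun a => appellCoeff (m a) n) l (𝓝 (appellCoeff m' n)) := by
  induction n using Nat.strong_induction_on with
  | _ n ih =>
    rcases eq_or_ne n 0 with rfl | hn
    · simp only [appellCoeff_zero]; exact tendsto_const_nhds
    simp only [appellCoeff_of_ne_zero _ hn]
    refine (tendsto_finsetSum _ fun j hj => ?_).neg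
    have hj' : j < n := Finset.mem_range.1 hj
    exact (tendsto_const_nhds.mul (ih j hj' fun i hi => h i (hi.trans hj'.le))).mul
      (h _ (Nat.sub_le _ _))

/-- The moments of a measure on `ℝ`. -/
noncomputable def momentSeq (ν : Measure ℝ) (j : ℕ) : ℝ := ∫ x, x ^ j ∂ν

theorem momentSeq_zero (ν : Measure ℝ) [IsProbabilityMeasure ν] : momentSeq ν 0 = 1 := by
  simp [momentSeq]

/-! ### Appell polynomials expressed through moments -/

section Probability

variable {ν : Measure ℝ} [IsProbabilityMeasure ν] {k : ℕ}

theorem charFun_ne_zero_eventually (ν : Measure ℝ) [IsProbabilityMeasure ν] :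
    ∀ᶠ u in 𝓝 (0 : ℝ), charFun ν u ≠ 0 :=
  (continuous_charFun (μ := ν)).continuousAt.eventually_ne (by simp [charFun_zero])

theorem contDiffAt_inv_charFun (hk : MemLp id k ν) :
    ContDiffAt ℝ k (fun u => (charFun ν u)⁻¹) 0 :=
  (contDiff_charFun hk).contDiffAt.inv (by simp [charFun_zero])

theorem contDiffAt_appell_generating (hk : MemLp id k ν) (x : ℝ) :
    ContDiffAt ℝ k (fun u : ℝ => Complex.exp (Complex.I * u * x) / charFun ν u) 0 := by
  have h1 : ContDiffAt ℝ k (fun u : ℝ => Complex.exp (Complex.I * u * x)) 0 := by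
    refine ContDiffAt.cexp ?_
    exact ((contDiffAt_const.mul Complex.ofRealCLM.contDiff.contDiffAt).mul contDiffAt_const)
  simpa only [div_eq_mul_inv] using h1.mul (contDiffAt_inv_charFun hk)

theorem memLp_id_mono (hk : MemLp id k ν) {j : ℕ} (hj : j ≤ k) : MemLp id j ν :=
  hk.mono_exponent (by exact_mod_cast hj)

/-- Differentiating `φ⁻¹ φ = 1` at `0` by the Leibniz rule, with `φ^{(j)}(0) = i^j m_j`, gives the
recursion that defines `appellCoeff`. The powers of `-i` absorb those of `i`, so the result is real.
-/
theorem iteratedDeriv_inv_charFun (hk : MemLp id k ν) {n : ℕ} (hn : n ≤ k) :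
    (-Complex.I) ^ n * iteratedDeriv n (fun u => (charFun ν u)⁻¹) 0
      = (appellCoeff (momentSeq ν) n : ℂ) := by
  induction n using Nat.strong_induction_on with
  | _ n ih =>
    rcases eq_or_ne n 0 with rfl | hn0
    · simp [appellCoeff_zero, charFun_zero]
    have hnk := memLp_id_mono hk hn
    have h1 : iteratedDeriv n (fun u => (charFun ν u)⁻¹ * charFun ν u) 0 = 0 := by
      have : (fun u => (charFun ν u)⁻¹ * charFun ν u) =ᶠ[𝓝 0] fun _ => (1 : ℂ) := by
        filter_upwards [charFun_ne_zero_eventually ν] with u hu using inv_mul_cancel₀ hu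
      rw [this.iteratedDeriv_eq, iteratedDeriv_const, if_neg hn0]
    rw [iteratedDeriv_fun_mul (contDiffAt_inv_charFun hnk) (contDiff_charFun hnk).contDiffAt] at h1
    have h2 : ∑ j ∈ Finset.range (n + 1), (n.choose j : ℂ) *
        ((-Complex.I) ^ j * iteratedDeriv j (fun u => (charFun ν u)⁻¹) 0) *
          (momentSeq ν (n - j) : ℂ) = 0 := by
      have := congrArg (fun c => (-Complex.I) ^ n * c) h1
      simp only [mul_zero, Finset.mul_sum] at this
      rw [← this]
      refine Finset.sum_congr rfl fun j hj => ?_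
      have hj' : j ≤ n := Nat.lt_succ_iff.1 (Finset.mem_range.1 hj)
      rw [iteratedDeriv_charFun_zero (memLp_id_mono hnk (Nat.sub_le n j))]
      have e : (-Complex.I) ^ n = (-Complex.I) ^ j * (-Complex.I) ^ (n - j) := by
        rw [← pow_add, Nat.add_sub_cancel' hj']
      have e2 : (-Complex.I) ^ (n - j) * Complex.I ^ (n - j) = 1 := by
        rw [← mul_pow]; simp
      rw [e, momentSeq]
      linear_combination -(n.choose j : ℂ) * (-Complex.I) ^ j *
        iteratedDeriv j (fun u => (charFun ν u)⁻¹) 0 * (∫ x, x ^ (n - j) ∂ν : ℝ) * e2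
    rw [Finset.sum_range_succ] at h2
    rw [appellCoeff_of_ne_zero _ hn0]
    have h3 : ∑ j ∈ Finset.range n, (n.choose j : ℂ) *
        ((-Complex.I) ^ j * iteratedDeriv j (fun u => (charFun ν u)⁻¹) 0) *
          (momentSeq ν (n - j) : ℂ) = ∑ j ∈ Finset.range n, (n.choose j : ℂ) *
        (appellCoeff (momentSeq ν) j : ℂ) * (momentSeq ν (n - j) : ℂ) :=
      Finset.sum_congr rfl fun j hj => by
        have hj' := Finset.mem_range.1 hj
        rw [ih j hj' (hj'.le.trans hn)]
    rw [h3] at h2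
    simp only [Nat.choose_self, Nat.cast_one, one_mul, Nat.sub_self, momentSeq_zero,
      Complex.ofReal_one, mul_one] at h2
    push_cast
    linear_combination h2

theorem iteratedDeriv_cexp_I_mul (x : ℝ) (n : ℕ) :
    iteratedDeriv n (fun u : ℝ => Complex.exp (Complex.I * u * x)) 0 = (Complex.I * x) ^ n := by
  have h : ∀ n : ℕ, iteratedDeriv n (fun u : ℝ => Complex.exp (Complex.I * u * x)) =
      fun u : ℝ => (Complex.I * x) ^ n * Complex.exp (Complex.I * u * x) := by
    intro n
    induction n with
    | zero => simp
    | succ n ih =>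
      rw [iteratedDeriv_succ, ih]
      funext u
      have h1 : HasDerivAt (fun u : ℝ => Complex.I * u * x) (Complex.I * 1 * x) u :=
        ((Complex.ofRealCLM.hasDerivAt (x := u)).const_mul _).mul_const _
      rw [(h1.cexp.const_mul _).deriv]
      ring
  rw [h]; simp

/-- The Appell polynomial in terms of the moments, before taking the real part. -/
theorem appell_complex_eq (hk : MemLp id k ν) (x : ℝ) :
    (-Complex.I) ^ k *
      iteratedDeriv k (fun u : ℝ => Complex.exp (Complex.I * u * x) / charFun ν u) 0 =
    ((∑ j ∈ Finset.range (k + 1),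
      (k.choose j : ℝ) * appellCoeff (momentSeq ν) j * x ^ (k - j) : ℝ) : ℂ) := by
  have h1 : ContDiffAt ℝ k (fun u : ℝ => Complex.exp (Complex.I * u * x)) 0 := by
    refine ContDiffAt.cexp ?_
    exact ((contDiffAt_const.mul Complex.ofRealCLM.contDiff.contDiffAt).mul contDiffAt_const)
  have h0 : (fun u : ℝ => Complex.exp (Complex.I * u * x) / charFun ν u) =
      fun u => (charFun ν u)⁻¹ * Complex.exp (Complex.I * u * x) := by
    funext u; rw [div_eq_inv_mul]
  rw [h0, iteratedDeriv_fun_mul (contDiffAt_inv_charFun hk) h1, Finset.mul_sum]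
  push_cast
  refine Finset.sum_congr rfl fun j hj => ?_
  have hj' : j ≤ k := Nat.lt_succ_iff.1 (Finset.mem_range.1 hj)
  rw [iteratedDeriv_cexp_I_mul, ← iteratedDeriv_inv_charFun hk hj', mul_pow]
  have e : (-Complex.I) ^ k = (-Complex.I) ^ j * (-Complex.I) ^ (k - j) := by
    rw [← pow_add, Nat.add_sub_cancel' hj']
  have e2 : (-Complex.I) ^ (k - j) * Complex.I ^ (k - j) = 1 := by
    rw [← mul_pow]; simp
  rw [e]
  linear_combination (k.choose j : ℂ) * (-Complex.I) ^ j *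
        iteratedDeriv j (fun u => (charFun ν u)⁻¹) 0 * (x : ℂ) ^ (k - j) * e2

theorem appell_eq_sum (hk : MemLp id k ν) (x : ℝ) :
    appell ν k x = ∑ j ∈ Finset.range (k + 1),
      (k.choose j : ℝ) * appellCoeff (momentSeq ν) j * x ^ (k - j) := by
  rw [appell, appell_complex_eq hk, Complex.ofReal_re]

theorem appell_complex_eq_ofReal (hk : MemLp id k ν) (x : ℝ) :
    (-Complex.I) ^ k *
      iteratedDeriv k (fun u : ℝ => Complex.exp (Complex.I * u * x) / charFun ν u) 0 =
    (appell ν k x : ℂ) := by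
  rw [appell_complex_eq hk, appell_eq_sum hk]

theorem measurable_appell (hk : MemLp id k ν) : Measurable (appell ν k) := by
  rw [show appell ν k = _ from funext (appell_eq_sum hk)]
  fun_prop

theorem memLp_id_zero (ν : Measure ℝ) [IsProbabilityMeasure ν] :
    MemLp id ((0 : ℕ) : ℝ≥0∞) ν := by
  simpa using aestronglyMeasurable_id

theorem appell_zero (x : ℝ) : appell ν 0 x = 1 := by
  rw [appell_eq_sum (memLp_id_zero ν)]; simp [appellCoeff_zero]

theorem integrable_pow_of_memLp (hk : MemLp id k ν) {j : ℕ} (hj : j ≤ k) :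
    Integrable (fun x : ℝ => x ^ j) ν := by
  have := (memLp_id_mono hk hj).integrable_norm_pow'
  refine (integrable_norm_iff (by fun_prop)).1 ?_
  simpa [norm_pow] using this

/-- Integrating the polynomial term by term gives the order `k` coefficient of `M⁻¹ · M`. -/
theorem integral_appell (hk : MemLp id k ν) (h0 : k ≠ 0) : ∫ x, appell ν k x ∂ν = 0 := by
  simp only [appell_eq_sum hk]
  rw [integral_finsetSum _ fun j _ =>
    (integrable_pow_of_memLp hk (Nat.sub_le _ _)).const_mul _]
  simp only [integral_const_mul]
  exact sum_choose_appellCoeff_mul (momentSeq_zero ν) h0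

theorem memLp_appell (hk : MemLp id ((2 * k : ℕ) : ℝ≥0∞) ν) : MemLp (appell ν k) 2 ν := by
  have hk' : MemLp id k ν := memLp_id_mono hk (by omega)
  rw [show appell ν k = _ from funext (appell_eq_sum hk')]
  refine memLp_finsetSum _ fun j _ => MemLp.const_mul ?_ _
  rw [memLp_two_iff_integrable_sq (by fun_prop)]
  simp only [← pow_mul]
  exact integrable_pow_of_memLp hk (by omega)

theorem appell_one (hk : MemLp id ((1 : ℕ) : ℝ≥0∞) ν) (h0 : ∫ x, x ∂ν = 0) (x : ℝ) :
    appell ν 1 x = x := by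
  rw [appell_eq_sum hk]
  simp [Finset.sum_range_succ, appellCoeff_zero, appellCoeff_of_ne_zero, momentSeq, h0]

theorem memLp_map_mul (hk : MemLp id k ν) (c : ℝ) : MemLp id k (ν.map (c * ·)) := by
  rw [memLp_map_measure_iff aestronglyMeasurable_id (by fun_prop)]
  exact hk.const_mul c

/-- Rescaling the variable by `c` rescales `m_j`, hence the `j`-th coefficient, by `c^j`; `A_k` is
therefore homogeneous. This is how the weights `c w` come out of the Wick products. -/
theorem appell_map_mul (hk : MemLp id k ν) (c x : ℝ) :
    appell (ν.map (c * ·)) k (c * x) = c ^ k * appell ν k x := by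
  have : IsProbabilityMeasure (ν.map (c * ·)) :=
    Measure.isProbabilityMeasure_map (by fun_prop)
  have hm : momentSeq (ν.map (c * ·)) = fun j => c ^ j * momentSeq ν j := by
    funext j
    rw [momentSeq, integral_map (by fun_prop) (by fun_prop)]
    simp only [mul_pow, integral_const_mul, momentSeq]
  rw [appell_eq_sum (memLp_map_mul hk c), appell_eq_sum hk, hm, Finset.mul_sum]
  refine Finset.sum_congr rfl fun j hj => ?_
  have hj' : j ≤ k := Nat.lt_succ_iff.1 (Finset.mem_range.1 hj)
  have e : c ^ k = c ^ j * c ^ (k - j) := by rw [← pow_add, Nat.add_sub_cancel' hj']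
  rw [appellCoeff_scale, e]
  ring

end Probability

/-! ### The Leibniz rule for a finite product -/

/-- The sum runs over maps recording which factor each of the `k` derivatives hits. Indexing by maps
instead of multiplicities avoids multinomial coefficients and matches the sums over tuples of
lattice points. -/
theorem iteratedDeriv_prod_eq_sum {ι : Type*} [DecidableEq ι] (T : Finset ι) (k : ℕ)
    (g : ι → ℝ → ℂ) (x : ℝ) (hg : ∀ p ∈ T, ContDiffAt ℝ k (g p) x) :
    iteratedDeriv k (fun u => ∏ p ∈ T, g p u) x =
      ∑ f ∈ Fintype.piFinset (fun _ : Fin k => T),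
        ∏ p ∈ T, iteratedDeriv (Finset.univ.filter fun j => f j = p).card (g p) x := by
  induction k generalizing x with
  | zero => simp
  | succ k ih =>
    -- The formula of order `k` will be differentiated, so it is needed on a neighbourhood and not
    -- only at `x`.
    have hev : ∀ᶠ y in 𝓝 x, ∀ p ∈ T, ContDiffAt ℝ (k + 1 : ℕ) (g p) y := by
      rw [Filter.eventually_all_finset]
      intro p hp
      exact (hg p hp).eventually (by simp)
    have heq : iteratedDeriv k (fun u => ∏ p ∈ T, g p u) =ᶠ[𝓝 x] fun y =>
        ∑ f ∈ Fintype.piFinset (fun _ : Fin k => T),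
          ∏ p ∈ T, iteratedDeriv (Finset.univ.filter fun j => f j = p).card (g p) y := by
      filter_upwards [hev] with y hy
      exact ih y fun p hp => (hy p hp).of_le (by exact_mod_cast Nat.le_succ k)
    rw [iteratedDeriv_succ, heq.deriv_eq]
    have hd : ∀ p ∈ T, ∀ m ≤ k, HasDerivAt (iteratedDeriv m (g p))
        (iteratedDeriv (m + 1) (g p) x) x := by
      intro p hp m hm
      rw [iteratedDeriv_succ]
      refine DifferentiableAt.hasDerivAt ?_
      simp only [← iteratedDerivWithin_univ]
      rw [← differentiableWithinAt_univ]
      exact ContDiffWithinAt.differentiableWithinAt_iteratedDerivWithin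
        ((hg p hp).contDiffWithinAt) (by exact_mod_cast Nat.lt_succ_of_le hm)
        (by simp)
    have hcard : ∀ (f : Fin k → ι) (p : ι), (Finset.univ.filter fun j => f j = p).card ≤ k :=
      fun f p => (Finset.card_filter_le _ _).trans (by simp)
    have h1 : HasDerivAt (fun y => ∑ f ∈ Fintype.piFinset (fun _ : Fin k => T),
          ∏ p ∈ T, iteratedDeriv (Finset.univ.filter fun j => f j = p).card (g p) y)
        (∑ f ∈ Fintype.piFinset (fun _ : Fin k => T), ∑ q ∈ T,
          (∏ p ∈ T.erase q, iteratedDeriv (Finset.univ.filter fun j => f j = p).card (g p) x) •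
            iteratedDeriv ((Finset.univ.filter fun j => f j = q).card + 1) (g q) x) x := by
      refine HasDerivAt.fun_sum fun f _ => ?_
      exact HasDerivAt.fun_finsetProd fun p hp => hd p hp _ (hcard f p)
    rw [h1.deriv, ← Finset.sum_product']
    -- The new derivative hits the factor `q`; prepending `q` to `f` gives the tuple of length `k +
    -- 1`.
    refine Finset.sum_bij' (fun fq _ => Fin.cons fq.2 fq.1) (fun f _ => (Fin.tail f, f 0))
      ?_ ?_ ?_ ?_ ?_
    · rintro ⟨f, q⟩ h
      simp only [Finset.mem_product, Fintype.mem_piFinset] at h ⊢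
      intro j
      refine Fin.cases ?_ (fun j => ?_) j
      · simpa using h.2
      · simpa using h.1 j
    · intro f h
      simp only [Finset.mem_product, Fintype.mem_piFinset] at h ⊢
      exact ⟨fun j => h _, h 0⟩
    · rintro ⟨f, q⟩ h
      simp
    · intro f h
      simp
    · rintro ⟨f, q⟩ h
      simp only [Finset.mem_product, Fintype.mem_piFinset] at h
      have hc : ∀ p, (Finset.univ.filter fun j => (Fin.cons q f : Fin (k + 1) → ι) j = p).card =
          (if q = p then 1 else 0) + (Finset.univ.filter fun j => f j = p).card := by
        intro p
        rw [Finset.card_filter, Finset.card_filter, Fin.sum_univ_succ]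
        simp
      rw [← Finset.prod_erase_mul T _ h.2, smul_eq_mul]
      congr 1
      · refine Finset.prod_congr rfl fun p hp => ?_
        rw [hc, if_neg (Finset.ne_of_mem_erase hp).symm, zero_add]
      · rw [hc, if_pos rfl, add_comm]

/-! ### Powers, moments and products of independent variables -/

theorem memLp_natCast_iff_integrable_abs_pow {Ω : Type*} [MeasurableSpace Ω] {μ : Measure Ω}
    {f : Ω → ℝ} (hf : AEStronglyMeasurable f μ) {n : ℕ} (hn : n ≠ 0) :
    MemLp f n μ ↔ Integrable (fun ω => |f ω| ^ n) μ := by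
  rw [← integrable_norm_rpow_iff hf (by exact_mod_cast hn) (by simp)]
  simp

theorem integrable_pow_of_memLp_comp {Ω : Type*} [MeasurableSpace Ω] {μ : Measure Ω}
    [IsProbabilityMeasure μ] {f : Ω → ℝ} {n : ℕ} (hf : MemLp f n μ) {j : ℕ} (hj : j ≤ n) :
    Integrable (fun ω => f ω ^ j) μ := by
  have := (hf.mono_exponent (p := (j : ℝ≥0∞)) (by exact_mod_cast hj)).integrable_norm_pow'
  refine (integrable_norm_iff (hf.1.pow j)).1 ?_
  simpa [norm_pow] using this

theorem abs_pow_le_one_add_abs_pow (x : ℝ) {i n : ℕ} (h : i ≤ n) : |x| ^ i ≤ 1 + |x| ^ n := by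
  rcases le_total |x| 1 with hx | hx
  · exact (pow_le_one₀ (abs_nonneg x) hx).trans (by have := pow_nonneg (abs_nonneg x) n; linarith)
  · exact (pow_le_pow_right₀ hx h).trans (by linarith)

section Noise

variable {Ω : Type*} [MeasurableSpace Ω] {μ : Measure Ω} [IsProbabilityMeasure μ]
  {ε : ℤ × ℤ → Ω → ℝ} {k : ℕ}

theorem IsStandardNoise.map_eq (hε : IsStandardNoise μ ε) (w : ℤ × ℤ) :
    μ.map (ε w) = μ.map (ε 0) := (hε.identDistrib w).map_eq

theorem IsStandardNoise.isProbabilityMeasure_map (hε : IsStandardNoise μ ε) (w : ℤ × ℤ) :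
    IsProbabilityMeasure (μ.map (ε w)) :=
  Measure.isProbabilityMeasure_map (hε.measurable w).aemeasurable

theorem IsStandardNoise.memLp (hε : IsStandardNoise μ ε) (hk : k ≠ 0)
    (hmom : Integrable (fun ω => |ε 0 ω| ^ (2 * k)) μ) (w : ℤ × ℤ) :
    MemLp (ε w) (2 * k : ℕ) μ := by
  rw [(hε.identDistrib w).memLp_iff]
  exact (memLp_natCast_iff_integrable_abs_pow (hε.measurable 0).aestronglyMeasurable
    (by omega)).2 hmom

theorem memLp_id_map {f : Ω → ℝ} (hf : AEMeasurable f μ) {p : ℝ≥0∞} (h : MemLp f p μ) :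
    MemLp id p (μ.map f) :=
  (memLp_map_measure_iff aestronglyMeasurable_id hf).2 h

theorem IsStandardNoise.iIndepFun_finset (hε : IsStandardNoise μ ε) (T : Finset (ℤ × ℤ)) :
    iIndepFun (fun p : T => ε p) μ := hε.indep.precomp Subtype.val_injective

theorem IsStandardNoise.integral_prod (hε : IsStandardNoise μ ε) (T : Finset (ℤ × ℤ))
    (h : ℤ × ℤ → ℝ → ℝ) (hh : ∀ p ∈ T, Measurable (h p)) :
    ∫ ω, ∏ p ∈ T, h p (ε p ω) ∂μ = ∏ p ∈ T, ∫ ω, h p (ε p ω) ∂μ := by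
  have := (hε.iIndepFun_finset T).integral_fun_prod_comp (f := fun p : T => h p)
    (fun p => (hε.measurable p).aemeasurable)
    (fun p => (hh p p.2).aestronglyMeasurable)
  rw [← Finset.prod_coe_sort T (fun p => ∫ ω, h p (ε p ω) ∂μ), ← this]
  congr with ω
  rw [← Finset.prod_coe_sort T (fun p => h p (ε p ω))]

theorem IsStandardNoise.integrable_prod (hε : IsStandardNoise μ ε) (T : Finset (ℤ × ℤ))
    (h : ℤ × ℤ → ℝ → ℝ) (hh : ∀ p ∈ T, Measurable (h p))
    (hi : ∀ p ∈ T, Integrable (fun ω => h p (ε p ω)) μ) :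
    Integrable (fun ω => ∏ p ∈ T, h p (ε p ω)) μ := by
  have hP : ∀ p : T, IsProbabilityMeasure (μ.map (ε p)) := fun p => hε.isProbabilityMeasure_map p
  have h1 : Integrable (fun x : T → ℝ => ∏ p : T, h p (x p))
      (Measure.pi fun p : T => μ.map (ε p)) := by
    refine Integrable.fintype_prod_dep fun p => ?_
    exact (integrable_map_measure (hh p p.2).aestronglyMeasurable
      (hε.measurable p).aemeasurable).2 (hi p p.2)
  have h3 := (hε.iIndepFun_finset T).map_fun_eq_pi_map fun p : T => (hε.measurable p).aemeasurable
  rw [← h3] at h1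
  have h2 := h1.comp_aemeasurable
    (aemeasurable_pi_lambda _ fun p : T => (hε.measurable p).aemeasurable)
  refine h2.congr (Eventually.of_forall fun ω => ?_)
  simp only [Function.comp]
  rw [← Finset.prod_coe_sort T (fun p => h p (ε p ω))]

/-! ### Wick products -/

/-- The multiplicity of `p` in the tuple `w`. -/
def mult (w : Fin k → ℤ × ℤ) (p : ℤ × ℤ) : ℕ := (Finset.univ.filter fun j => w j = p).card

theorem mult_le (w : Fin k → ℤ × ℤ) (p : ℤ × ℤ) : mult w p ≤ k :=
  (Finset.card_filter_le _ _).trans (by simp)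

theorem mult_eq_zero {w : Fin k → ℤ × ℤ} {p : ℤ × ℤ} :
    mult w p = 0 ↔ p ∉ Finset.univ.image w := by
  simp [mult, Finset.filter_eq_empty_iff]

theorem mult_eq_one_of_injective {w : Fin k → ℤ × ℤ} (hw : Function.Injective w) {p : ℤ × ℤ}
    (hp : p ∈ Finset.univ.image w) : mult w p = 1 := by
  obtain ⟨j, -, rfl⟩ := Finset.mem_image.1 hp
  rw [mult, Finset.card_eq_one]
  exact ⟨j, by ext i; simp [hw.eq_iff]⟩

theorem IsStandardNoise.appellOf_eq (hε : IsStandardNoise μ ε) (m : ℕ) (p : ℤ × ℤ) (ω : Ω) :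
    appellOf μ m (ε p) ω = appell (μ.map (ε 0)) m (ε p ω) := by
  rw [appellOf, hε.map_eq]

/-- Points outside the tuple contribute `A_0 = 1`, so the product may run over any larger finite
set. Two Wick products can thus be multiplied over a common set of points. -/
theorem IsStandardNoise.wick_eq (hε : IsStandardNoise μ ε) (w : Fin k → ℤ × ℤ)
    {T : Finset (ℤ × ℤ)} (hT : Finset.univ.image w ⊆ T) (ω : Ω) :
    wick μ ε w ω = ∏ p ∈ T, appell (μ.map (ε 0)) (mult w p) (ε p ω) := by
  have := hε.isProbabilityMeasure_map 0
  rw [wick]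
  simp only [hε.appellOf_eq]
  refine Finset.prod_subset hT fun p _ hp => ?_
  change appell _ (mult w p) _ = 1
  rw [mult_eq_zero.2 hp, appell_zero]

theorem IsStandardNoise.memLp_id (hε : IsStandardNoise μ ε) (hk : k ≠ 0)
    (hmom : Integrable (fun ω => |ε 0 ω| ^ (2 * k)) μ) {n : ℕ} (hn : n ≤ 2 * k) :
    MemLp id n (μ.map (ε 0)) := by
  have := hε.isProbabilityMeasure_map 0
  exact memLp_id_mono (memLp_id_map (hε.measurable 0).aemeasurable (hε.memLp hk hmom 0)) hn

theorem IsStandardNoise.wick_of_injective (hε : IsStandardNoise μ ε) (hk : k ≠ 0)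
    (hmom : Integrable (fun ω => |ε 0 ω| ^ (2 * k)) μ)
    {w : Fin k → ℤ × ℤ} (hw : Function.Injective w) (ω : Ω) :
    wick μ ε w ω = ∏ j, ε (w j) ω := by
  have := hε.isProbabilityMeasure_map 0
  rw [hε.wick_eq w subset_rfl, ← Finset.prod_image (g := w) (f := fun p => ε p ω) hw.injOn]
  refine Finset.prod_congr rfl fun p hp => ?_
  rw [mult_eq_one_of_injective hw hp, appell_one (hε.memLp_id hk hmom (by omega))]
  rw [integral_map (hε.measurable 0).aemeasurable (by fun_prop)]
  exact hε.mean_zero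

/-- The Appell polynomial of a finite linear combination of the noise variables. -/
theorem IsStandardNoise.appell_sum (hε : IsStandardNoise μ ε) (hk : k ≠ 0)
    (hmom : Integrable (fun ω => |ε 0 ω| ^ (2 * k)) μ) (c : ℤ × ℤ → ℝ) (T : Finset (ℤ × ℤ))
    (ω : Ω) :
    appellOf μ k (fun ω => ∑ w ∈ T, c w * ε w ω) ω =
      ∑ f ∈ Fintype.piFinset (fun _ : Fin k => T), (∏ j, c (f j)) * wick μ ε f ω := by
  have hP := hε.isProbabilityMeasure_map 0
  have hSm : Measurable (fun ω => ∑ w ∈ T, c w * ε w ω) :=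
    Finset.measurable_sum _ fun w _ => (hε.measurable w).const_mul _
  have hSp : IsProbabilityMeasure (μ.map fun ω => ∑ w ∈ T, c w * ε w ω) :=
    Measure.isProbabilityMeasure_map hSm.aemeasurable
  have hScale : ∀ p, μ.map (fun ω => c p * ε p ω) = (μ.map (ε 0)).map (c p * ·) := by
    intro p
    rw [← hε.map_eq p, Measure.map_map (by fun_prop) (hε.measurable p)]
    rfl
  have hSk : MemLp id k (μ.map fun ω => ∑ w ∈ T, c w * ε w ω) := by
    refine memLp_id_map hSm.aemeasurable (memLp_finsetSum _ fun w _ => ?_)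
    exact ((hε.memLp hk hmom w).mono_exponent (by exact_mod_cast (by omega))).const_mul _
  have hpk : ∀ p, ∀ m ≤ k, MemLp id m ((μ.map (ε 0)).map (c p * ·)) := fun p m hm =>
    memLp_map_mul (hε.memLp_id hk hmom (by omega)) _
  have hpP : ∀ p, IsProbabilityMeasure ((μ.map (ε 0)).map (c p * ·)) := fun p =>
    Measure.isProbabilityMeasure_map (by fun_prop)
  have hchar : ∀ u, charFun (μ.map fun ω => ∑ w ∈ T, c w * ε w ω) u =
      ∏ p ∈ T, charFun ((μ.map (ε 0)).map (c p * ·)) u := by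
    intro u
    have hind : iIndepFun (fun p => fun ω => c p * ε p ω) μ :=
      hε.indep.comp (fun p x => c p * x) fun p => by fun_prop
    rw [(hind.restrict T).charFun_map_fun_finsetSum_eq_prod fun p _ =>
      ((hε.measurable p).const_mul _).aemeasurable, Finset.prod_apply]
    exact Finset.prod_congr rfl fun p _ => by rw [hScale]
  -- Exponentials and characteristic functions of independent terms both multiply, so the generating
  -- function is a product over `T` and the Leibniz rule for products applies.
  have hgen : (fun u : ℝ => Complex.exp (Complex.I * u * (∑ w ∈ T, c w * ε w ω : ℝ)) /
      charFun (μ.map fun ω => ∑ w ∈ T, c w * ε w ω) u) =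
      fun u : ℝ => ∏ p ∈ T, Complex.exp (Complex.I * u * (c p * ε p ω : ℝ)) /
        charFun ((μ.map (ε 0)).map (c p * ·)) u := by
    funext u
    rw [hchar, Finset.prod_div_distrib, ← Complex.exp_sum, Complex.ofReal_sum, Finset.mul_sum]
  have hfin : (appell (μ.map fun ω => ∑ w ∈ T, c w * ε w ω) k (∑ w ∈ T, c w * ε w ω) : ℂ) =
      ((∑ f ∈ Fintype.piFinset (fun _ : Fin k => T), (∏ j, c (f j)) * wick μ ε f ω : ℝ) : ℂ) := by
    rw [← appell_complex_eq_ofReal hSk, hgen, iteratedDeriv_prod_eq_sum _ _ _ _ fun p _ =>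
      contDiffAt_appell_generating (hpk p k le_rfl) _, Finset.mul_sum, Complex.ofReal_sum]
    refine Finset.sum_congr rfl fun f hf => ?_
    rw [Fintype.mem_piFinset] at hf
    have hfT : Finset.univ.image f ⊆ T := by
      intro p hp
      obtain ⟨j, -, rfl⟩ := Finset.mem_image.1 hp
      exact hf j
    have hkcard : ∑ p ∈ T, mult f p = k := by
      have := Finset.card_eq_sum_card_fiberwise (s := Finset.univ) (f := f) (t := T)
        (fun j _ => hf j)
      simpa [mult] using this.symm
    have e : (-Complex.I) ^ k = ∏ p ∈ T, (-Complex.I) ^ mult f p := by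
      rw [Finset.prod_pow_eq_pow_sum, hkcard]
    rw [e, ← Finset.prod_mul_distrib]
    have e2 : (∏ j, c (f j)) = ∏ p ∈ T, c p ^ mult f p := by
      rw [Finset.prod_comp]
      refine Finset.prod_subset hfT fun p _ hp => ?_
      change c p ^ mult f p = 1
      rw [mult_eq_zero.2 hp, pow_zero]
    rw [hε.wick_eq f hfT, e2, ← Finset.prod_mul_distrib, Complex.ofReal_prod]
    refine Finset.prod_congr rfl fun p _ => ?_
    rw [← appell_map_mul (hε.memLp_id hk hmom (by have := mult_le f p; omega)),
      ← appell_complex_eq_ofReal (hpk p _ (mult_le f p))]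
    rfl
  exact_mod_cast hfin

/-! ### A moment bound for linear combinations of the noise -/

/-- Adding one variable multiplies `W = 1 + E S^{2k}` by at most `1 + K c_p² ≤ exp(K c_p²)`: in the
binomial expansion the term linear in `c_p` vanishes by centring, and all higher ones carry `c_p²`.
The bound depends on `T` only through `∑ c²`, as an infinite linear combination requires. -/
theorem IsStandardNoise.moment_bound (hε : IsStandardNoise μ ε) (hk : k ≠ 0)
    (hmom : Integrable (fun ω => |ε 0 ω| ^ (2 * k)) μ) (c : ℤ × ℤ → ℝ) {B : ℝ}
    (hB : ∀ w, |c w| ≤ B) :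
    ∃ K : ℝ, 0 ≤ K ∧ ∀ T : Finset (ℤ × ℤ),
      1 + ∫ ω, (∑ w ∈ T, c w * ε w ω) ^ (2 * k) ∂μ ≤ Real.exp (K * ∑ w ∈ T, c w ^ 2) := by
  set N := 2 * k with hN
  have hB0 : 0 ≤ B := (abs_nonneg _).trans (hB 0)
  set M : ℝ := 1 + ∫ ω, |ε 0 ω| ^ N ∂μ with hM
  have hM0 : 0 ≤ M := add_nonneg zero_le_one (integral_nonneg fun ω => by positivity)
  -- `2^N` is the sum of the binomial coefficients, `(1 + B)^N` bounds the powers of `|c p|` beyond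
  -- the second, and `M` bounds the noise moments.
  refine ⟨2 ^ N * ((1 + B) ^ N * M), by positivity, fun T => ?_⟩
  have hLp : ∀ T : Finset (ℤ × ℤ), MemLp (fun ω => ∑ w ∈ T, c w * ε w ω) N μ := fun T =>
    memLp_finsetSum _ fun w _ => (hε.memLp hk hmom w).const_mul _
  induction T using Finset.induction_on with
  | empty => simp [hN, hk]
  | insert p T hp ih =>
    set S : Ω → ℝ := fun ω => ∑ w ∈ T, c w * ε w ω with hS
    set W : ℝ := 1 + ∫ ω, S ω ^ N ∂μ with hW
    have hev : Even N := even_two_mul k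
    have hSN : 0 ≤ ∫ ω, S ω ^ N ∂μ := integral_nonneg fun ω => hev.pow_nonneg _
    have hW0 : 0 ≤ W := by linarith
    -- The coefficient at `p` is replaced by `1` so that the independent family contains `ε p`
    -- itself, even if `c p = 0`.
    have hind : IndepFun S (ε p) μ := by
      have hind0 : iIndepFun (fun q => fun ω => (if q = p then (1 : ℝ) else c q) * ε q ω) μ :=
        hε.indep.comp (fun q x => (if q = p then (1 : ℝ) else c q) * x) fun q => by fun_prop
      have := hind0.indepFun_finsetSum_of_notMem
        (fun q => (hε.measurable q).const_mul _) hp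
      convert this using 1
      · funext ω
        rw [Finset.sum_apply]
        refine Finset.sum_congr rfl fun q hq => ?_
        rw [if_neg (ne_of_mem_of_not_mem hq hp)]
      · funext ω; simp
    -- The index `j = N` reproduces `E S^N`, the index `j = N - 1` gives zero because the noise is
    -- centred, and for the others `|E S^j| ≤ W`.
    have hterm : ∀ j, j ≤ N → ∫ ω, S ω ^ j * (c p * ε p ω) ^ (N - j) * (N.choose j : ℝ) ∂μ ≤
        (if j = N then ∫ ω, S ω ^ N ∂μ else 0) +
          (N.choose j : ℝ) * (c p ^ 2 * ((1 + B) ^ N * M * W)) := by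
      intro j hj
      have hfac : ∫ ω, S ω ^ j * (c p * ε p ω) ^ (N - j) * (N.choose j : ℝ) ∂μ =
          (∫ ω, S ω ^ j ∂μ) * (c p ^ (N - j) * ∫ ω, ε p ω ^ (N - j) ∂μ) * (N.choose j : ℝ) := by
        rw [integral_mul_const]
        congr 1
        rw [← integral_const_mul]
        simp only [mul_pow]
        have h2 : IndepFun (fun ω => S ω ^ j) (fun ω => c p ^ (N - j) * ε p ω ^ (N - j)) μ :=
          hind.comp (φ := fun x => x ^ j) (ψ := fun x => c p ^ (N - j) * x ^ (N - j))
            (by fun_prop) (by fun_prop)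
        exact h2.integral_fun_mul_eq_mul_integral ((hLp T).1.pow j)
          (((hε.measurable p).pow_const _).const_mul _).aestronglyMeasurable
      have hnn : 0 ≤ (N.choose j : ℝ) * (c p ^ 2 * ((1 + B) ^ N * M * W)) := by positivity
      rw [hfac]
      rcases eq_or_ne j N with rfl | hjN
      · rw [if_pos rfl]
        simp only [Nat.sub_self, pow_zero, integral_const, probReal_univ, smul_eq_mul, mul_one,
          Nat.choose_self, Nat.cast_one] at hnn ⊢
        linarith
      rw [if_neg hjN, zero_add]
      rcases eq_or_ne (N - j) 1 with h1 | h1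
      · rw [h1]
        simp only [pow_one]
        rw [(hε.identDistrib p).integral_eq, hε.mean_zero]
        simpa using hnn
      obtain ⟨i, hi⟩ : ∃ i, N - j = i + 2 := ⟨N - j - 2, by omega⟩
      have hSj : |∫ ω, S ω ^ j ∂μ| ≤ W := by
        refine (abs_integral_le_integral_abs).trans ?_
        have : W = ∫ ω, (1 + S ω ^ N) ∂μ := by
          rw [integral_add (integrable_const _) (integrable_pow_of_memLp_comp (hLp T) le_rfl)]
          simp [hW, hS]
        rw [this]
        refine integral_mono (integrable_pow_of_memLp_comp (hLp T) hj).abs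
          ((integrable_const _).add (integrable_pow_of_memLp_comp (hLp T) le_rfl)) fun ω => ?_
        have := abs_pow_le_one_add_abs_pow (S ω) hj
        simpa only [abs_pow, hev.pow_abs] using this
      have hεj : |∫ ω, ε p ω ^ (N - j) ∂μ| ≤ M := by
        refine (abs_integral_le_integral_abs).trans ?_
        have : M = ∫ ω, (1 + |ε p ω| ^ N) ∂μ := by
          have e : ∫ ω, |ε p ω| ^ N ∂μ = ∫ ω, |ε 0 ω| ^ N ∂μ :=
            ((hε.identDistrib p).comp (u := fun x => |x| ^ N) (by fun_prop)).integral_eq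
          have hI : Integrable (fun ω => |ε p ω| ^ N) μ := by
            have := (integrable_pow_of_memLp_comp (hε.memLp hk hmom p) le_rfl).abs
            simpa only [abs_pow] using this
          rw [integral_add (integrable_const _) hI, e]
          simp [hM]
        rw [this]
        refine integral_mono
          (integrable_pow_of_memLp_comp (hε.memLp hk hmom p) (Nat.sub_le _ _)).abs
          ((integrable_const _).add ?_) fun ω => ?_
        · have := (integrable_pow_of_memLp_comp (hε.memLp hk hmom p) le_rfl).abs
          simpa only [abs_pow] using this
        · simpa only [abs_pow] using abs_pow_le_one_add_abs_pow (ε p ω) (Nat.sub_le N j)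
      have hc : |c p ^ (N - j)| ≤ c p ^ 2 * (1 + B) ^ N := by
        rw [hi, pow_add, abs_mul, abs_pow, abs_pow, sq_abs, mul_comm]
        refine mul_le_mul_of_nonneg_left ?_ (sq_nonneg _)
        calc |c p| ^ i ≤ (1 + B) ^ i :=
              pow_le_pow_left₀ (abs_nonneg _) ((hB p).trans (by linarith)) _
          _ ≤ (1 + B) ^ N := pow_le_pow_right₀ (by linarith) (by omega)
      calc (∫ ω, S ω ^ j ∂μ) * (c p ^ (N - j) * ∫ ω, ε p ω ^ (N - j) ∂μ) * (N.choose j : ℝ)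
          ≤ |(∫ ω, S ω ^ j ∂μ) * (c p ^ (N - j) * ∫ ω, ε p ω ^ (N - j) ∂μ)| * (N.choose j : ℝ) :=
            mul_le_mul_of_nonneg_right (le_abs_self _) (Nat.cast_nonneg _)
        _ ≤ (W * (c p ^ 2 * (1 + B) ^ N * M)) * (N.choose j : ℝ) := by
            rw [abs_mul, abs_mul]
            gcongr
        _ = _ := by ring
    have hexp : ∫ ω, (∑ w ∈ insert p T, c w * ε w ω) ^ N ∂μ ≤
        ∫ ω, S ω ^ N ∂μ + 2 ^ N * (c p ^ 2 * ((1 + B) ^ N * M * W)) := by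
      have h1 : ∀ ω, (∑ w ∈ insert p T, c w * ε w ω) ^ N =
          ∑ j ∈ Finset.range (N + 1), S ω ^ j * (c p * ε p ω) ^ (N - j) * (N.choose j : ℝ) := by
        intro ω
        rw [Finset.sum_insert hp, add_comm, add_pow]
      simp only [h1]
      rw [integral_finsetSum]
      · calc _ ≤ ∑ j ∈ Finset.range (N + 1), ((if j = N then ∫ ω, S ω ^ N ∂μ else 0) +
              (N.choose j : ℝ) * (c p ^ 2 * ((1 + B) ^ N * M * W))) :=
              Finset.sum_le_sum fun j hj => hterm j (Nat.lt_succ_iff.1 (Finset.mem_range.1 hj))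
          _ = _ := by
              rw [Finset.sum_add_distrib, ← Finset.sum_mul, Finset.sum_ite_eq', if_pos (by simp)]
              congr 2
              exact_mod_cast Nat.sum_range_choose N
      · intro j hj
        have hj' : j ≤ N := Nat.lt_succ_iff.1 (Finset.mem_range.1 hj)
        refine Integrable.mul_const ?_ _
        have h2 : IndepFun (fun ω => S ω ^ j) (fun ω => (c p * ε p ω) ^ (N - j)) μ :=
          hind.comp (φ := fun x => x ^ j) (ψ := fun x => (c p * x) ^ (N - j))
            (by fun_prop) (by fun_prop)
        exact h2.integrable_mul (integrable_pow_of_memLp_comp (hLp T) hj')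
          (integrable_pow_of_memLp_comp ((hε.memLp hk hmom p).const_mul (c p)) (Nat.sub_le _ _))
    rw [Finset.sum_insert hp, mul_add, Real.exp_add]
    set K := 2 ^ N * ((1 + B) ^ N * M) with hK
    calc 1 + ∫ ω, (∑ w ∈ insert p T, c w * ε w ω) ^ N ∂μ
        ≤ (K * c p ^ 2 + 1) * W := by
          have e : (K * c p ^ 2 + 1) * W =
              1 + (∫ ω, S ω ^ N ∂μ + 2 ^ N * (c p ^ 2 * ((1 + B) ^ N * M * W))) := by
            rw [hK]; ring_nf; rw [hW]; ring
          rw [e]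
          linarith
      _ ≤ Real.exp (K * c p ^ 2) * Real.exp (K * ∑ w ∈ T, c w ^ 2) :=
          mul_le_mul (Real.add_one_le_exp _) ih hW0 (Real.exp_nonneg _)

end Noise

section WickMoments

variable {Ω : Type*} [MeasurableSpace Ω] {μ : Measure Ω} [IsProbabilityMeasure μ]
  {ε : ℤ × ℤ → Ω → ℝ} {k : ℕ}

/-! ### Second moments of Wick products -/

theorem IsStandardNoise.memLp_appell (hε : IsStandardNoise μ ε) (hk : k ≠ 0)
    (hmom : Integrable (fun ω => |ε 0 ω| ^ (2 * k)) μ) {m : ℕ} (hm : m ≤ k) (p : ℤ × ℤ) :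
    MemLp (fun ω => appell (μ.map (ε 0)) m (ε p ω)) 2 μ := by
  have := hε.isProbabilityMeasure_map 0
  have h := AnisoField.memLp_appell (hε.memLp_id hk hmom (n := 2 * m) (by omega))
  rw [← hε.map_eq p] at h
  have h2 := (memLp_map_measure_iff h.1 (hε.measurable p).aemeasurable).1 h
  rw [hε.map_eq p] at h2
  exact h2

theorem IsStandardNoise.measurable_appell (hε : IsStandardNoise μ ε) (hk : k ≠ 0)
    (hmom : Integrable (fun ω => |ε 0 ω| ^ (2 * k)) μ) {m : ℕ} (hm : m ≤ k) :
    Measurable (appell (μ.map (ε 0)) m) := by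
  have := hε.isProbabilityMeasure_map 0
  exact AnisoField.measurable_appell (hε.memLp_id hk hmom (by omega))

theorem IsStandardNoise.integral_appell (hε : IsStandardNoise μ ε) (hk : k ≠ 0)
    (hmom : Integrable (fun ω => |ε 0 ω| ^ (2 * k)) μ) {m : ℕ} (hm : m ≤ k) (hm0 : m ≠ 0)
    (p : ℤ × ℤ) : ∫ ω, appell (μ.map (ε 0)) m (ε p ω) ∂μ = 0 := by
  have := hε.isProbabilityMeasure_map 0
  rw [← integral_map (φ := ε p) (hε.measurable p).aemeasurable
    (hε.measurable_appell hk hmom hm).aestronglyMeasurable, hε.map_eq p]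
  exact AnisoField.integral_appell (hε.memLp_id hk hmom (by omega)) hm0

theorem IsStandardNoise.measurable_wick (hε : IsStandardNoise μ ε) (hk : k ≠ 0)
    (hmom : Integrable (fun ω => |ε 0 ω| ^ (2 * k)) μ) (w : Fin k → ℤ × ℤ) :
    Measurable (wick μ ε w) := by
  rw [show wick μ ε w = _ from funext (hε.wick_eq w subset_rfl)]
  exact Finset.measurable_prod _ fun p _ =>
    (hε.measurable_appell hk hmom (mult_le w p)).comp (hε.measurable p)

theorem IsStandardNoise.memLp_wick (hε : IsStandardNoise μ ε) (hk : k ≠ 0)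
    (hmom : Integrable (fun ω => |ε 0 ω| ^ (2 * k)) μ) (w : Fin k → ℤ × ℤ) :
    MemLp (wick μ ε w) 2 μ := by
  rw [memLp_two_iff_integrable_sq (hε.measurable_wick hk hmom w).aestronglyMeasurable]
  simp only [hε.wick_eq w subset_rfl, ← Finset.prod_pow]
  refine hε.integrable_prod _ (fun p x => appell (μ.map (ε 0)) (mult w p) x ^ 2) ?_ ?_
  · exact fun p _ => (hε.measurable_appell hk hmom (mult_le w p)).pow_const 2
  · exact fun p _ => (hε.memLp_appell hk hmom (mult_le w p) p).integrable_sq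

theorem IsStandardNoise.integral_wick (hε : IsStandardNoise μ ε) (hk : k ≠ 0)
    (hmom : Integrable (fun ω => |ε 0 ω| ^ (2 * k)) μ) (w : Fin k → ℤ × ℤ) :
    ∫ ω, wick μ ε w ω ∂μ = 0 := by
  simp only [hε.wick_eq w subset_rfl]
  rw [hε.integral_prod _ (fun p x => appell (μ.map (ε 0)) (mult w p) x)
    fun p _ => hε.measurable_appell hk hmom (mult_le w p)]
  have hmem : w ⟨0, Nat.pos_of_ne_zero hk⟩ ∈ Finset.univ.image w :=
    Finset.mem_image_of_mem _ (Finset.mem_univ _)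
  refine Finset.prod_eq_zero hmem ?_
  exact hε.integral_appell hk hmom (mult_le w _) (fun h => mult_eq_zero.1 h hmem) _

theorem IsStandardNoise.integral_wick_mul (hε : IsStandardNoise μ ε) (hk : k ≠ 0)
    (hmom : Integrable (fun ω => |ε 0 ω| ^ (2 * k)) μ) (w w' : Fin k → ℤ × ℤ) :
    ∫ ω, wick μ ε w ω * wick μ ε w' ω ∂μ =
      ∏ p ∈ Finset.univ.image w ∪ Finset.univ.image w',
        ∫ ω, appell (μ.map (ε 0)) (mult w p) (ε p ω) *
          appell (μ.map (ε 0)) (mult w' p) (ε p ω) ∂μ := by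
  have hfun : ∀ ω, wick μ ε w ω * wick μ ε w' ω =
      ∏ p ∈ Finset.univ.image w ∪ Finset.univ.image w', appell (μ.map (ε 0)) (mult w p) (ε p ω) *
        appell (μ.map (ε 0)) (mult w' p) (ε p ω) := fun ω => by
    rw [hε.wick_eq w (Finset.subset_union_left (s₂ := Finset.univ.image w')),
      hε.wick_eq w' (Finset.subset_union_right (s₁ := Finset.univ.image w)),
      ← Finset.prod_mul_distrib]
  simp only [hfun]
  exact hε.integral_prod _ (fun p x => appell (μ.map (ε 0)) (mult w p) x *
    appell (μ.map (ε 0)) (mult w' p) x) fun p _ =>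
      (hε.measurable_appell hk hmom (mult_le w p)).mul
        (hε.measurable_appell hk hmom (mult_le w' p))

/-- A point in one support and not in the other contributes `E A_m(ε) = 0` with `m ≥ 1`, which kills
the whole product. -/
theorem IsStandardNoise.integral_wick_mul_eq_zero (hε : IsStandardNoise μ ε) (hk : k ≠ 0)
    (hmom : Integrable (fun ω => |ε 0 ω| ^ (2 * k)) μ) {w w' : Fin k → ℤ × ℤ}
    (hw : Finset.univ.image w ≠ Finset.univ.image w') :
    ∫ ω, wick μ ε w ω * wick μ ε w' ω ∂μ = 0 := by
  have := hε.isProbabilityMeasure_map 0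
  have key : ∀ w w' : Fin k → ℤ × ℤ, ∀ p ∈ Finset.univ.image w, p ∉ Finset.univ.image w' →
      ∫ ω, wick μ ε w ω * wick μ ε w' ω ∂μ = 0 := by
    intro w w' p hp hp'
    rw [hε.integral_wick_mul hk hmom]
    refine Finset.prod_eq_zero (Finset.mem_union_left _ hp) ?_
    rw [mult_eq_zero.2 hp']
    simp only [appell_zero, mul_one]
    exact hε.integral_appell hk hmom (mult_le w _) (fun h => mult_eq_zero.1 h hp) _
  by_cases h : Finset.univ.image w ⊆ Finset.univ.image w'
  · obtain ⟨p, hp, hp'⟩ := Finset.not_subset.1 fun h' => hw (h.antisymm h')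
    rw [← key w' w p hp hp']
    simp only [mul_comm]
  · obtain ⟨p, hp, hp'⟩ := Finset.not_subset.1 h
    exact key w w' p hp hp'

theorem IsStandardNoise.integral_wick_mul_of_injective (hε : IsStandardNoise μ ε) (hk : k ≠ 0)
    (hmom : Integrable (fun ω => |ε 0 ω| ^ (2 * k)) μ) {w w' : Fin k → ℤ × ℤ}
    (hi : Function.Injective w) (hi' : Function.Injective w')
    (hw : Finset.univ.image w = Finset.univ.image w') :
    ∫ ω, wick μ ε w ω * wick μ ε w' ω ∂μ = 1 := by
  have := hε.isProbabilityMeasure_map 0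
  rw [hε.integral_wick_mul hk hmom, ← hw, Finset.union_idempotent]
  refine Finset.prod_eq_one fun p hp => ?_
  rw [mult_eq_one_of_injective hi hp, mult_eq_one_of_injective hi' (hw ▸ hp)]
  have h0 : ∫ x, x ∂(μ.map (ε 0)) = 0 := by
    rw [integral_map (hε.measurable 0).aemeasurable (by fun_prop)]
    exact hε.mean_zero
  simp only [appell_one (hε.memLp_id hk hmom (n := 1) (by omega)) h0, ← sq]
  exact ((hε.identDistrib p).comp (u := fun x => x ^ 2) (by fun_prop)).integral_eq.trans
    hε.variance_one

theorem IsStandardNoise.exists_abs_integral_wick_mul_le (hε : IsStandardNoise μ ε) (hk : k ≠ 0)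
    (hmom : Integrable (fun ω => |ε 0 ω| ^ (2 * k)) μ) :
    ∃ B : ℝ, 0 ≤ B ∧ ∀ w w' : Fin k → ℤ × ℤ, |∫ ω, wick μ ε w ω * wick μ ε w' ω ∂μ| ≤ B := by
  set D : ℝ := 1 + ∑ m ∈ Finset.range (k + 1), ∑ m' ∈ Finset.range (k + 1),
    |∫ x, appell (μ.map (ε 0)) m x * appell (μ.map (ε 0)) m' x ∂(μ.map (ε 0))| with hD
  have hD1 : 1 ≤ D := le_add_of_nonneg_right
    (Finset.sum_nonneg fun _ _ => Finset.sum_nonneg fun _ _ => abs_nonneg _)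
  -- At most `2k` distinct points occur in the two tuples together; the summand `1` in `D` makes its
  -- powers increasing.
  refine ⟨D ^ (2 * k), by positivity, fun w w' => ?_⟩
  rw [hε.integral_wick_mul hk hmom, Finset.abs_prod]
  have hfac : ∀ p, |∫ ω, appell (μ.map (ε 0)) (mult w p) (ε p ω) *
          appell (μ.map (ε 0)) (mult w' p) (ε p ω) ∂μ| ≤ D := by
    intro p
    have e := integral_map (μ := μ) (φ := ε p) (hε.measurable p).aemeasurable
      (f := fun x => appell (μ.map (ε 0)) (mult w p) x * appell (μ.map (ε 0)) (mult w' p) x)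
      ((hε.measurable_appell hk hmom (mult_le w p)).mul
        (hε.measurable_appell hk hmom (mult_le w' p))).aestronglyMeasurable
    rw [← e, hε.map_eq p, hD]
    refine le_trans ?_ (le_add_of_nonneg_left zero_le_one)
    have hm : ∀ w : Fin k → ℤ × ℤ, mult w p ∈ Finset.range (k + 1) := fun w =>
      Finset.mem_range.2 (Nat.lt_succ_of_le (mult_le w p))
    refine le_trans ?_ (Finset.single_le_sum (f := fun m => ∑ m' ∈ Finset.range (k + 1),
      |∫ x, appell (μ.map (ε 0)) m x * appell (μ.map (ε 0)) m' x ∂(μ.map (ε 0))|)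
      (fun _ _ => Finset.sum_nonneg fun _ _ => abs_nonneg _) (hm w))
    exact Finset.single_le_sum (f := fun m' =>
      |∫ x, appell (μ.map (ε 0)) (mult w p) x * appell (μ.map (ε 0)) m' x ∂(μ.map (ε 0))|)
      (fun _ _ => abs_nonneg _) (hm w')
  calc _ ≤ ∏ _p ∈ Finset.univ.image w ∪ Finset.univ.image w', D :=
        Finset.prod_le_prod (fun _ _ => abs_nonneg _) fun p _ => hfac p
    _ = D ^ (Finset.univ.image w ∪ Finset.univ.image w').card := Finset.prod_const _
    _ ≤ D ^ (2 * k) := by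
        refine pow_le_pow_right₀ hD1 ((Finset.card_union_le _ _).trans ?_)
        have h1 : ∀ w : Fin k → ℤ × ℤ, (Finset.univ.image w).card ≤ k := fun w =>
          Finset.card_image_le.trans (by simp)
        have := h1 w; have := h1 w'; omega

end WickMoments

/-! ### Sums over tuples that are orthogonal across different supports -/

section Hilbert

variable {H : Type*} [NormedAddCommGroup H] [InnerProductSpace ℝ H] {k : ℕ}
  {e : (Fin k → ℤ × ℤ) → H} {B : ℝ}

theorem card_filter_image_eq_le (F : Finset (Fin k → ℤ × ℤ)) (i : Fin k → ℤ × ℤ) :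
    (F.filter fun j => Finset.univ.image i = Finset.univ.image j).card ≤ k ^ k := by
  have hsub : (F.filter fun j => Finset.univ.image i = Finset.univ.image j) ⊆
      Fintype.piFinset (fun _ : Fin k => Finset.univ.image i) := by
    intro j hj
    rw [Fintype.mem_piFinset]
    intro l
    rw [(Finset.mem_filter.1 hj).2]
    exact Finset.mem_image_of_mem _ (Finset.mem_univ _)
  refine (Finset.card_le_card hsub).trans ?_
  rw [Fintype.card_piFinset_const]
  exact Nat.pow_le_pow_left (Finset.card_image_le.trans (by simp)) k

/-- The Gram matrix is block diagonal along supports. A block has at most `k^k` rows and entries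
bounded by `B`, so `2|c_i c_j| ≤ c_i² + c_j²` gives a Bessel-type inequality. -/
theorem norm_sq_sum_smul_le (hB0 : 0 ≤ B)
    (horth : ∀ i j, Finset.univ.image i ≠ Finset.univ.image j → inner ℝ (e i) (e j) = 0)
    (hB : ∀ i j, |inner ℝ (e i) (e j)| ≤ B) (c : (Fin k → ℤ × ℤ) → ℝ)
    (F : Finset (Fin k → ℤ × ℤ)) :
    ‖∑ i ∈ F, c i • e i‖ ^ 2 ≤ B * k ^ k * ∑ i ∈ F, c i ^ 2 := by
  rw [← real_inner_self_eq_norm_sq, sum_inner]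
  simp only [inner_sum, real_inner_smul_left, real_inner_smul_right]
  set R : (Fin k → ℤ × ℤ) → (Fin k → ℤ × ℤ) → ℝ := fun i j =>
    if Finset.univ.image i = Finset.univ.image j then 1 else 0 with hR
  have hRs : ∀ i j, R i j = R j i := fun i j => by simp only [hR, eq_comm]
  have h1 : ∀ i j, c j * (c i * inner ℝ (e i) (e j)) ≤
      B / 2 * (R i j * c i ^ 2) + B / 2 * (R j i * c j ^ 2) := by
    intro i j
    rw [hRs j i]
    by_cases h : Finset.univ.image i = Finset.univ.image j
    · simp only [hR, if_pos h, one_mul]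
      have h2 := abs_le.1 (hB i j)
      nlinarith [sq_nonneg (c i - c j), sq_nonneg (c i + c j)]
    · simp [hR, if_neg h, horth i j h]
  have h3 : ∀ i, ∑ j ∈ F, R i j ≤ (k : ℝ) ^ k := by
    intro i
    simp only [hR, Finset.sum_boole]
    exact_mod_cast card_filter_image_eq_le F i
  calc ∑ i ∈ F, ∑ j ∈ F, c j * (c i * inner ℝ (e i) (e j))
      ≤ ∑ i ∈ F, ∑ j ∈ F, (B / 2 * (R i j * c i ^ 2) + B / 2 * (R j i * c j ^ 2)) :=
        Finset.sum_le_sum fun i _ => Finset.sum_le_sum fun j _ => h1 i j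
    _ = B * ∑ i ∈ F, (∑ j ∈ F, R i j) * c i ^ 2 := by
        simp only [Finset.sum_add_distrib]
        rw [Finset.sum_comm (f := fun i j => B / 2 * (R j i * c j ^ 2))]
        simp only [← Finset.mul_sum, ← Finset.sum_mul]
        ring
    _ ≤ B * ∑ i ∈ F, (k : ℝ) ^ k * c i ^ 2 := by
        gcongr with i hi
        exact h3 i
    _ = _ := by rw [← Finset.mul_sum, mul_assoc]

theorem summable_smul_of_sq [CompleteSpace H] (hB0 : 0 ≤ B)
    (horth : ∀ i j, Finset.univ.image i ≠ Finset.univ.image j → inner ℝ (e i) (e j) = 0)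
    (hB : ∀ i j, |inner ℝ (e i) (e j)| ≤ B) {c : (Fin k → ℤ × ℤ) → ℝ}
    (hc : Summable fun i => c i ^ 2) : Summable fun i => c i • e i := by
  rw [summable_iff_vanishing_norm]
  intro δ hδ
  obtain ⟨s, hs⟩ := summable_iff_vanishing_norm.1 hc (δ ^ 2 / (B * k ^ k + 1)) (by positivity)
  refine ⟨s, fun t ht => ?_⟩
  refine lt_of_pow_lt_pow_left₀ 2 hδ.le ?_
  have h1 := norm_sq_sum_smul_le hB0 horth hB c t
  have h2 := (le_abs_self _).trans_lt (hs t ht)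
  rw [lt_div_iff₀ (by positivity)] at h2
  have h3 : 0 ≤ ∑ i ∈ t, c i ^ 2 := Finset.sum_nonneg fun _ _ => sq_nonneg _
  nlinarith

end Hilbert

theorem summable_prod_of_summable {k : ℕ} {b : ℤ × ℤ → ℝ} (hb0 : ∀ w, 0 ≤ b w)
    (hb : Summable b) : Summable fun w : Fin k → ℤ × ℤ => ∏ j, b (w j) := by
  classical
  refine summable_of_sum_le (c := (∑' w, b w) ^ k)
    (fun w => Finset.prod_nonneg fun _ _ => hb0 _) fun F => ?_
  set T : Finset (ℤ × ℤ) := F.biUnion fun w => Finset.univ.image w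
  have hF : F ⊆ Fintype.piFinset (fun _ : Fin k => T) := by
    intro w hw
    rw [Fintype.mem_piFinset]
    exact fun j => Finset.mem_biUnion.2 ⟨w, hw, Finset.mem_image_of_mem _ (Finset.mem_univ _)⟩
  calc ∑ w ∈ F, ∏ j, b (w j) ≤ ∑ w ∈ Fintype.piFinset (fun _ : Fin k => T), ∏ j, b (w j) :=
        Finset.sum_le_sum_of_subset_of_nonneg hF fun w _ _ =>
          Finset.prod_nonneg fun _ _ => hb0 _
    _ = (∑ w ∈ T, b w) ^ k := by
        rw [← Finset.prod_univ_sum]; simp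
    _ ≤ _ := pow_le_pow_left₀ (Finset.sum_nonneg fun _ _ => hb0 _)
        (hb.sum_le_tsum _ fun _ _ => hb0 _) k

/-! ### Unconditional convergence in `L²` -/

section L2Sum

variable {Ω ι : Type*} [MeasurableSpace Ω] {μ : Measure Ω} {f : ι → Ω → ℝ} {F : Ω → ℝ}

theorem toLp_finsetSum (hf : ∀ i, MemLp (f i) 2 μ) (S : Finset ι) :
    (memLp_finsetSum S fun i _ => hf i).toLp (fun ω => ∑ i ∈ S, f i ω) =
      ∑ i ∈ S, (hf i).toLp (f i) := by
  classical
  induction S using Finset.induction_on with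
  | empty =>
    simp only [Finset.sum_empty]
    exact MemLp.toLp_zero _
  | insert i S hi ih =>
    simp only [Finset.sum_insert hi]
    rw [← ih]
    exact MemLp.toLp_add (hf i) (memLp_finsetSum S fun i _ => hf i)

theorem tendsto_eLpNorm_iff_hasSum (hf : ∀ i, MemLp (f i) 2 μ) (hF : MemLp F 2 μ) :
    Tendsto (fun S : Finset ι => eLpNorm (fun ω => F ω - ∑ i ∈ S, f i ω) 2 μ) atTop (𝓝 0) ↔
      HasSum (fun i => (hf i).toLp (f i)) (hF.toLp F) := by
  rw [HasSum, SummationFilter.unconditional_filter]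
  simp only [← toLp_finsetSum hf]
  rw [Lp.tendsto_Lp_iff_tendsto_eLpNorm'']
  refine tendsto_congr fun S => ?_
  rw [← eLpNorm_neg]
  congr 1
  funext ω
  simp

theorem HasL2Sum.hasSum (h : HasL2Sum μ f F) :
    HasSum (fun i => (h.memLp_term i).toLp (f i)) (h.memLp_sum.toLp F) :=
  (tendsto_eLpNorm_iff_hasSum _ _).1 h.tendsto

theorem hasL2Sum_of_hasSum (hf : ∀ i, MemLp (f i) 2 μ) {G : Lp ℝ 2 μ}
    (h : HasSum (fun i => (hf i).toLp (f i)) G) : HasL2Sum μ f G where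
  memLp_term := hf
  memLp_sum := Lp.memLp G
  tendsto := by
    rw [tendsto_eLpNorm_iff_hasSum hf (Lp.memLp G), Lp.toLp_coeFn]
    exact h

theorem inner_toLp {g : Ω → ℝ} (hF : MemLp F 2 μ) (hg : MemLp g 2 μ) :
    inner ℝ (hF.toLp F) (hg.toLp g) = ∫ ω, F ω * g ω ∂μ := by
  rw [L2.inner_def]
  refine integral_congr_ae ?_
  filter_upwards [hF.coeFn_toLp, hg.coeFn_toLp] with ω h1 h2
  rw [h1, h2]
  simp [mul_comm]

theorem inner_coe_Lp (G G' : Lp ℝ 2 μ) : inner ℝ G G' = ∫ ω, G ω * G' ω ∂μ := by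
  rw [L2.inner_def]
  refine integral_congr_ae (Eventually.of_forall fun ω => ?_)
  simp [mul_comm]

end L2Sum

section AppellLimit

variable {Ω : Type*} [MeasurableSpace Ω] {μ : Measure Ω} [IsProbabilityMeasure μ]
  {ε : ℤ × ℤ → Ω → ℝ} {k : ℕ}

/-! ### Square summability of the coefficients of an `L²` moving average -/

theorem IsStandardNoise.integral_mul (hε : IsStandardNoise μ ε) (w w' : ℤ × ℤ) :
    ∫ ω, ε w ω * ε w' ω ∂μ = if w = w' then 1 else 0 := by
  split_ifs with h
  · subst h
    simp only [← sq]
    exact ((hε.identDistrib w).comp (u := fun x => x ^ 2) (by fun_prop)).integral_eq.trans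
      hε.variance_one
  · rw [(hε.indep.indepFun h).integral_fun_mul_eq_mul_integral
      (hε.measurable w).aestronglyMeasurable (hε.measurable w').aestronglyMeasurable,
      (hε.identDistrib w).integral_eq, hε.mean_zero, zero_mul]

/-- The noise is orthonormal, so the squared norms of the partial sums are the partial sums of `∑
c²`, and the former converge. -/
theorem IsStandardNoise.summable_sq (hε : IsStandardNoise μ ε) {c : ℤ × ℤ → ℝ} {Y : Ω → ℝ}
    (hY : HasL2Sum μ (fun w ω => c w * ε w ω) Y) : Summable fun w => c w ^ 2 := by
  have h := hY.hasSum
  have h1 : ∀ S : Finset (ℤ × ℤ), inner ℝ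
      (∑ w ∈ S, (hY.memLp_term w).toLp (fun ω => c w * ε w ω))
      (∑ w ∈ S, (hY.memLp_term w).toLp (fun ω => c w * ε w ω)) = ∑ w ∈ S, c w ^ 2 := by
    intro S
    have hmul : ∀ w w', ∫ ω, c w * ε w ω * (c w' * ε w' ω) ∂μ =
        if w = w' then c w * c w' else 0 := by
      intro w w'
      have e : ∀ ω, c w * ε w ω * (c w' * ε w' ω) = c w * c w' * (ε w ω * ε w' ω) :=
        fun ω => by ring
      simp only [e]
      rw [integral_const_mul, hε.integral_mul, mul_ite, mul_one, mul_zero]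
    simp only [sum_inner, inner_sum, inner_toLp, hmul]
    refine Finset.sum_congr rfl fun w hw => ?_
    rw [Finset.sum_eq_single w]
    · rw [if_pos rfl, sq]
    · exact fun w' _ hne => if_neg hne
    · exact fun h => absurd hw h
  refine ⟨_, (h.inner h).congr fun S => ?_⟩
  exact h1 S

/-! ### The Appell polynomial of an infinite linear combination -/

theorem tendsto_piFinset_atTop :
    Tendsto (fun T : Finset (ℤ × ℤ) => Fintype.piFinset (fun _ : Fin k => T)) atTop atTop := by
  refine tendsto_atTop_finset_of_monotone (fun T T' h => ?_) fun w => ?_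
  · exact Fintype.piFinset_subset _ _ fun _ => h
  · exact ⟨Finset.univ.image w, by simp [Fintype.mem_piFinset]⟩

theorem integral_mul_sq_le {f g : Ω → ℝ} (hf : MemLp f 2 μ) (hg : MemLp g 2 μ) :
    (∫ ω, f ω * g ω ∂μ) ^ 2 ≤ (∫ ω, f ω ^ 2 ∂μ) * ∫ ω, g ω ^ 2 ∂μ := by
  have h := real_inner_mul_inner_self_le (hf.toLp f) (hg.toLp g)
  simp only [inner_toLp] at h
  simpa only [sq] using h

/-- Fatou's lemma. It puts the limit `Y`, given only as an `L²` limit, into `L^{2k}`. -/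
theorem memLp_of_ae_tendsto_of_integral_le {N : ℕ} (hN : N ≠ 0) (hev : Even N) {S : ℕ → Ω → ℝ}
    {Y : Ω → ℝ} (hS : ∀ n, MemLp (S n) N μ) (hY : AEStronglyMeasurable Y μ)
    (hlim : ∀ᵐ ω ∂μ, Tendsto (fun n => S n ω) atTop (𝓝 (Y ω))) {M : ℝ}
    (hM : ∀ n, ∫ ω, S n ω ^ N ∂μ ≤ M) : MemLp Y N μ := by
  refine ⟨hY, (Lp.eLpNorm_lim_le_liminf_eLpNorm (fun n => (hS n).1) Y hlim).trans_lt ?_⟩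
  have hb : ∀ n, eLpNorm (S n) N μ ≤ ENNReal.ofReal (M ^ (N : ℝ)⁻¹) := by
    intro n
    rw [(hS n).eLpNorm_eq_integral_rpow_norm (by exact_mod_cast hN) (by simp)]
    refine ENNReal.ofReal_le_ofReal ?_
    simp only [ENNReal.toReal_natCast, Real.rpow_natCast, Real.norm_eq_abs, hev.pow_abs]
    refine Real.rpow_le_rpow (integral_nonneg fun ω => hev.pow_nonneg _) (hM n) (by positivity)
  refine (liminf_le_liminf (Eventually.of_forall hb)).trans_lt ?_
  rw [liminf_const]
  exact ENNReal.ofReal_lt_top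

theorem abs_pow_sub_pow_le_mul (x y : ℝ) {j k : ℕ} (hj : j ≤ k) :
    |x ^ j - y ^ j| ≤ |x - y| * (k * (2 + |x| ^ k + |y| ^ k)) := by
  refine (abs_pow_sub_pow_le x y j).trans ?_
  rw [mul_assoc]
  refine mul_le_mul_of_nonneg_left ?_ (abs_nonneg _)
  have h1 := abs_pow_le_one_add_abs_pow x (show j - 1 ≤ k by omega)
  have h2 := abs_pow_le_one_add_abs_pow y (show j - 1 ≤ k by omega)
  have hx := pow_nonneg (abs_nonneg x) k
  have hy := pow_nonneg (abs_nonneg y) k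
  refine mul_le_mul (by exact_mod_cast hj) ?_ (by positivity) (by positivity)
  rcases max_choice |x| |y| with h | h <;> rw [h] <;> linarith

theorem memLp_two_abs_pow {f : Ω → ℝ} (hf : MemLp f (2 * k : ℕ) μ) :
    MemLp (fun ω => |f ω| ^ k) 2 μ := by
  have hm : AEStronglyMeasurable (fun ω => |f ω| ^ k) μ := hf.1.norm.pow k
  rw [memLp_two_iff_integrable_sq hm]
  refine (integrable_pow_of_memLp_comp hf le_rfl).congr (Eventually.of_forall fun ω => ?_)
  simp only [← pow_mul, mul_comm k 2, (even_two_mul k).pow_abs]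

theorem memLp_add_abs_pow {f g : Ω → ℝ} (hf : MemLp f (2 * k : ℕ) μ)
    (hg : MemLp g (2 * k : ℕ) μ) :
    MemLp (fun ω => (k : ℝ) * (2 + |f ω| ^ k + |g ω| ^ k)) 2 μ := by
  have h1 : MemLp (fun _ : Ω => (2 : ℝ)) 2 μ := memLp_const 2
  have h2 : MemLp (fun ω => 2 + |f ω| ^ k) 2 μ := h1.add (memLp_two_abs_pow hf)
  have h3 : MemLp (fun ω => 2 + |f ω| ^ k + |g ω| ^ k) 2 μ := h2.add (memLp_two_abs_pow hg)
  exact h3.const_mul _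

theorem integral_add_abs_pow_sq_le {f g : Ω → ℝ} (hf : MemLp f (2 * k : ℕ) μ)
    (hg : MemLp g (2 * k : ℕ) μ) :
    ∫ ω, ((k : ℝ) * (2 + |f ω| ^ k + |g ω| ^ k)) ^ 2 ∂μ ≤
      k ^ 2 * (3 * (4 + ∫ ω, f ω ^ (2 * k) ∂μ + ∫ ω, g ω ^ (2 * k) ∂μ)) := by
  have i1 := integrable_pow_of_memLp_comp hf le_rfl
  have i2 := integrable_pow_of_memLp_comp hg le_rfl
  have i0 : Integrable (fun _ : Ω => (4 : ℝ)) μ := integrable_const 4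
  have i3 : Integrable (fun ω => 4 + f ω ^ (2 * k)) μ := i0.add i1
  have i4 : Integrable (fun ω => 4 + f ω ^ (2 * k) + g ω ^ (2 * k)) μ := i3.add i2
  have i5 : Integrable (fun ω => (k : ℝ) ^ 2 * (3 * (4 + f ω ^ (2 * k) + g ω ^ (2 * k)))) μ :=
    (i4.const_mul 3).const_mul _
  calc ∫ ω, ((k : ℝ) * (2 + |f ω| ^ k + |g ω| ^ k)) ^ 2 ∂μ
      ≤ ∫ ω, (k : ℝ) ^ 2 * (3 * (4 + f ω ^ (2 * k) + g ω ^ (2 * k))) ∂μ := by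
        refine integral_mono (memLp_add_abs_pow hf hg).integrable_sq i5 fun ω => ?_
        have e : ∀ x : ℝ, x ^ (2 * k) = (|x| ^ k) ^ 2 := fun x => by
          rw [← pow_mul, mul_comm k 2, (even_two_mul k).pow_abs]
        simp only [e, mul_pow]
        generalize |f ω| ^ k = x
        generalize |g ω| ^ k = y
        refine mul_le_mul_of_nonneg_left ?_ (by positivity)
        nlinarith [sq_nonneg (x - 2), sq_nonneg (y - 2), sq_nonneg (x - y)]
    _ = _ := by
        rw [integral_const_mul, integral_const_mul, integral_add i3 i2, integral_add i0 i1]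
        simp

/-- By Cauchy–Schwarz, `|E(S^j - Y^j)|²` is at most `E(S - Y)²` times a second moment of `k(2 +
|S|^k + |Y|^k)`, which the uniform `2k`-th moment bound controls. -/
theorem tendsto_integral_pow {α : Type*} {l : Filter α} {S : α → Ω → ℝ} {Y : Ω → ℝ}
    (hS : ∀ n, MemLp (S n) (2 * k : ℕ) μ) (hY : MemLp Y (2 * k : ℕ) μ)
    (hS2 : ∀ n, MemLp (S n) 2 μ) (hY2 : MemLp Y 2 μ)
    (hlim : Tendsto (fun n => ∫ ω, (S n ω - Y ω) ^ 2 ∂μ) l (𝓝 0)) {M : ℝ}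
    (hM : ∀ n, ∫ ω, S n ω ^ (2 * k) ∂μ ≤ M) {j : ℕ} (hj : j ≤ k) :
    Tendsto (fun n => ∫ ω, S n ω ^ j ∂μ) l (𝓝 (∫ ω, Y ω ^ j ∂μ)) := by
  rw [tendsto_iff_norm_sub_tendsto_zero]
  set D : ℝ := k ^ 2 * (3 * (4 + M + ∫ ω, Y ω ^ (2 * k) ∂μ)) with hD
  have hVb : ∀ n, ∫ ω, ((k : ℝ) * (2 + |S n ω| ^ k + |Y ω| ^ k)) ^ 2 ∂μ ≤ D := by
    intro n
    refine (integral_add_abs_pow_sq_le (hS n) hY).trans ?_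
    have := hM n
    rw [hD]
    gcongr
  refine squeeze_zero (g := fun n => √((∫ ω, (S n ω - Y ω) ^ 2 ∂μ) * D))
    (fun n => norm_nonneg _) (fun n => ?_) ?_
  · have i1 := integrable_pow_of_memLp_comp (hS n) (show j ≤ 2 * k by omega)
    have i2 := integrable_pow_of_memLp_comp hY (show j ≤ 2 * k by omega)
    have hdiff : MemLp (fun ω => |S n ω - Y ω|) 2 μ := ((hS2 n).sub hY2).norm
    have hV := memLp_add_abs_pow (hS n) hY
    have i3 : Integrable (fun ω => |S n ω - Y ω| * ((k : ℝ) * (2 + |S n ω| ^ k + |Y ω| ^ k))) μ :=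
      hdiff.integrable_mul hV
    have h1 : |∫ ω, (S n ω ^ j - Y ω ^ j) ∂μ| ≤
        ∫ ω, |S n ω - Y ω| * ((k : ℝ) * (2 + |S n ω| ^ k + |Y ω| ^ k)) ∂μ :=
      abs_integral_le_integral_abs.trans (integral_mono (i1.sub i2).abs i3
        fun ω => abs_pow_sub_pow_le_mul _ _ hj)
    have h2 := integral_mul_sq_le hdiff hV
    simp only [sq_abs] at h2
    refine Real.le_sqrt_of_sq_le ?_
    rw [Real.norm_eq_abs, ← integral_sub i1 i2]
    refine (pow_le_pow_left₀ (abs_nonneg _) h1 2).trans (h2.trans ?_)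
    exact mul_le_mul_of_nonneg_left (hVb n) (integral_nonneg fun ω => sq_nonneg _)
  · have h3 := (hlim.mul_const D).sqrt
    rwa [zero_mul, Real.sqrt_zero] at h3

/-- The family of Wick products as elements of `L²`. -/
noncomputable def wickLp (h : ∀ w : Fin k → ℤ × ℤ, MemLp (wick μ ε w) 2 μ)
    (w : Fin k → ℤ × ℤ) : Lp ℝ 2 μ := (h w).toLp

theorem IsStandardNoise.summable_wickLp (hε : IsStandardNoise μ ε) (hk : k ≠ 0)
    (hmom : Integrable (fun ω => |ε 0 ω| ^ (2 * k)) μ) {c : ℤ × ℤ → ℝ}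
    (hc : Summable fun w => c w ^ 2) :
    Summable fun w : Fin k → ℤ × ℤ => (∏ j, c (w j)) • wickLp (hε.memLp_wick hk hmom) w := by
  obtain ⟨B, hB0, hB⟩ := hε.exists_abs_integral_wick_mul_le hk hmom
  refine summable_smul_of_sq hB0 (fun i j hij => ?_) (fun i j => ?_) ?_
  · rw [wickLp, wickLp, inner_toLp, hε.integral_wick_mul_eq_zero hk hmom hij]
  · rw [wickLp, wickLp, inner_toLp]
    exact hB i j
  · simp only [← Finset.prod_pow]
    exact summable_prod_of_summable (b := fun w => c w ^ 2) (fun w => sq_nonneg (c w)) hc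

/-- The Appell polynomial of an `L²` linear combination of the noise is an `L²` series of Wick
products. -/
theorem IsStandardNoise.appellOf_ae_eq (hε : IsStandardNoise μ ε) (hk : k ≠ 0)
    (hmom : Integrable (fun ω => |ε 0 ω| ^ (2 * k)) μ) {c : ℤ × ℤ → ℝ} {Y : Ω → ℝ}
    (hY : HasL2Sum μ (fun w ω => c w * ε w ω) Y) :
    appellOf μ k Y =ᵐ[μ]
      (∑' w : Fin k → ℤ × ℤ, (∏ j, c (w j)) • wickLp (hε.memLp_wick hk hmom) w : Lp ℝ 2 μ) := by
  have hc := hε.summable_sq hY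
  set G : Lp ℝ 2 μ := ∑' w : Fin k → ℤ × ℤ, (∏ j, c (w j)) • wickLp (hε.memLp_wick hk hmom) w
    with hG
  set S : Finset (ℤ × ℤ) → Ω → ℝ := fun T ω => ∑ w ∈ T, c w * ε w ω with hS
  set W : Finset (ℤ × ℤ) → Ω → ℝ := fun T ω =>
    ∑ f ∈ Fintype.piFinset (fun _ : Fin k => T), (∏ j, c (f j)) * wick μ ε f ω with hW
  have hwm : ∀ f : Fin k → ℤ × ℤ, MemLp (fun ω => (∏ j, c (f j)) * wick μ ε f ω) 2 μ := fun f =>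
    (hε.memLp_wick hk hmom f).const_mul _
  have hSL : ∀ T, MemLp (S T) (2 * k : ℕ) μ := fun T =>
    memLp_finsetSum _ fun w _ => (hε.memLp hk hmom w).const_mul _
  have hS2 : ∀ T, MemLp (S T) 2 μ := fun T => memLp_finsetSum _ fun w _ => hY.memLp_term w
  have hWL : ∀ T, MemLp (W T) 2 μ := fun T => memLp_finsetSum _ fun f _ => hwm f
  have hGsum : HasSum (fun f : Fin k → ℤ × ℤ => (hwm f).toLp) G :=
    (hε.summable_wickLp hk hmom hc).hasSum
  have hGlim : Tendsto (fun T => eLpNorm (W T - (G : Ω → ℝ)) 2 μ) atTop (𝓝 0) := by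
    have h1 := (hasL2Sum_of_hasSum hwm hGsum).tendsto.comp (tendsto_piFinset_atTop (k := k))
    refine h1.congr fun T => ?_
    rw [Function.comp, ← eLpNorm_neg]
    congr 1
    funext ω
    simp [hW]
  have hSlim : Tendsto (fun T => eLpNorm (S T - Y) 2 μ) atTop (𝓝 0) := by
    refine hY.tendsto.congr fun T => ?_
    rw [← eLpNorm_neg]
    congr 1
    funext ω
    simp [hS]
  have hint : Tendsto (fun T => ∫ ω, (S T ω - Y ω) ^ 2 ∂μ) atTop (𝓝 0) := by
    have h1 := hY.hasSum
    rw [HasSum, SummationFilter.unconditional_filter, tendsto_iff_norm_sub_tendsto_zero] at h1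
    have h2 := h1.pow 2
    rw [zero_pow two_ne_zero] at h2
    refine h2.congr fun T => ?_
    rw [← toLp_finsetSum hY.memLp_term, ← MemLp.toLp_sub (hS2 T) hY.memLp_sum,
      ← real_inner_self_eq_norm_sq, inner_toLp]
    simp [sq, hS]
  -- A square-summable family is bounded, since `|x| ≤ 1 + x²`.
  obtain ⟨C, hC⟩ : ∃ C : ℝ, ∀ w, |c w| ≤ C := by
    refine ⟨1 + ∑' w, c w ^ 2, fun w => ?_⟩
    have h1 := hc.le_tsum w fun _ _ => sq_nonneg _
    have h2 := abs_nonneg (c w)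
    have h3 := sq_abs (c w)
    nlinarith
  obtain ⟨K, hK0, hK⟩ := hε.moment_bound hk hmom c hC
  have hM : ∀ T, ∫ ω, S T ω ^ (2 * k) ∂μ ≤ Real.exp (K * ∑' w, c w ^ 2) := by
    intro T
    have h1 := hK T
    have h2 : Real.exp (K * ∑ w ∈ T, c w ^ 2) ≤ Real.exp (K * ∑' w, c w ^ 2) := by
      refine Real.exp_le_exp.2 (mul_le_mul_of_nonneg_left ?_ hK0)
      exact hc.sum_le_tsum _ fun _ _ => sq_nonneg _
    linarith
  -- Two successive extractions: `S` converges almost surely along `ns`, and then both `S` and `W`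
  -- do along `ns ∘ ms`.
  obtain ⟨ns, hns, hSae⟩ := (tendstoInMeasure_of_tendsto_eLpNorm two_ne_zero
    (fun T => (hS2 T).1) hY.memLp_sum.1 hSlim).exists_seq_tendsto_ae'
  obtain ⟨ms, hms, hWae⟩ := (tendstoInMeasure_of_tendsto_eLpNorm two_ne_zero
    (fun n => (hWL (ns n)).1) (Lp.memLp G).1 (hGlim.comp hns)).exists_seq_tendsto_ae
  have hYL : MemLp Y (2 * k : ℕ) μ :=
    memLp_of_ae_tendsto_of_integral_le (by omega) (even_two_mul k) (fun n => hSL (ns n))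
      hY.memLp_sum.1 hSae fun n => hM (ns n)
  -- The Appell polynomial of a partial sum is relative to the law of that partial sum, so its
  -- coefficients have to converge as well as its argument.
  have hmomlim : ∀ j ≤ k, Tendsto (fun n => ∫ ω, S (ns (ms n)) ω ^ j ∂μ) atTop
      (𝓝 (∫ ω, Y ω ^ j ∂μ)) := fun j hj =>
    (tendsto_integral_pow hSL hYL hS2 hY.memLp_sum hint hM hj).comp
      (hns.comp hms.tendsto_atTop)
  have hAp : ∀ {V : Ω → ℝ}, MemLp V (2 * k : ℕ) μ → ∀ ω, appellOf μ k V ω =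
      ∑ j ∈ Finset.range (k + 1), (k.choose j : ℝ) *
        appellCoeff (fun j => ∫ ω, V ω ^ j ∂μ) j * V ω ^ (k - j) := by
    intro V hV ω
    have hP : IsProbabilityMeasure (μ.map V) := Measure.isProbabilityMeasure_map hV.1.aemeasurable
    rw [appellOf, appell_eq_sum (memLp_id_mono (memLp_id_map hV.1.aemeasurable hV) (by omega))]
    have hm : momentSeq (μ.map V) = fun j => ∫ ω, V ω ^ j ∂μ := by
      funext j
      rw [momentSeq, integral_map hV.1.aemeasurable (by fun_prop)]
    rw [hm]
  filter_upwards [hSae, hWae] with ω h1 h2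
  -- For partial sums `A_k(S)` and `W` coincide, so the two almost sure limits are equal.
  refine tendsto_nhds_unique ?_ h2
  have h3 : Tendsto (fun n => appellOf μ k (S (ns (ms n))) ω) atTop (𝓝 (appellOf μ k Y ω)) := by
    rw [hAp hYL]
    simp only [hAp (hSL _)]
    refine tendsto_finsetSum _ fun j hj => ?_
    have hj' : j ≤ k := Nat.lt_succ_iff.1 (Finset.mem_range.1 hj)
    refine (tendsto_const_nhds.mul (tendsto_appellCoeff j fun i hi => ?_)).mul
      ((h1.comp hms.tendsto_atTop).pow _)
    exact hmomlim i (hi.trans hj')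
  refine h3.congr fun n => ?_
  exact hε.appell_sum hk hmom c _ ω

end AppellLimit

/-! ### A bound for sums over pairs of tuples with coincidences -/

/-- With nonnegative terms, a parametrization that covers `A` several times only overcounts;
injectivity of `φ` is not needed. -/
theorem sum_le_sum_of_subset_image {α β : Type*} [DecidableEq β] {A : Finset β} {D : Finset α}
    {φ : α → β} (h : A ⊆ D.image φ) {f : β → ℝ} (hf : ∀ b, 0 ≤ f b) :
    ∑ b ∈ A, f b ≤ ∑ a ∈ D, f (φ a) := by
  refine (Finset.sum_le_sum_of_subset_of_nonneg h fun b _ _ => hf b).trans ?_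
  rw [Finset.sum_comp f φ]
  refine Finset.sum_le_sum fun b hb => ?_
  obtain ⟨a, ha, rfl⟩ := Finset.mem_image.1 hb
  have h1 : 1 ≤ (D.filter fun x => φ x = φ a).card :=
    Finset.card_pos.2 ⟨a, Finset.mem_filter.2 ⟨ha, rfl⟩⟩
  rw [nsmul_eq_mul]
  exact le_mul_of_one_le_left (hf _) (by exact_mod_cast h1)

/-- Since `min(x, y) ≤ δ`, one has `xy ≤ x² + y²`, `x²y ≤ δ(x² + y²)` and `x²y² ≤ δ²(x² + y²)`.
Every exponent above `1` thus earns one factor `δ`, while `x² + y²` remains for the summation;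
surplus powers are absorbed by `M`. -/
theorem pow_mul_pow_le {x y δ M : ℝ} (hx : 0 ≤ x) (hy : 0 ≤ y) (hδ : 0 ≤ δ) (hM : 1 ≤ M)
    (hxM : x ≤ M) (hyM : y ≤ M) (hmin : x ≤ δ ∨ y ≤ δ) {k m n : ℕ} (hm : m ≠ 0) (hn : n ≠ 0)
    (hmk : m ≤ k) (hnk : n ≤ k) :
    x ^ m * y ^ n ≤ M ^ k * M ^ k * δ ^ (min (m - 1) 1 + min (n - 1) 1) * (x ^ 2 + y ^ 2) := by
  have hxp : ∀ i ≤ k, x ^ i ≤ M ^ k := fun i hi =>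
    (pow_le_pow_left₀ hx hxM i).trans (pow_le_pow_right₀ hM hi)
  have hyp : ∀ i ≤ k, y ^ i ≤ M ^ k := fun i hi =>
    (pow_le_pow_left₀ hy hyM i).trans (pow_le_pow_right₀ hM hi)
  have hM1 : 1 ≤ M ^ k := one_le_pow₀ hM
  have hxy : x * y ≤ x ^ 2 + y ^ 2 := by nlinarith [sq_nonneg (x - y), sq_nonneg x, sq_nonneg y]
  have key : ∀ (i i' : ℕ) (z w : ℝ), i ≤ k → i' ≤ k → 0 ≤ z → z ≤ w →
      x ^ i * y ^ i' * z ≤ M ^ k * M ^ k * w := by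
    intro i i' z w hi hi' hz hzw
    have := hxp i hi
    have := hyp i' hi'
    gcongr
  obtain ⟨m', rfl⟩ : ∃ m', m = m' + 1 := ⟨m - 1, by omega⟩
  obtain ⟨n', rfl⟩ : ∃ n', n = n' + 1 := ⟨n - 1, by omega⟩
  rw [mul_assoc (M ^ k * M ^ k)]
  rcases m' with _ | m' <;> rcases n' with _ | n'
  · have := key 0 0 (x * y) (x ^ 2 + y ^ 2) (by omega) (by omega) (by positivity) hxy
    simpa using this
  · have h1 : x * y ^ 2 ≤ δ * (x ^ 2 + y ^ 2) := by
      rcases hmin with h | h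
      · nlinarith [mul_le_mul_of_nonneg_right h (sq_nonneg y), mul_nonneg hδ (sq_nonneg x)]
      · nlinarith [mul_le_mul_of_nonneg_right h (mul_nonneg hx hy),
          mul_le_mul_of_nonneg_left hxy hδ]
    have := key 0 n' (x * y ^ 2) _ (by omega) (by omega) (by positivity) h1
    simp only [zero_add, Nat.sub_self, Nat.add_sub_cancel]
    rw [show min 0 1 + min (n' + 1) 1 = 1 by omega]
    rw [pow_one δ]
    refine le_trans (le_of_eq ?_) this
    ring
  · have h1 : x ^ 2 * y ≤ δ * (x ^ 2 + y ^ 2) := by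
      rcases hmin with h | h
      · nlinarith [mul_le_mul_of_nonneg_right h (mul_nonneg hx hy),
          mul_le_mul_of_nonneg_left hxy hδ]
      · nlinarith [mul_le_mul_of_nonneg_right h (sq_nonneg x), mul_nonneg hδ (sq_nonneg y)]
    have := key m' 0 (x ^ 2 * y) _ (by omega) (by omega) (by positivity) h1
    simp only [zero_add, Nat.sub_self, Nat.add_sub_cancel]
    rw [show min (m' + 1) 1 + min 0 1 = 1 by omega]
    rw [pow_one δ]
    refine le_trans (le_of_eq ?_) this
    ring
  · have h1 : x ^ 2 * y ^ 2 ≤ δ ^ 2 * (x ^ 2 + y ^ 2) := by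
      rcases hmin with h | h
      · have := pow_le_pow_left₀ hx h 2
        nlinarith [mul_le_mul_of_nonneg_right this (sq_nonneg y), mul_nonneg (sq_nonneg δ) (sq_nonneg x)]
      · have := pow_le_pow_left₀ hy h 2
        nlinarith [mul_le_mul_of_nonneg_right this (sq_nonneg x), mul_nonneg (sq_nonneg δ) (sq_nonneg y)]
    have := key m' n' (x ^ 2 * y ^ 2) _ (by omega) (by omega) (by positivity) h1
    simp only [Nat.add_sub_cancel]
    rw [show min (m' + 1) 1 + min (n' + 1) 1 = 2 by omega]
    refine le_trans (le_of_eq ?_) this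
    ring

theorem exists_two_le_card_fiber {k r : ℕ} (hr : r < k) (α : Fin k → Fin r) :
    ∃ p, 2 ≤ (Finset.univ.filter fun l => α l = p).card := by
  obtain ⟨x, y, hxy, h⟩ := Fintype.exists_ne_map_eq_of_card_lt α (by simpa using hr)
  refine ⟨α x, Finset.one_lt_card.2 ⟨x, by simp, y, by simp [h], hxy⟩⟩

/-- Collecting the indices in each fibre factorizes the sum over `v` into `r` one-point sums. As `r
< k`, both `α` and `β` have a fibre with at least two elements, and each of these yields a factor
`δ`, possibly at the same point. -/
theorem sum_prod_comp_le {k r : ℕ} (hr : r < k) {α β : Fin k → Fin r}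
    (hα : Function.Surjective α) (hβ : Function.Surjective β) {b b' : ℤ × ℤ → ℝ} {δ M : ℝ}
    (hb : ∀ w, 0 ≤ b w) (hb' : ∀ w, 0 ≤ b' w) (hδ : 0 ≤ δ) (hδ1 : δ ≤ 1) (hM : 1 ≤ M)
    (hbM : ∀ w, b w ≤ M) (hbM' : ∀ w, b' w ≤ M) (hmin : ∀ w, b w ≤ δ ∨ b' w ≤ δ)
    (T : Finset (ℤ × ℤ)) (hs : ∑ w ∈ T, b w ^ 2 ≤ M) (hs' : ∑ w ∈ T, b' w ^ 2 ≤ M) :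
    ∑ v ∈ Fintype.piFinset (fun _ : Fin r => T),
      (∏ l, b (v (α l))) * ∏ l, b' (v (β l)) ≤ (2 * M * (M ^ k * M ^ k)) ^ k * δ ^ 2 := by
  set m : Fin r → ℕ := fun p => (Finset.univ.filter fun l => α l = p).card with hm
  set n : Fin r → ℕ := fun p => (Finset.univ.filter fun l => β l = p).card with hn
  have hpos : ∀ {γ : Fin k → Fin r}, Function.Surjective γ → ∀ p,
      (Finset.univ.filter fun l => γ l = p).card ≠ 0 := by
    intro γ hγ p
    obtain ⟨l, rfl⟩ := hγ p
    exact Finset.card_ne_zero_of_mem (Finset.mem_filter.2 ⟨Finset.mem_univ l, rfl⟩)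
  have hle : ∀ (γ : Fin k → Fin r) p, (Finset.univ.filter fun l => γ l = p).card ≤ k :=
    fun γ p => (Finset.card_filter_le _ _).trans (by simp)
  have hprod : ∀ (γ : Fin k → Fin r) (g : ℤ × ℤ → ℝ) (v : Fin r → ℤ × ℤ),
      ∏ l, g (v (γ l)) = ∏ p, g (v p) ^ (Finset.univ.filter fun l => γ l = p).card := by
    intro γ g v
    rw [← Finset.prod_fiberwise' Finset.univ γ fun p => g (v p)]
    simp only [Finset.prod_const]
  have h1 : ∑ v ∈ Fintype.piFinset (fun _ : Fin r => T),
      (∏ l, b (v (α l))) * ∏ l, b' (v (β l)) = ∏ p, ∑ w ∈ T, b w ^ m p * b' w ^ n p := by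
    rw [Finset.prod_univ_sum]
    refine Finset.sum_congr rfl fun v _ => ?_
    rw [hprod α b, hprod β b', Finset.prod_mul_distrib]
  set A : ℝ := 2 * M * (M ^ k * M ^ k) with hA
  have hA1 : 1 ≤ A := by
    have : 1 ≤ M ^ k := one_le_pow₀ hM
    rw [hA]; nlinarith [mul_le_mul this this zero_le_one (by linarith)]
  have h2 : ∀ p, ∑ w ∈ T, b w ^ m p * b' w ^ n p ≤
      A * δ ^ (min (m p - 1) 1 + min (n p - 1) 1) := by
    intro p
    calc ∑ w ∈ T, b w ^ m p * b' w ^ n p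
        ≤ ∑ w ∈ T, M ^ k * M ^ k * δ ^ (min (m p - 1) 1 + min (n p - 1) 1) *
            (b w ^ 2 + b' w ^ 2) := Finset.sum_le_sum fun w _ =>
          pow_mul_pow_le (hb w) (hb' w) hδ hM (hbM w) (hbM' w) (hmin w) (hpos hα p) (hpos hβ p)
            (hle α p) (hle β p)
      _ = M ^ k * M ^ k * δ ^ (min (m p - 1) 1 + min (n p - 1) 1) *
            (∑ w ∈ T, b w ^ 2 + ∑ w ∈ T, b' w ^ 2) := by
          rw [← Finset.mul_sum, Finset.sum_add_distrib]
      _ ≤ M ^ k * M ^ k * δ ^ (min (m p - 1) 1 + min (n p - 1) 1) * (M + M) := by gcongr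
      _ = _ := by rw [hA]; ring
  rw [h1]
  calc ∏ p, ∑ w ∈ T, b w ^ m p * b' w ^ n p
      ≤ ∏ p : Fin r, A * δ ^ (min (m p - 1) 1 + min (n p - 1) 1) :=
        Finset.prod_le_prod (fun p _ => Finset.sum_nonneg fun w _ =>
          mul_nonneg (pow_nonneg (hb w) _) (pow_nonneg (hb' w) _)) fun p _ => h2 p
    _ = A ^ r * δ ^ (∑ p, (min (m p - 1) 1 + min (n p - 1) 1)) := by
        rw [Finset.prod_mul_distrib, Finset.prod_pow_eq_pow_sum]
        simp
    _ ≤ A ^ k * δ ^ 2 := by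
        refine mul_le_mul (pow_le_pow_right₀ hA1 hr.le) (pow_le_pow_of_le_one hδ hδ1 ?_)
          (pow_nonneg hδ _) (by positivity)
        rw [Finset.sum_add_distrib]
        obtain ⟨p, hp⟩ := exists_two_le_card_fiber hr α
        obtain ⟨q, hq⟩ := exists_two_le_card_fiber hr β
        have e1 := Finset.single_le_sum (f := fun p => min (m p - 1) 1) (fun _ _ => Nat.zero_le _)
          (Finset.mem_univ p)
        have e2 := Finset.single_le_sum (f := fun p => min (n p - 1) 1) (fun _ _ => Nat.zero_le _)
          (Finset.mem_univ q)
        have e3 : min (m p - 1) 1 = 1 := by simp only [hm]; omega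
        have e4 : min (n q - 1) 1 = 1 := by simp only [hn]; omega
        simp only [e3] at e1
        simp only [e4] at e2
        omega

/-! ### Factorization of tuples through their common support -/

theorem card_image_lt_of_not_injective {k : ℕ} {i : Fin k → ℤ × ℤ}
    (hi : ¬ Function.Injective i) : (Finset.univ.image i).card < k := by
  refine lt_of_le_of_ne (Finset.card_image_le.trans (by simp)) fun h => hi ?_
  have : (Finset.univ.image i).card = (Finset.univ : Finset (Fin k)).card := by simpa using h
  exact Set.injOn_univ.1 (by simpa using Finset.card_image_iff.1 this)

/-- Enumerating the common support writes both tuples as the same list of `r < k` points read along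
two surjections. Only finitely many pairs of surjections occur, whatever the tuples. -/
theorem exists_factorization {k : ℕ} {i j : Fin k → ℤ × ℤ} (hi : ¬ Function.Injective i)
    (hij : Finset.univ.image i = Finset.univ.image j) :
    ∃ r < k, ∃ α β : Fin k → Fin r, ∃ v : Fin r → ℤ × ℤ, Function.Surjective α ∧
      Function.Surjective β ∧ v ∘ α = i ∧ v ∘ β = j := by
  set S := Finset.univ.image i with hS
  let E := S.equivFin
  have hiS : ∀ l, i l ∈ S := fun l => Finset.mem_image_of_mem _ (Finset.mem_univ _)
  have hjS : ∀ l, j l ∈ S := fun l => hij ▸ Finset.mem_image_of_mem _ (Finset.mem_univ _)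
  refine ⟨S.card, card_image_lt_of_not_injective hi, fun l => E ⟨i l, hiS l⟩,
    fun l => E ⟨j l, hjS l⟩, fun p => (E.symm p : ℤ × ℤ), ?_, ?_, ?_, ?_⟩
  · intro p
    have hmem : (E.symm p : ℤ × ℤ) ∈ Finset.univ.image i := by rw [← hS]; exact (E.symm p).2
    obtain ⟨l, -, hl⟩ := Finset.mem_image.1 hmem
    exact ⟨l, by rw [← E.apply_symm_apply p]; exact congrArg E (Subtype.ext hl)⟩
  · intro p
    have hmem : (E.symm p : ℤ × ℤ) ∈ Finset.univ.image j := by rw [← hij]; exact (E.symm p).2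
    obtain ⟨l, -, hl⟩ := Finset.mem_image.1 hmem
    exact ⟨l, by rw [← E.apply_symm_apply p]; exact congrArg E (Subtype.ext hl)⟩
  · funext l; simp
  · funext l; simp

/-- The main combinatorial bound: two tuples with the same, too small support cost `δ²`. The
constant counts all maps `α, β` and depends only on `k` and `M`. -/
theorem exists_sum_coincident_pairs_le (k : ℕ) (M : ℝ) (hM : 1 ≤ M) :
    ∃ C : ℝ, 0 ≤ C ∧ ∀ (b b' : ℤ × ℤ → ℝ) (δ : ℝ), (∀ w, 0 ≤ b w) → (∀ w, 0 ≤ b' w) → 0 ≤ δ →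
      δ ≤ 1 → (∀ w, b w ≤ M) → (∀ w, b' w ≤ M) → (∀ w, b w ≤ δ ∨ b' w ≤ δ) →
      ∀ T : Finset (ℤ × ℤ), ∑ w ∈ T, b w ^ 2 ≤ M → ∑ w ∈ T, b' w ^ 2 ≤ M →
      ∀ A : Finset ((Fin k → ℤ × ℤ) × (Fin k → ℤ × ℤ)),
        (∀ ij ∈ A, ij.1 ∈ Fintype.piFinset (fun _ : Fin k => T) ∧ ¬ Function.Injective ij.1 ∧
          Finset.univ.image ij.1 = Finset.univ.image ij.2) →
        ∑ ij ∈ A, (∏ l, b (ij.1 l)) * ∏ l, b' (ij.2 l) ≤ C * δ ^ 2 := by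
  classical
  set C0 : ℝ := (2 * M * (M ^ k * M ^ k)) ^ k with hC0
  refine ⟨∑ r ∈ Finset.range k, ∑ _αβ : (Fin k → Fin r) × (Fin k → Fin r), C0,
    Finset.sum_nonneg fun _ _ => Finset.sum_nonneg fun _ _ => by positivity, ?_⟩
  intro b b' δ hb hb' hδ hδ1 hbM hbM' hmin T hs hs' A hA
  let D : Finset (Σ r : ℕ, ((Fin k → Fin r) × (Fin k → Fin r)) × (Fin r → ℤ × ℤ)) :=
    (Finset.range k).sigma fun r =>
      (Finset.univ.filter fun αβ : (Fin k → Fin r) × (Fin k → Fin r) =>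
        Function.Surjective αβ.1 ∧ Function.Surjective αβ.2) ×ˢ
        Fintype.piFinset (fun _ : Fin r => T)
  let φ : (Σ r : ℕ, ((Fin k → Fin r) × (Fin k → Fin r)) × (Fin r → ℤ × ℤ)) →
      (Fin k → ℤ × ℤ) × (Fin k → ℤ × ℤ) := fun d => (d.2.2 ∘ d.2.1.1, d.2.2 ∘ d.2.1.2)
  have hsub : A ⊆ D.image φ := by
    rintro ⟨i, j⟩ hij
    obtain ⟨hiT, hi, him⟩ := hA _ hij
    obtain ⟨r, hr, α, β, v, hα, hβ, hvi, hvj⟩ := exists_factorization hi him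
    rw [Finset.mem_image]
    refine ⟨⟨r, (α, β), v⟩, ?_, by simp only [φ, hvi, hvj]⟩
    simp only [D, Finset.mem_sigma, Finset.mem_range, Finset.mem_product, Finset.mem_filter,
      Finset.mem_univ, true_and]
    refine ⟨hr, ⟨hα, hβ⟩, ?_⟩
    rw [Fintype.mem_piFinset] at hiT ⊢
    intro p
    obtain ⟨l, rfl⟩ := hα p
    have := hiT l
    rw [← hvi] at this
    exact this
  refine (sum_le_sum_of_subset_image hsub (f := fun ij => (∏ l, b (ij.1 l)) * ∏ l, b' (ij.2 l))
    fun ij => mul_nonneg (Finset.prod_nonneg fun _ _ => hb _)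
      (Finset.prod_nonneg fun _ _ => hb' _)).trans ?_
  rw [Finset.sum_sigma, Finset.sum_mul]
  refine Finset.sum_le_sum fun r hr => ?_
  rw [Finset.sum_product, Finset.sum_mul]
  refine (Finset.sum_le_sum fun αβ hαβ => ?_).trans
    (Finset.sum_le_sum_of_subset_of_nonneg (Finset.filter_subset _ _)
      fun _ _ _ => by positivity)
  obtain ⟨-, h1, h2⟩ := Finset.mem_filter.1 hαβ
  exact sum_prod_comp_le (Finset.mem_range.1 hr) h1 h2 hb hb' hδ hδ1 hM hbM hbM' hmin T hs hs'

/-- Injective tuples with a given support are the permutations of one of them. This is the source of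
the factor `k!` in the covariance. -/
theorem card_filter_injective_image_eq {k : ℕ} {T : Finset (ℤ × ℤ)} {i : Fin k → ℤ × ℤ}
    (hi : Function.Injective i) (hiT : i ∈ Fintype.piFinset (fun _ : Fin k => T)) :
    ((Fintype.piFinset (fun _ : Fin k => T)).filter fun j =>
      Function.Injective j ∧ Finset.univ.image i = Finset.univ.image j).card = k.factorial := by
  classical
  have h1 : ((Fintype.piFinset (fun _ : Fin k => T)).filter fun j =>
      Function.Injective j ∧ Finset.univ.image i = Finset.univ.image j) =
      (Finset.univ : Finset (Equiv.Perm (Fin k))).image fun σ : Equiv.Perm (Fin k) => i ∘ σ := by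
    ext j
    simp only [Finset.mem_filter, Finset.mem_image, Finset.mem_univ, true_and]
    constructor
    · rintro ⟨-, hj, him⟩
      have : ∀ l, ∃ l', i l' = j l := by
        intro l
        have : j l ∈ Finset.univ.image i := him ▸ Finset.mem_image_of_mem _ (Finset.mem_univ l)
        simpa using this
      choose σ hσ using this
      have hσi : Function.Injective σ := fun x y hxy => hj (by rw [← hσ, ← hσ, hxy])
      exact ⟨Equiv.ofBijective σ (Finite.injective_iff_bijective.1 hσi), funext hσ⟩
    · rintro ⟨σ, rfl⟩
      rw [Fintype.mem_piFinset] at hiT ⊢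
      refine ⟨fun l => hiT _, hi.comp σ.injective, ?_⟩
      rw [← Finset.image_image, Finset.image_univ_equiv]
  rw [h1, Finset.card_image_of_injective, Finset.card_univ, Fintype.card_perm, Fintype.card_fin]
  intro σ τ h
  ext l
  exact congrArg Fin.val (hi (congrFun h l))

section Parts

variable {Ω : Type*} [MeasurableSpace Ω] {μ : Measure Ω} [IsProbabilityMeasure μ]
  {ε : ℤ × ℤ → Ω → ℝ} {k : ℕ}

/-! ### The off-diagonal and diagonal parts and their covariances -/

/-- The part of the Wick series carried by the tuples in `s`. -/
noncomputable def partLp (h : ∀ w : Fin k → ℤ × ℤ, MemLp (wick μ ε w) 2 μ)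
    (s : Set (Fin k → ℤ × ℤ)) (c : ℤ × ℤ → ℝ) : Lp ℝ 2 μ :=
  ∑' w, s.indicator (fun w => (∏ j, c (w j)) • wickLp h w) w

theorem IsStandardNoise.hasSum_partLp (hε : IsStandardNoise μ ε) (hk : k ≠ 0)
    (hmom : Integrable (fun ω => |ε 0 ω| ^ (2 * k)) μ) {c : ℤ × ℤ → ℝ}
    (hc : Summable fun w => c w ^ 2) (s : Set (Fin k → ℤ × ℤ)) :
    HasSum (s.indicator fun w => (∏ j, c (w j)) • wickLp (hε.memLp_wick hk hmom) w)
      (partLp (hε.memLp_wick hk hmom) s c) :=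
  ((hε.summable_wickLp hk hmom hc).indicator s).hasSum

theorem IsStandardNoise.hasL2Sum_partLp (hε : IsStandardNoise μ ε) (hk : k ≠ 0)
    (hmom : Integrable (fun ω => |ε 0 ω| ^ (2 * k)) μ) {c : ℤ × ℤ → ℝ}
    (hc : Summable fun w => c w ^ 2) (s : Set (Fin k → ℤ × ℤ)) :
    HasL2Sum μ (fun (w : s) ω => (∏ j, c (w.1 j)) * wick μ ε w.1 ω)
      (partLp (hε.memLp_wick hk hmom) s c) := by
  have hwm : ∀ w : s, MemLp (fun ω => (∏ j, c (w.1 j)) * wick μ ε w.1 ω) 2 μ := fun w =>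
    (hε.memLp_wick hk hmom w.1).const_mul _
  have h := hasSum_subtype_iff_indicator.2 (hε.hasSum_partLp hk hmom hc s)
  have e : ((fun w => (∏ j, c (w j)) • wickLp (hε.memLp_wick hk hmom) w) ∘ Subtype.val) =
      fun w : s => (hwm w).toLp (fun ω => (∏ j, c (w.1 j)) * wick μ ε w.1 ω) := funext fun w => rfl
  rw [e] at h
  exact hasL2Sum_of_hasSum hwm h

theorem IsStandardNoise.partLp_add_compl (hε : IsStandardNoise μ ε) (hk : k ≠ 0)
    (hmom : Integrable (fun ω => |ε 0 ω| ^ (2 * k)) μ) {c : ℤ × ℤ → ℝ}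
    (hc : Summable fun w => c w ^ 2) (s : Set (Fin k → ℤ × ℤ)) :
    partLp (hε.memLp_wick hk hmom) s c + partLp (hε.memLp_wick hk hmom) sᶜ c =
      ∑' w : Fin k → ℤ × ℤ, (∏ j, c (w j)) • wickLp (hε.memLp_wick hk hmom) w := by
  refine ((HasSum.add_compl (s := s) ?_ ?_).tsum_eq).symm
  · exact hasSum_subtype_iff_indicator.2 (hε.hasSum_partLp hk hmom hc s)
  · exact hasSum_subtype_iff_indicator.2 (hε.hasSum_partLp hk hmom hc sᶜ)

theorem IsStandardNoise.integral_partLp (hε : IsStandardNoise μ ε) (hk : k ≠ 0)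
    (hmom : Integrable (fun ω => |ε 0 ω| ^ (2 * k)) μ) {c : ℤ × ℤ → ℝ}
    (hc : Summable fun w => c w ^ 2) (s : Set (Fin k → ℤ × ℤ)) :
    ∫ ω, partLp (hε.memLp_wick hk hmom) s c ω ∂μ = 0 := by
  -- The expectation is the inner product with the constant `1`, a continuous functional, so it may
  -- be taken term by term.
  have h1 : MemLp (fun _ : Ω => (1 : ℝ)) 2 μ := memLp_const 1
  have h2 : ∀ G : Lp ℝ 2 μ, ∫ ω, G ω ∂μ = innerSL ℝ (h1.toLp) G := by
    intro G
    rw [innerSL_apply_apply]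
    nth_rw 2 [← Lp.toLp_coeFn G (Lp.memLp G)]
    rw [inner_toLp]
    simp
  rw [h2]
  refine HasSum.unique ((hε.hasSum_partLp hk hmom hc s).mapL (innerSL ℝ (h1.toLp))) ?_
  convert hasSum_zero with w
  by_cases hw : w ∈ s
  · rw [Set.indicator_of_mem hw, map_smul, innerSL_apply_apply, wickLp, inner_toLp]
    simp [hε.integral_wick hk hmom w]
  · rw [Set.indicator_of_notMem hw, map_zero]

/-- Boxes `T^k` exhaust the set of tuples, so inner products of the infinite series can be estimated
on finite double sums. -/
theorem IsStandardNoise.tendsto_inner_partLp (hε : IsStandardNoise μ ε) (hk : k ≠ 0)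
    (hmom : Integrable (fun ω => |ε 0 ω| ^ (2 * k)) μ) {c c' : ℤ × ℤ → ℝ}
    (hc : Summable fun w => c w ^ 2) (hc' : Summable fun w => c' w ^ 2)
    (s s' : Set (Fin k → ℤ × ℤ)) [DecidablePred (· ∈ s)] [DecidablePred (· ∈ s')] :
    Tendsto (fun T : Finset (ℤ × ℤ) =>
      ∑ i ∈ (Fintype.piFinset (fun _ : Fin k => T)).filter (· ∈ s),
        ∑ j ∈ (Fintype.piFinset (fun _ : Fin k => T)).filter (· ∈ s'),
          (∏ l, c (i l)) * (∏ l, c' (j l)) * ∫ ω, wick μ ε i ω * wick μ ε j ω ∂μ) atTop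
      (𝓝 (inner ℝ (partLp (hε.memLp_wick hk hmom) s c)
        (partLp (hε.memLp_wick hk hmom) s' c'))) := by
  have h1 : ∀ {c : ℤ × ℤ → ℝ} (_ : Summable fun w => c w ^ 2) (s : Set (Fin k → ℤ × ℤ))
      [DecidablePred (· ∈ s)],
      Tendsto (fun T : Finset (ℤ × ℤ) =>
        ∑ i ∈ (Fintype.piFinset (fun _ : Fin k => T)).filter (· ∈ s),
          (∏ l, c (i l)) • wickLp (hε.memLp_wick hk hmom) i) atTop
        (𝓝 (partLp (hε.memLp_wick hk hmom) s c)) := by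
    intro c hc s _
    have := hε.hasSum_partLp hk hmom hc s
    rw [HasSum, SummationFilter.unconditional_filter] at this
    refine (this.comp tendsto_piFinset_atTop).congr fun T => ?_
    rw [Function.comp, Finset.sum_filter]
    exact Finset.sum_congr rfl fun i _ => by rw [Set.indicator_apply]
  refine ((h1 hc s).inner (h1 hc' s')).congr fun T => ?_
  rw [sum_inner]
  refine Finset.sum_congr rfl fun i _ => ?_
  rw [inner_sum]
  refine Finset.sum_congr rfl fun j _ => ?_
  rw [real_inner_smul_left, real_inner_smul_right, wickLp, wickLp, inner_toLp, mul_assoc]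

/-- An injective tuple has `k` support points and a non-injective one has fewer, so the supports
never agree. -/
theorem IsStandardNoise.inner_partLp_injective_not_injective (hε : IsStandardNoise μ ε)
    (hk : k ≠ 0) (hmom : Integrable (fun ω => |ε 0 ω| ^ (2 * k)) μ) {c c' : ℤ × ℤ → ℝ}
    (hc : Summable fun w => c w ^ 2) (hc' : Summable fun w => c' w ^ 2) :
    inner ℝ (partLp (hε.memLp_wick hk hmom) {w | Function.Injective w} c)
      (partLp (hε.memLp_wick hk hmom) {w | Function.Injective w}ᶜ c') = 0 := by
  classical
  refine tendsto_nhds_unique (hε.tendsto_inner_partLp hk hmom hc hc' _ _) ?_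
  refine tendsto_const_nhds.congr fun T => ?_
  symm
  refine Finset.sum_eq_zero fun i hi => Finset.sum_eq_zero fun j hj => ?_
  have hi' : Function.Injective i := (Finset.mem_filter.1 hi).2
  have hj' : ¬ Function.Injective j := (Finset.mem_filter.1 hj).2
  rw [hε.integral_wick_mul_eq_zero hk hmom, mul_zero]
  intro h
  have h1 := card_image_lt_of_not_injective hj'
  rw [← h, Finset.card_image_of_injective _ hi'] at h1
  simp at h1

/-- For the diagonal part only pairs with equal supports survive, and these are coincident pairs.
For the off-diagonal part the surviving pairs give `k!` times the sum of `∏ c c'` over injective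
tuples; this is the full power `(∑ c c')^k` minus its non-injective terms, which are coincident
pairs again. -/
theorem IsStandardNoise.exists_covariance_bounds (hε : IsStandardNoise μ ε) (hk : k ≠ 0)
    (hmom : Integrable (fun ω => |ε 0 ω| ^ (2 * k)) μ) {M : ℝ} (hM : 1 ≤ M) :
    ∃ C : ℝ, 0 ≤ C ∧ ∀ (c c' : ℤ × ℤ → ℝ) (δ : ℝ), (Summable fun w => c w ^ 2) →
      (Summable fun w => c' w ^ 2) → ∑' w, c w ^ 2 ≤ M → ∑' w, c' w ^ 2 ≤ M → 0 ≤ δ → δ ≤ 1 →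
      (∀ w, |c w| ≤ δ ∨ |c' w| ≤ δ) →
      |inner ℝ (partLp (hε.memLp_wick hk hmom) {w | Function.Injective w}ᶜ c)
        (partLp (hε.memLp_wick hk hmom) {w | Function.Injective w}ᶜ c')| ≤ C * δ ^ 2 ∧
      |inner ℝ (partLp (hε.memLp_wick hk hmom) {w | Function.Injective w} c)
        (partLp (hε.memLp_wick hk hmom) {w | Function.Injective w} c') -
          k.factorial * (∑' w, c w * c' w) ^ k| ≤ C * δ ^ 2 := by
  classical
  obtain ⟨C0, hC0, hpairs⟩ := exists_sum_coincident_pairs_le k M hM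
  obtain ⟨B, hB0, hB⟩ := hε.exists_abs_integral_wick_mul_le hk hmom
  refine ⟨B * C0 + k.factorial * C0, by positivity, ?_⟩
  intro c c' δ hc hc' hcM hcM' hδ hδ1 hmin
  have hle : ∀ {c : ℤ × ℤ → ℝ}, (Summable fun w => c w ^ 2) → ∑' w, c w ^ 2 ≤ M →
      ∀ w, |c w| ≤ M := by
    intro c hc hcM w
    have h1 := (hc.le_tsum w fun _ _ => sq_nonneg _).trans hcM
    rw [← sq_abs] at h1
    nlinarith [abs_nonneg (c w)]
  have hsum : ∀ {c : ℤ × ℤ → ℝ}, (Summable fun w => c w ^ 2) → ∑' w, c w ^ 2 ≤ M →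
      ∀ T : Finset (ℤ × ℤ), ∑ w ∈ T, |c w| ^ 2 ≤ M := by
    intro c hc hcM T
    simp only [sq_abs]
    exact (hc.sum_le_tsum _ fun _ _ => sq_nonneg _).trans hcM
  have hP := fun T => hpairs (fun w => |c w|) (fun w => |c' w|) δ (fun w => abs_nonneg _)
    (fun w => abs_nonneg _) hδ hδ1 (hle hc hcM) (hle hc' hcM') hmin T (hsum hc hcM T)
    (hsum hc' hcM' T)
  constructor
  · refine le_of_tendsto (hε.tendsto_inner_partLp hk hmom hc hc' _ _).abs
      (Eventually.of_forall fun T => ?_)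
    set box := (Fintype.piFinset (fun _ : Fin k => T)).filter
      (· ∈ ({w | Function.Injective w}ᶜ : Set (Fin k → ℤ × ℤ))) with hbox
    set A := (box ×ˢ box).filter fun ij : (Fin k → ℤ × ℤ) × (Fin k → ℤ × ℤ) =>
      Finset.univ.image ij.1 = Finset.univ.image ij.2 with hA
    have hb1 := hP T A (fun ij hij => by
      obtain ⟨h1, h2⟩ := Finset.mem_filter.1 hij
      obtain ⟨h3, h4⟩ := Finset.mem_filter.1 (Finset.mem_product.1 h1).1
      exact ⟨h3, h4, h2⟩)
    calc |∑ i ∈ box, ∑ j ∈ box, (∏ l, c (i l)) * (∏ l, c' (j l)) *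
            ∫ ω, wick μ ε i ω * wick μ ε j ω ∂μ|
        ≤ ∑ ij ∈ box ×ˢ box, |(∏ l, c (ij.1 l)) * (∏ l, c' (ij.2 l)) *
            ∫ ω, wick μ ε ij.1 ω * wick μ ε ij.2 ω ∂μ| := by
          rw [← Finset.sum_product']
          exact Finset.abs_sum_le_sum_abs _ _
      _ ≤ ∑ ij ∈ box ×ˢ box, if Finset.univ.image ij.1 = Finset.univ.image ij.2 then
            B * ((∏ l, |c (ij.1 l)|) * ∏ l, |c' (ij.2 l)|) else 0 := by
          refine Finset.sum_le_sum fun ij _ => ?_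
          split_ifs with h
          · rw [abs_mul, abs_mul, Finset.abs_prod, Finset.abs_prod, mul_comm B]
            exact mul_le_mul_of_nonneg_left (hB _ _) (mul_nonneg
              (Finset.prod_nonneg fun _ _ => abs_nonneg _)
              (Finset.prod_nonneg fun _ _ => abs_nonneg _))
          · rw [hε.integral_wick_mul_eq_zero hk hmom h, mul_zero, abs_zero]
      _ = B * ∑ ij ∈ A, (∏ l, |c (ij.1 l)|) * ∏ l, |c' (ij.2 l)| := by
          rw [← Finset.sum_filter, Finset.mul_sum]
      _ ≤ B * (C0 * δ ^ 2) := mul_le_mul_of_nonneg_left hb1 hB0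
      _ ≤ _ := by
          have : 0 ≤ (k.factorial : ℝ) * C0 * δ ^ 2 := by positivity
          nlinarith
  · have hcc : Summable fun w => c w * c' w := by
      refine Summable.of_norm_bounded (g := fun w => c w ^ 2 + c' w ^ 2) (hc.add hc') fun w => ?_
      rw [Real.norm_eq_abs, abs_le]
      constructor <;> nlinarith [sq_nonneg (c w - c' w), sq_nonneg (c w + c' w)]
    have hlim2 : Tendsto (fun T : Finset (ℤ × ℤ) => (k.factorial : ℝ) * (∑ w ∈ T, c w * c' w) ^ k)
        atTop (𝓝 (k.factorial * (∑' w, c w * c' w) ^ k)) := by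
      have := hcc.hasSum
      rw [HasSum, SummationFilter.unconditional_filter] at this
      exact (this.pow k).const_mul _
    refine le_of_tendsto ((hε.tendsto_inner_partLp hk hmom hc hc' _ _).sub hlim2).abs
      (Eventually.of_forall fun T => ?_)
    set full := Fintype.piFinset (fun _ : Fin k => T) with hfull
    set box := full.filter (· ∈ ({w | Function.Injective w} : Set (Fin k → ℤ × ℤ))) with hbox
    set nbox := full.filter (fun w => ¬ (w ∈ ({w | Function.Injective w} :
      Set (Fin k → ℤ × ℤ)))) with hnbox
    have e1 : ∑ i ∈ box, ∑ j ∈ box, (∏ l, c (i l)) * (∏ l, c' (j l)) *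
        ∫ ω, wick μ ε i ω * wick μ ε j ω ∂μ =
        k.factorial * ∑ i ∈ box, (∏ l, c (i l)) * ∏ l, c' (i l) := by
      rw [Finset.mul_sum]
      refine Finset.sum_congr rfl fun i hi => ?_
      obtain ⟨hiT, hii⟩ := Finset.mem_filter.1 hi
      have e2 : ∀ j ∈ box, (∏ l, c (i l)) * (∏ l, c' (j l)) *
          ∫ ω, wick μ ε i ω * wick μ ε j ω ∂μ =
          if Finset.univ.image i = Finset.univ.image j then
            (∏ l, c (i l)) * (∏ l, c' (i l)) else 0 := by
        intro j hj
        have hji : Function.Injective j := (Finset.mem_filter.1 hj).2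
        split_ifs with h
        · rw [hε.integral_wick_mul_of_injective hk hmom hii hji h, mul_one]
          congr 1
          rw [← Finset.prod_image (g := j) (f := c') hji.injOn, ← h,
            Finset.prod_image (fun x _ y _ hxy => hii hxy)]
        · rw [hε.integral_wick_mul_eq_zero hk hmom h, mul_zero]
      rw [Finset.sum_congr rfl e2, ← Finset.sum_filter, Finset.sum_const, nsmul_eq_mul,
        hbox, Finset.filter_filter]
      congr 2
      exact card_filter_injective_image_eq hii hiT
    -- Expanding the power produces all tuples; the non-injective ones, viewed as pairs `(i, i)`,
    -- fall under the coincidence bound.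
    have e3 : (∑ w ∈ T, c w * c' w) ^ k = ∑ i ∈ box, (∏ l, c (i l)) * ∏ l, c' (i l) +
        ∑ i ∈ nbox, (∏ l, c (i l)) * ∏ l, c' (i l) := by
      rw [hbox, hnbox, Finset.sum_filter_add_sum_filter_not]
      simp only [← Finset.prod_mul_distrib]
      rw [hfull, ← Finset.prod_univ_sum (fun _ : Fin k => T) (fun _ w => c w * c' w)]
      simp
    rw [e1, e3, mul_add, sub_add_cancel_left, abs_neg, abs_mul, Nat.abs_cast]
    have hb1 := hP T (nbox.image fun i => (i, i)) (fun ij hij => by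
      obtain ⟨i, hi, rfl⟩ := Finset.mem_image.1 hij
      obtain ⟨h3, h4⟩ := Finset.mem_filter.1 hi
      exact ⟨h3, h4, rfl⟩)
    rw [Finset.sum_image (fun x _ y _ h => (Prod.ext_iff.1 h).1)] at hb1
    have h5 : |∑ i ∈ nbox, (∏ l, c (i l)) * ∏ l, c' (i l)| ≤ C0 * δ ^ 2 := by
      refine (Finset.abs_sum_le_sum_abs _ _).trans (le_trans (le_of_eq ?_) hb1)
      exact Finset.sum_congr rfl fun i _ => by rw [abs_mul, Finset.abs_prod, Finset.abs_prod]
    have h6 : (k.factorial : ℝ) * |∑ i ∈ nbox, (∏ l, c (i l)) * ∏ l, c' (i l)| ≤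
        k.factorial * (C0 * δ ^ 2) := mul_le_mul_of_nonneg_left h5 (Nat.cast_nonneg _)
    have : 0 ≤ B * C0 * δ ^ 2 := by positivity
    nlinarith

end Parts

/-! ### The anisotropic gauge -/

section Gauge

variable {q₁ q₂ : ℝ}

/-- The gauge `ρ` as a function on the plane. -/
noncomputable def gauge (q₁ q₂ : ℝ) (x : ℝ × ℝ) : ℝ := rho q₁ q₂ x.1 x.2

theorem gauge_nonneg (q₁ q₂ : ℝ) (x : ℝ × ℝ) : 0 ≤ gauge q₁ q₂ x :=
  Real.rpow_nonneg (add_nonneg (by positivity) (Real.rpow_nonneg (abs_nonneg _) _)) _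

theorem gauge_sq (q₁ q₂ : ℝ) (x : ℝ × ℝ) :
    gauge q₁ q₂ x ^ 2 = x.1 ^ 2 + |x.2| ^ (2 * q₂ / q₁) := by
  have h : 0 ≤ |x.1| ^ 2 + |x.2| ^ (2 * q₂ / q₁) :=
    add_nonneg (by positivity) (Real.rpow_nonneg (abs_nonneg _) _)
  rw [gauge, rho, ← Real.rpow_natCast, ← Real.rpow_mul h]
  norm_num

theorem abs_rpow_sq (q₁ q₂ s : ℝ) : (|s| ^ (q₂ / q₁)) ^ 2 = |s| ^ (2 * q₂ / q₁) := by
  rw [← Real.rpow_natCast, ← Real.rpow_mul (abs_nonneg _)]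
  congr 1
  push_cast
  ring

theorem abs_fst_le_gauge (q₁ q₂ : ℝ) (x : ℝ × ℝ) : |x.1| ≤ gauge q₁ q₂ x := by
  refine abs_le_of_sq_le_sq ?_ (gauge_nonneg _ _ _)
  rw [gauge_sq]
  exact le_add_of_nonneg_right (Real.rpow_nonneg (abs_nonneg _) _)

theorem abs_snd_rpow_le_gauge (q₁ q₂ : ℝ) (x : ℝ × ℝ) :
    |x.2| ^ (q₂ / q₁) ≤ gauge q₁ q₂ x := by
  refine le_of_sq_le_sq ?_ (gauge_nonneg _ _ _)
  rw [gauge_sq, abs_rpow_sq]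
  exact le_add_of_nonneg_left (sq_nonneg _)

theorem gauge_le_add (q₁ q₂ : ℝ) (x : ℝ × ℝ) :
    gauge q₁ q₂ x ≤ |x.1| + |x.2| ^ (q₂ / q₁) := by
  have h := Real.rpow_nonneg (abs_nonneg x.2) (q₂ / q₁)
  refine le_of_sq_le_sq ?_ (by positivity)
  rw [gauge_sq, ← abs_rpow_sq, ← sq_abs x.1]
  nlinarith [mul_nonneg (abs_nonneg x.1) h]

theorem gauge_neg (q₁ q₂ : ℝ) (x : ℝ × ℝ) : gauge q₁ q₂ (-x) = gauge q₁ q₂ x := by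
  simp [gauge, rho]

theorem gauge_neg_snd (q₁ q₂ t s : ℝ) : gauge q₁ q₂ (t, -s) = gauge q₁ q₂ (t, s) := by
  simp [gauge, rho]

theorem gauge_zero (h₁ : 0 < q₁) (h₂ : 0 < q₂) : gauge q₁ q₂ 0 = 0 := by
  have : (2 * q₂ / q₁) ≠ 0 := by positivity
  simp [gauge, rho, Real.zero_rpow this]

theorem gauge_pos {x : ℝ × ℝ} (hx : x ≠ 0) : 0 < gauge q₁ q₂ x := by
  have h2 : x.1 ≠ 0 ∨ x.2 ≠ 0 := by
    by_contra! h
    exact hx (Prod.ext h.1 h.2)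
  rcases h2 with h | h
  · exact (abs_pos.2 h).trans_le (abs_fst_le_gauge _ _ _)
  · exact (Real.rpow_pos_of_pos (abs_pos.2 h) _).trans_le (abs_snd_rpow_le_gauge _ _ _)

theorem abs_fst_lt_gauge {x : ℝ × ℝ} (hx : x.2 ≠ 0) : |x.1| < gauge q₁ q₂ x := by
  refine abs_lt_of_sq_lt_sq ?_ (gauge_nonneg _ _ _)
  rw [gauge_sq]
  exact lt_add_of_pos_right _ (Real.rpow_pos_of_pos (abs_pos.2 hx) _)

theorem abs_fst_div_gauge_le_one (q₁ q₂ : ℝ) (x : ℝ × ℝ) : |x.1 / gauge q₁ q₂ x| ≤ 1 := by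
  rw [abs_div, abs_of_nonneg (gauge_nonneg q₁ q₂ x)]
  exact div_le_one_of_le₀ (abs_fst_le_gauge _ _ _) (gauge_nonneg _ _ _)

theorem fst_div_gauge_mem_Icc (q₁ q₂ : ℝ) (x : ℝ × ℝ) :
    x.1 / gauge q₁ q₂ x ∈ Set.Icc (-1 : ℝ) 1 :=
  abs_le.1 (abs_fst_div_gauge_le_one q₁ q₂ x)

theorem continuous_gauge (h₁ : 0 < q₁) (h₂ : 0 < q₂) : Continuous (gauge q₁ q₂) := by
  unfold gauge rho
  have h3 : 0 ≤ 2 * q₂ / q₁ := by positivity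
  exact ((continuous_fst.abs.pow 2).add (continuous_snd.abs.rpow_const fun _ => Or.inr h3)).rpow_const
    fun _ => Or.inr (by norm_num)

/-- The anisotropic dilation. -/
noncomputable def dil (q₁ q₂ r : ℝ) (x : ℝ × ℝ) : ℝ × ℝ := (r * x.1, r ^ gamma0 q₁ q₂ * x.2)

theorem gauge_dil (h₁ : 0 < q₁) (h₂ : 0 < q₂) {r : ℝ} (hr : 0 ≤ r) (x : ℝ × ℝ) :
    gauge q₁ q₂ (dil q₁ q₂ r x) = r * gauge q₁ q₂ x := by
  refine (sq_eq_sq₀ (gauge_nonneg _ _ _) (mul_nonneg hr (gauge_nonneg _ _ _))).1 ?_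
  rw [mul_pow, gauge_sq, gauge_sq, dil]
  simp only
  rw [abs_mul, Real.mul_rpow (abs_nonneg _) (abs_nonneg _),
    abs_of_nonneg (Real.rpow_nonneg hr _), ← Real.rpow_mul hr, gamma0]
  have : q₁ / q₂ * (2 * q₂ / q₁) = (2 : ℕ) := by push_cast; field_simp
  rw [this, Real.rpow_natCast]
  ring

theorem dil_add (r : ℝ) (x y : ℝ × ℝ) :
    dil q₁ q₂ r (x + y) = dil q₁ q₂ r x + dil q₁ q₂ r y := by
  simp [dil, mul_add]

/-- The constant in the quasi-triangle inequality. -/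
noncomputable def gaugeConst (q₁ q₂ : ℝ) : ℝ := 1 + 2 ^ (q₂ / q₁)

theorem gaugeConst_pos (q₁ q₂ : ℝ) : 0 < gaugeConst q₁ q₂ := by
  have := Real.rpow_pos_of_pos (zero_lt_two' ℝ) (q₂ / q₁)
  rw [gaugeConst]; linarith

theorem gauge_add_le (h₁ : 0 < q₁) (h₂ : 0 < q₂) (x y : ℝ × ℝ) :
    gauge q₁ q₂ (x + y) ≤ gaugeConst q₁ q₂ * (gauge q₁ q₂ x + gauge q₁ q₂ y) := by
  have hβ : 0 ≤ q₂ / q₁ := by positivity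
  have hs : |x.2 + y.2| ^ (q₂ / q₁) ≤
      2 ^ (q₂ / q₁) * (|x.2| ^ (q₂ / q₁) + |y.2| ^ (q₂ / q₁)) := by
    have hx := Real.rpow_nonneg (abs_nonneg x.2) (q₂ / q₁)
    have hy := Real.rpow_nonneg (abs_nonneg y.2) (q₂ / q₁)
    have h2 := Real.rpow_nonneg (zero_le_two (α := ℝ)) (q₂ / q₁)
    calc |x.2 + y.2| ^ (q₂ / q₁) ≤ (2 * max |x.2| |y.2|) ^ (q₂ / q₁) := by
          refine Real.rpow_le_rpow (abs_nonneg _) ((abs_add_le _ _).trans ?_) hβ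
          have := le_max_left |x.2| |y.2|
          have := le_max_right |x.2| |y.2|
          linarith
      _ = 2 ^ (q₂ / q₁) * (max |x.2| |y.2|) ^ (q₂ / q₁) :=
          Real.mul_rpow zero_le_two (le_max_of_le_left (abs_nonneg _))
      _ ≤ _ := by
          refine mul_le_mul_of_nonneg_left ?_ h2
          rcases max_choice |x.2| |y.2| with h | h <;> rw [h] <;> linarith
  have h3 := gauge_le_add q₁ q₂ (x + y)
  have h4 := abs_add_le x.1 y.1
  have h5 := abs_fst_le_gauge q₁ q₂ x
  have h6 := abs_fst_le_gauge q₁ q₂ y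
  have h7 := abs_snd_rpow_le_gauge q₁ q₂ x
  have h8 := abs_snd_rpow_le_gauge q₁ q₂ y
  have h9 : (2 : ℝ) ^ (q₂ / q₁) * (|x.2| ^ (q₂ / q₁) + |y.2| ^ (q₂ / q₁)) ≤
      2 ^ (q₂ / q₁) * (gauge q₁ q₂ x + gauge q₁ q₂ y) :=
    mul_le_mul_of_nonneg_left (add_le_add h7 h8) (Real.rpow_nonneg zero_le_two _)
  simp only [Prod.fst_add, Prod.snd_add] at h3
  rw [gaugeConst]
  linarith

/-- A sum of two points cannot be far from the origin while both points are near it. This supplies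
the dichotomy for the coefficients as well as the lower bound separating the two singularities of
the convolution. -/
theorem gauge_div_le_or (h₁ : 0 < q₁) (h₂ : 0 < q₂) (x y : ℝ × ℝ) :
    gauge q₁ q₂ (x + y) / (2 * gaugeConst q₁ q₂) ≤ gauge q₁ q₂ x ∨
      gauge q₁ q₂ (x + y) / (2 * gaugeConst q₁ q₂) ≤ gauge q₁ q₂ y := by
  have hK := gaugeConst_pos q₁ q₂
  by_contra! h
  have h1 := gauge_add_le h₁ h₂ x y
  have h2 := add_lt_add h.1 h.2
  have h3 := mul_lt_mul_of_pos_left h2 hK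
  have h4 : gaugeConst q₁ q₂ * (gauge q₁ q₂ (x + y) / (2 * gaugeConst q₁ q₂) +
      gauge q₁ q₂ (x + y) / (2 * gaugeConst q₁ q₂)) = gauge q₁ q₂ (x + y) := by
    field_simp; ring
  linarith

/-! ### Lattice points at infinity -/

/-- A lattice point as a point of the plane. -/
def toPlane (z : ℤ × ℤ) : ℝ × ℝ := ((z.1 : ℝ), (z.2 : ℝ))

theorem rhoZ_eq (q₁ q₂ : ℝ) (z : ℤ × ℤ) : rhoZ q₁ q₂ z = gauge q₁ q₂ (toPlane z) := rfl

theorem toPlane_add (z w : ℤ × ℤ) : toPlane (z + w) = toPlane z + toPlane w := by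
  simp [toPlane]

theorem toPlane_neg (z : ℤ × ℤ) : toPlane (-z) = -toPlane z := by
  simp [toPlane]

theorem eventually_atInfinity {p : ℤ × ℤ → Prop} :
    (∀ᶠ z in atInfinity, p z) ↔ ∃ N : ℤ, ∀ z, N ≤ |z.1| + |z.2| → p z := by
  rw [atInfinity, (atTop_basis.comap _).eventually_iff]
  simp

theorem tendsto_atInfinity_iff_rhoZ (h₁ : 0 < q₁) (h₂ : 0 < q₂) {α : Type*} {l : Filter α}
    {f : α → ℤ × ℤ} :
    Tendsto f l atInfinity ↔ Tendsto (fun a => rhoZ q₁ q₂ (f a)) l atTop := by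
  have hβ : 0 ≤ q₂ / q₁ := by positivity
  rw [atInfinity, tendsto_comap_iff]
  constructor
  · intro h
    rw [tendsto_atTop] at h ⊢
    intro R
    filter_upwards [h ⌈1 + |R| + |R| ^ (q₁ / q₂)⌉] with a ha
    by_contra! hlt
    have h3 : gauge q₁ q₂ (toPlane (f a)) ≤ |R| := (rhoZ_eq q₁ q₂ (f a)) ▸ hlt.le.trans (le_abs_self R)
    have h4 := (abs_fst_le_gauge q₁ q₂ (toPlane (f a))).trans h3
    have h5 := (abs_snd_rpow_le_gauge q₁ q₂ (toPlane (f a))).trans h3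
    have h6 : |(toPlane (f a)).2| ≤ |R| ^ (q₁ / q₂) := by
      have := Real.rpow_le_rpow (Real.rpow_nonneg (abs_nonneg _) _) h5
        (show 0 ≤ q₁ / q₂ by positivity)
      rwa [← Real.rpow_mul (abs_nonneg _), div_mul_div_cancel₀ h₁.ne', div_self h₂.ne',
        Real.rpow_one] at this
    have h7 : 1 + |R| + |R| ^ (q₁ / q₂) ≤ ((|(f a).1| + |(f a).2| : ℤ) : ℝ) := Int.ceil_le.1 ha
    push_cast at h7
    simp only [toPlane] at h4 h6
    linarith
  · intro h
    rw [tendsto_atTop] at h ⊢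
    intro N
    filter_upwards [h (1 + |(N : ℝ)| + |(N : ℝ)| ^ (q₂ / q₁))] with a ha
    by_contra! hlt
    simp only [Function.comp] at hlt
    have h3 : (|((f a).1 : ℝ)| + |((f a).2 : ℝ)|) < N := by exact_mod_cast hlt
    have h4 := gauge_le_add q₁ q₂ (toPlane (f a))
    have h5 := abs_nonneg ((f a).1 : ℝ)
    have h6 := abs_nonneg ((f a).2 : ℝ)
    have h7 := le_abs_self (N : ℝ)
    have h8 : |((f a).2 : ℝ)| ^ (q₂ / q₁) ≤ |(N : ℝ)| ^ (q₂ / q₁) :=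
      Real.rpow_le_rpow h6 (by linarith) hβ
    rw [rhoZ_eq] at ha
    simp only [toPlane] at ha h4
    linarith

theorem tendsto_rhoZ_atInfinity (h₁ : 0 < q₁) (h₂ : 0 < q₂) :
    Tendsto (rhoZ q₁ q₂) atInfinity atTop :=
  (tendsto_atInfinity_iff_rhoZ h₁ h₂).1 tendsto_id

/-! ### Bounds on the coefficients -/

theorem IsLRDCoefficient.exists_abs_L₀_le {L₀ : ℝ → ℝ} {a : ℤ × ℤ → ℝ}
    (ha : IsLRDCoefficient q₁ q₂ L₀ a) :
    ∃ C : ℝ, 0 ≤ C ∧ ∀ u ∈ Set.Icc (-1 : ℝ) 1, |L₀ u| ≤ C := by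
  obtain ⟨C, hC⟩ := ha.L₀_regular.1
  exact ⟨C, (abs_nonneg _).trans (hC 0 (by norm_num)), hC⟩

/-- The asymptotics hold only near infinity; the `1 +` in the bound makes it valid at every lattice
point, including the origin where `ρ` vanishes. -/
theorem IsLRDCoefficient.exists_abs_le {L₀ : ℝ → ℝ} {a : ℤ × ℤ → ℝ}
    (ha : IsLRDCoefficient q₁ q₂ L₀ a) :
    ∃ C : ℝ, 0 ≤ C ∧ ∀ w, |a w| ≤ C * (1 + rhoZ q₁ q₂ w) ^ (-q₁) := by
  obtain ⟨C₀, hC₀, hL⟩ := ha.exists_abs_L₀_le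
  obtain ⟨o, ho, hao⟩ := ha.asymptotics
  have h₁ := ha.q₁_pos
  have h₂ := ha.q₂_pos
  have hρ0 : ∀ w, 0 ≤ rhoZ q₁ q₂ w := fun w => gauge_nonneg q₁ q₂ (toPlane w)
  have hev : ∀ᶠ w in atInfinity,
      |a w| ≤ (C₀ + 1) * 2 ^ q₁ * (1 + rhoZ q₁ q₂ w) ^ (-q₁) := by
    have ho1 : ∀ᶠ w in atInfinity, |o w| < 1 := by
      have := ho.abs
      rw [abs_zero] at this
      exact this.eventually_lt_const one_pos
    filter_upwards [hao, ho1, (tendsto_rhoZ_atInfinity h₁ h₂).eventually_ge_atTop 1]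
      with w h3 h4 h5
    -- For `ρ ≥ 1` one has `(1 + ρ)/2 ≤ ρ`.
    have h6 : rhoZ q₁ q₂ w ^ (-q₁) ≤ 2 ^ q₁ * (1 + rhoZ q₁ q₂ w) ^ (-q₁) := by
      have e : (2 : ℝ) ^ q₁ * (1 + rhoZ q₁ q₂ w) ^ (-q₁) = ((1 + rhoZ q₁ q₂ w) / 2) ^ (-q₁) := by
        rw [Real.div_rpow (by linarith) zero_le_two, Real.rpow_neg zero_le_two, div_inv_eq_mul,
          mul_comm]
      rw [e]
      exact Real.rpow_le_rpow_of_nonpos (by linarith) (by linarith) (by linarith)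
    have h7 := hL _ (fst_div_gauge_mem_Icc q₁ q₂ (toPlane w))
    have h8 : |L₀ ((w.1 : ℝ) / rhoZ q₁ q₂ w) + o w| ≤ C₀ + 1 :=
      (abs_add_le _ _).trans (add_le_add h7 h4.le)
    rw [h3, abs_mul, abs_of_nonneg (Real.rpow_nonneg (hρ0 w) _)]
    calc _ ≤ (2 ^ q₁ * (1 + rhoZ q₁ q₂ w) ^ (-q₁)) * (C₀ + 1) := by
          gcongr
      _ = _ := by ring
  obtain ⟨N, hN⟩ := eventually_atInfinity.1 hev
  set F : Finset (ℤ × ℤ) := Finset.Icc (-|N|) |N| ×ˢ Finset.Icc (-|N|) |N| with hF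
  -- The sum over the finite box `F` absorbs the points where the asymptotic bound is not available.
  refine ⟨(C₀ + 1) * 2 ^ q₁ + ∑ w ∈ F, |a w| * (1 + rhoZ q₁ q₂ w) ^ q₁,
    add_nonneg (by positivity) (Finset.sum_nonneg fun w _ => ?_), fun w => ?_⟩
  · exact mul_nonneg (abs_nonneg _) (Real.rpow_nonneg (by linarith [hρ0 w]) _)
  have h10 : ∀ w, 0 < 1 + rhoZ q₁ q₂ w := fun w => by linarith [hρ0 w]
  have hS : 0 ≤ ∑ w ∈ F, |a w| * (1 + rhoZ q₁ q₂ w) ^ q₁ :=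
    Finset.sum_nonneg fun w _ => mul_nonneg (abs_nonneg _) (Real.rpow_nonneg (h10 w).le _)
  have h11 : 0 ≤ (1 + rhoZ q₁ q₂ w) ^ (-q₁) := Real.rpow_nonneg (h10 w).le _
  rw [add_mul]
  by_cases hw : N ≤ |w.1| + |w.2|
  · exact (hN w hw).trans (le_add_of_nonneg_right (mul_nonneg hS h11))
  · have hwF : w ∈ F := by
      have h3 := le_abs_self N
      have h4 := abs_nonneg w.1
      have h5 := abs_nonneg w.2
      rw [hF, Finset.mem_product, Finset.mem_Icc, Finset.mem_Icc, ← abs_le, ← abs_le]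
      constructor <;> omega
    refine le_trans ?_ (le_add_of_nonneg_left (mul_nonneg (by positivity) h11))
    have h12 := Finset.single_le_sum (f := fun w => |a w| * (1 + rhoZ q₁ q₂ w) ^ q₁)
      (fun w _ => mul_nonneg (abs_nonneg _) (Real.rpow_nonneg (h10 w).le _)) hwF
    calc |a w| = |a w| * (1 + rhoZ q₁ q₂ w) ^ q₁ * (1 + rhoZ q₁ q₂ w) ^ (-q₁) := by
          rw [mul_assoc, ← Real.rpow_add (h10 w), add_neg_cancel, Real.rpow_zero, mul_one]
      _ ≤ _ := mul_le_mul_of_nonneg_right h12 h11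

/-- One of two coefficients whose positions differ by `z` is at most `O(ρ(z)^{-q₁})`. -/
theorem IsLRDCoefficient.exists_min_le {L₀ : ℝ → ℝ} {a : ℤ × ℤ → ℝ}
    (ha : IsLRDCoefficient q₁ q₂ L₀ a) :
    ∃ C : ℝ, 0 ≤ C ∧ ∀ z, 0 < rhoZ q₁ q₂ z → ∀ w,
      |a (-w)| ≤ C * rhoZ q₁ q₂ z ^ (-q₁) ∨ |a (z - w)| ≤ C * rhoZ q₁ q₂ z ^ (-q₁) := by
  obtain ⟨C, hC, haC⟩ := ha.exists_abs_le
  have h₁ := ha.q₁_pos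
  have h₂ := ha.q₂_pos
  have hK := gaugeConst_pos q₁ q₂
  refine ⟨C * (2 * gaugeConst q₁ q₂) ^ q₁, by positivity, fun z hz w => ?_⟩
  have key : ∀ v, rhoZ q₁ q₂ z / (2 * gaugeConst q₁ q₂) ≤ rhoZ q₁ q₂ v →
      |a v| ≤ C * (2 * gaugeConst q₁ q₂) ^ q₁ * rhoZ q₁ q₂ z ^ (-q₁) := by
    intro v hv
    have e : (2 * gaugeConst q₁ q₂) ^ q₁ * rhoZ q₁ q₂ z ^ (-q₁) =
        (rhoZ q₁ q₂ z / (2 * gaugeConst q₁ q₂)) ^ (-q₁) := by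
      rw [Real.div_rpow hz.le (by positivity), Real.rpow_neg (x := 2 * gaugeConst q₁ q₂)
        (by positivity), div_inv_eq_mul, mul_comm]
    refine (haC v).trans ?_
    rw [mul_assoc, e]
    refine mul_le_mul_of_nonneg_left ?_ hC
    exact Real.rpow_le_rpow_of_nonpos (by positivity) (by linarith) (by linarith)
  -- As `z = w + (z - w)`, one summand has gauge at least `ρ(z)/(2K)`; the gauge is even, so `w` may
  -- be replaced by `-w`.
  have h3 := gauge_div_le_or h₁ h₂ (toPlane w) (toPlane (z - w))
  rw [← toPlane_add, add_sub_cancel, ← rhoZ_eq] at h3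
  rcases h3 with h | h
  · refine Or.inl (key _ ?_)
    rwa [rhoZ_eq q₁ q₂ (-w), toPlane_neg, gauge_neg]
  · exact Or.inr (key _ h)

end Gauge

/-! ### An integrable majorant -/

/-- `min(|t|^{-p}, |t|^{-2p})`. -/
noncomputable def tail (p t : ℝ) : ℝ := min (|t| ^ (-p)) (|t| ^ (-(2 * p)))

theorem tail_nonneg (p t : ℝ) : 0 ≤ tail p t :=
  le_min (Real.rpow_nonneg (abs_nonneg _) _) (Real.rpow_nonneg (abs_nonneg _) _)

theorem measurable_tail (p : ℝ) : Measurable (tail p) := by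
  unfold tail; fun_prop

/-- The exponent `p < 1` governs the origin and `2p > 1` governs infinity. With `p = 1/Q` these two
conditions are `1 < Q < 2`. -/
theorem integrable_tail {p : ℝ} (h1 : p < 1) (h2 : 1 < 2 * p) : Integrable (tail p) := by
  have hle : ∀ (S : Set ℝ) (r : ℝ), MeasurableSet S → S ⊆ Set.Ioi 0 →
      IntegrableOn (fun t : ℝ => t ^ r) S → (∀ t, tail p t ≤ |t| ^ r) →
      IntegrableOn (tail p) S := by
    intro S r hS hS0 hint hb
    refine Integrable.mono' hint (measurable_tail p).aestronglyMeasurable ?_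
    filter_upwards [ae_restrict_mem hS] with t ht
    rw [Real.norm_eq_abs, abs_of_nonneg (tail_nonneg p t)]
    have := hb t
    rwa [abs_of_pos (hS0 ht)] at this
  have hA : IntegrableOn (tail p) (Set.Ioc 0 1) := by
    refine hle _ (-p) measurableSet_Ioc (fun t ht => ht.1) ?_ fun t => min_le_left _ _
    exact (intervalIntegrable_iff_integrableOn_Ioc_of_le zero_le_one).1
      (intervalIntegral.intervalIntegrable_rpow' (by linarith))
  have hB : IntegrableOn (tail p) (Set.Ioi 1) := by
    refine hle _ (-(2 * p)) measurableSet_Ioi (Set.Ioi_subset_Ioi zero_le_one) ?_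
      fun t => min_le_right _ _
    exact integrableOn_Ioi_rpow_of_lt (by linarith) zero_lt_one
  have hC : IntegrableOn (tail p) (Set.Ioi 0) := by
    rw [← Set.Ioc_union_Ioi_eq_Ioi zero_le_one]
    exact hA.union hB
  have hD : IntegrableOn (tail p) (Set.Iic 0) := by
    rw [← Measure.map_neg_eq_self (volume : Measure ℝ)]
    let m : MeasurableEmbedding fun x : ℝ => -x := (Homeomorph.neg ℝ).measurableEmbedding
    rw [m.integrableOn_map_iff]
    have e : tail p ∘ (fun x : ℝ => -x) = tail p := by funext t; simp [tail]
    rw [e, Set.neg_preimage, Set.neg_Iic, neg_zero]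
    exact Iff.mpr integrableOn_Ici_iff_integrableOn_Ioi hC
  rw [← integrableOn_univ, ← Set.Iic_union_Ioi (a := (0 : ℝ))]
  exact hD.union hC

section Convolution

variable {q₁ q₂ : ℝ}

theorem bigQ_mul (h₁ : 0 < q₁) (h₂ : 0 < q₂) : q₁ * bigQ q₁ q₂ = 1 + gamma0 q₁ q₂ := by
  rw [bigQ, gamma0]; field_simp

/-- An integrable majorant on the plane. -/
noncomputable def planeTail (q₁ q₂ : ℝ) (y : ℝ × ℝ) : ℝ :=
  tail (1 / bigQ q₁ q₂) y.1 * tail (1 / bigQ q₁ q₂) y.2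

theorem integrable_planeTail (hQ : 1 < bigQ q₁ q₂) (hQ' : bigQ q₁ q₂ < 2) :
    Integrable (planeTail q₁ q₂) := by
  have h : Integrable (tail (1 / bigQ q₁ q₂)) := by
    refine integrable_tail ?_ ?_
    · rwa [div_lt_one (by linarith)]
    · rw [mul_one_div, lt_div_iff₀ (by linarith)]; linarith
  exact h.mul_prod h

/-- Since `q₁ = p(1 + γ₀)` with `p = 1/Q`, the power `R^{-q₁}` splits as `R^{-p} (R^{γ₀})^{-p}`, and
`|y₁| ≤ R`, `|y₂| ≤ R^{γ₀}`. Integrability on the plane thereby reduces to one dimension, without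
anisotropic polar coordinates. -/
theorem min_rpow_gauge_le_planeTail (h₁ : 0 < q₁) (h₂ : 0 < q₂) (hQ : 1 < bigQ q₁ q₂)
    {y : ℝ × ℝ} (hy1 : y.1 ≠ 0) (hy2 : y.2 ≠ 0) :
    min (gauge q₁ q₂ y ^ (-q₁)) (gauge q₁ q₂ y ^ (-(2 * q₁))) ≤ planeTail q₁ q₂ y := by
  set p := 1 / bigQ q₁ q₂ with hp
  set R := gauge q₁ q₂ y with hR
  have hR0 : 0 < R := gauge_pos fun h => hy1 (by rw [h]; rfl)
  have hp0 : 0 < p := by rw [hp]; exact one_div_pos.2 (by linarith)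
  have hγ : 0 < gamma0 q₁ q₂ := div_pos h₁ h₂
  have hpq : p * (1 + gamma0 q₁ q₂) = q₁ := by
    rw [← bigQ_mul h₁ h₂, hp]; field_simp
  have ht : |y.1| ≤ R := abs_fst_le_gauge _ _ _
  have hs : |y.2| ≤ R ^ gamma0 q₁ q₂ := by
    have := Real.rpow_le_rpow (Real.rpow_nonneg (abs_nonneg _) _)
      (abs_snd_rpow_le_gauge q₁ q₂ y) hγ.le
    rwa [← Real.rpow_mul (abs_nonneg _), gamma0, div_mul_div_cancel₀ h₁.ne', div_self h₂.ne',
      Real.rpow_one] at this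
  have hv0 : 0 < R ^ gamma0 q₁ q₂ := Real.rpow_pos_of_pos hR0 _
  have key : ∀ {u t : ℝ}, t ≠ 0 → |t| ≤ u → min (u ^ (-p)) (u ^ (-(2 * p))) ≤ tail p t :=
    fun ht0 htu => min_le_min (Real.rpow_le_rpow_of_nonpos (abs_pos.2 ht0) htu (by linarith))
      (Real.rpow_le_rpow_of_nonpos (abs_pos.2 ht0) htu (by linarith))
  have hprod : ∀ i : ℝ, R ^ (-(i * q₁)) = R ^ (-(i * p)) * (R ^ gamma0 q₁ q₂) ^ (-(i * p)) := by
    intro i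
    rw [← Real.rpow_mul hR0.le, ← Real.rpow_add hR0]
    congr 1
    linear_combination (-i) * (-hpq)
  rw [planeTail]
  rcases le_total R 1 with h | h
  · have e := hprod 1
    simp only [one_mul] at e
    refine (min_le_left _ _).trans ?_
    rw [e]
    have hv1 : R ^ gamma0 q₁ q₂ ≤ 1 := Real.rpow_le_one hR0.le h hγ.le
    have hm : ∀ {u : ℝ}, 0 < u → u ≤ 1 → u ^ (-p) ≤ min (u ^ (-p)) (u ^ (-(2 * p))) :=
      fun hu hu1 => le_min le_rfl (Real.rpow_le_rpow_of_exponent_ge hu hu1 (by linarith))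
    exact mul_le_mul ((hm hR0 h).trans (key hy1 ht)) ((hm hv0 hv1).trans (key hy2 hs))
      (Real.rpow_nonneg hv0.le _) (tail_nonneg _ _)
  · refine (min_le_right _ _).trans ?_
    rw [hprod 2]
    have hv1 : 1 ≤ R ^ gamma0 q₁ q₂ := Real.one_le_rpow h hγ.le
    have hm : ∀ {u : ℝ}, 1 ≤ u → u ^ (-(2 * p)) ≤ min (u ^ (-p)) (u ^ (-(2 * p))) :=
      fun hu1 => le_min (Real.rpow_le_rpow_of_exponent_le hu1 (by linarith)) le_rfl
    exact mul_le_mul ((hm h).trans (key hy1 ht)) ((hm hv1).trans (key hy2 hs))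
      (Real.rpow_nonneg hv0.le _) (tail_nonneg _ _)

theorem ae_coord_ne_zero : ∀ᵐ y : ℝ × ℝ, y.1 ≠ 0 ∧ y.2 ≠ 0 := by
  have h : ∀ᵐ t : ℝ, t ≠ 0 := by simp [ae_iff]
  have h1 : ∀ᵐ y : ℝ × ℝ, y.1 ≠ 0 := Measure.quasiMeasurePreserving_fst.ae h
  have h2 : ∀ᵐ y : ℝ × ℝ, y.2 ≠ 0 := Measure.quasiMeasurePreserving_snd.ae h
  filter_upwards [h1, h2] with y h3 h4 using ⟨h3, h4⟩

/-! ### Convergence of convolutions of functions of gauge order `-q₁` -/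

/-- A weight with `weight x y + weight y x = 1`. -/
noncomputable def weight (q₁ q₂ : ℝ) (x y : ℝ × ℝ) : ℝ :=
  gauge q₁ q₂ y ^ q₁ / (gauge q₁ q₂ x ^ q₁ + gauge q₁ q₂ y ^ q₁)

theorem gauge_rpow_add_pos {x y : ℝ × ℝ} (h : x ≠ y) :
    0 < gauge q₁ q₂ x ^ q₁ + gauge q₁ q₂ y ^ q₁ := by
  have hx := Real.rpow_nonneg (gauge_nonneg q₁ q₂ x) q₁
  have hy := Real.rpow_nonneg (gauge_nonneg q₁ q₂ y) q₁
  by_cases h0 : x = 0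
  · have : 0 < gauge q₁ q₂ y ^ q₁ := Real.rpow_pos_of_pos (gauge_pos fun h' => h (h0.trans h'.symm)) _
    linarith
  · have : 0 < gauge q₁ q₂ x ^ q₁ := Real.rpow_pos_of_pos (gauge_pos h0) _
    linarith

theorem weight_add_weight {x y : ℝ × ℝ} (h : x ≠ y) :
    weight q₁ q₂ x y + weight q₁ q₂ y x = 1 := by
  have := gauge_rpow_add_pos (q₁ := q₁) (q₂ := q₂) h
  rw [weight, weight, add_comm (gauge q₁ q₂ y ^ q₁) (gauge q₁ q₂ x ^ q₁), ← add_div,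
    add_comm (gauge q₁ q₂ y ^ q₁), div_self this.ne']

/-- The numerator of the weight cancels the singularity of `v` at `y = -z`, leaving `|u|` over `S =
ρ(y)^{q₁} + ρ(z+y)^{q₁}`. Both `S ≥ ρ(y)^{q₁}` and a lower bound away from zero hold, so the
majorant depends on `z` only through the lower bound `c`. -/
theorem abs_mul_weight_le (h₁ : 0 < q₁) (h₂ : 0 < q₂) {u v C C' c : ℝ} {z y : ℝ × ℝ}
    (hu : |u| * gauge q₁ q₂ y ^ q₁ ≤ C) (hv : |v| * gauge q₁ q₂ (z + y) ^ q₁ ≤ C')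
    (hc : 0 < c) (hz : c ≤ gauge q₁ q₂ z) (hy : y ≠ 0) :
    |u * v * weight q₁ q₂ y (z + y)| ≤
      C * C' * max 1 ((c / (2 * gaugeConst q₁ q₂)) ^ (-q₁)) *
        min (gauge q₁ q₂ y ^ (-q₁)) (gauge q₁ q₂ y ^ (-(2 * q₁))) := by
  have hK := gaugeConst_pos q₁ q₂
  set A := gauge q₁ q₂ y with hA
  set B := gauge q₁ q₂ (z + y) with hB
  have hA0 : 0 < A := gauge_pos hy
  have hB0 : 0 ≤ B := gauge_nonneg _ _ _
  have hAq : 0 < A ^ q₁ := Real.rpow_pos_of_pos hA0 _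
  have hBq : 0 ≤ B ^ q₁ := Real.rpow_nonneg hB0 _
  set S := A ^ q₁ + B ^ q₁ with hS
  have hS0 : 0 < S := by linarith
  set d := c / (2 * gaugeConst q₁ q₂) with hd
  have hd0 : 0 < d := by positivity
  have hC0 : 0 ≤ C := le_trans (by positivity) hu
  have hC0' : 0 ≤ C' := le_trans (by positivity) hv
  -- From `z = (z + y) + (-y)`, the points `z + y` and `y` cannot both be close to the origin.
  have hSd : d ^ q₁ ≤ S := by
    have h3 := gauge_div_le_or h₁ h₂ (z + y) (-y)
    rw [add_neg_cancel_right, gauge_neg] at h3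
    have h4 : d ≤ gauge q₁ q₂ z / (2 * gaugeConst q₁ q₂) := by rw [hd]; gcongr
    rcases h3 with h | h
    · have := Real.rpow_le_rpow hd0.le (h4.trans h) h₁.le
      linarith
    · have := Real.rpow_le_rpow hd0.le (h4.trans h) h₁.le
      linarith
  set D := max 1 (d ^ (-q₁)) with hD
  have hD1 : 1 ≤ D := le_max_left _ _
  have hSinv : S⁻¹ ≤ D * min 1 (A ^ (-q₁)) := by
    have e1 : S⁻¹ ≤ A ^ (-q₁) := by
      rw [Real.rpow_neg hA0.le]
      exact inv_anti₀ hAq (by linarith)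
    have e2 : S⁻¹ ≤ D := by
      refine le_trans ?_ (le_max_right _ _)
      rw [Real.rpow_neg hd0.le]
      exact inv_anti₀ (Real.rpow_pos_of_pos hd0 _) hSd
    have hA' : 0 ≤ A ^ (-q₁) := Real.rpow_nonneg hA0.le _
    rcases min_choice 1 (A ^ (-q₁)) with h | h <;> rw [h]
    · linarith
    · nlinarith
  have hu' : |u| ≤ C * A ^ (-q₁) := by
    rw [Real.rpow_neg hA0.le, ← div_eq_mul_inv, le_div_iff₀ hAq]
    exact hu
  have hAn : 0 ≤ A ^ (-q₁) := Real.rpow_nonneg hA0.le _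
  have hmin : A ^ (-q₁) * min 1 (A ^ (-q₁)) = min (A ^ (-q₁)) (A ^ (-(2 * q₁))) := by
    rw [mul_min_of_nonneg _ _ hAn, mul_one, ← Real.rpow_add hA0]
    congr 2; ring
  calc |u * v * weight q₁ q₂ y (z + y)| = |u| * (|v| * B ^ q₁) * S⁻¹ := by
        rw [weight, abs_mul, abs_mul, abs_div, abs_of_nonneg hBq, abs_of_pos hS0, div_eq_mul_inv]
        ring
    _ ≤ (C * A ^ (-q₁)) * C' * (D * min 1 (A ^ (-q₁))) := by
        refine mul_le_mul (mul_le_mul hu' hv (by positivity) (by positivity)) hSinv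
          (by positivity) (by positivity)
    _ = C * C' * D * (A ^ (-q₁) * min 1 (A ^ (-q₁))) := by ring
    _ = _ := by rw [hmin]

theorem measurable_weight_translate (h₁ : 0 < q₁) (h₂ : 0 < q₂) (z : ℝ × ℝ) :
    Measurable fun y => weight q₁ q₂ y (z + y) := by
  have h := (continuous_gauge h₁ h₂).measurable
  unfold weight
  have h2 : Measurable fun y => gauge q₁ q₂ (z + y) := h.comp (measurable_const_add z)
  exact (h2.pow_const _).div ((h.pow_const _).add (h2.pow_const _))

theorem aestronglyMeasurable_translate {g : ℝ × ℝ → ℝ} (hg : AEStronglyMeasurable g)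
    (z : ℝ × ℝ) : AEStronglyMeasurable fun y => g (z + y) :=
  hg.comp_measurePreserving (measurePreserving_add_left volume z)

theorem norm_mul_weight_le_planeTail (h₁ : 0 < q₁) (h₂ : 0 < q₂) (hQ : 1 < bigQ q₁ q₂)
    {f g : ℝ × ℝ → ℝ} {C C' c : ℝ} {z : ℝ × ℝ}
    (hf : ∀ y, |f y| * gauge q₁ q₂ y ^ q₁ ≤ C) (hg : ∀ y, |g y| * gauge q₁ q₂ y ^ q₁ ≤ C')
    (hc : 0 < c) (hz : c ≤ gauge q₁ q₂ z) :
    ∀ᵐ y : ℝ × ℝ, ‖f y * g (z + y) * weight q₁ q₂ y (z + y)‖ ≤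
      C * C' * max 1 ((c / (2 * gaugeConst q₁ q₂)) ^ (-q₁)) * planeTail q₁ q₂ y := by
  have hC0 : 0 ≤ C := le_trans (mul_nonneg (abs_nonneg _)
    (Real.rpow_nonneg (gauge_nonneg _ _ _) _)) (hf 0)
  have hC0' : 0 ≤ C' := le_trans (mul_nonneg (abs_nonneg _)
    (Real.rpow_nonneg (gauge_nonneg _ _ _) _)) (hg 0)
  filter_upwards [ae_coord_ne_zero] with y hy
  refine (abs_mul_weight_le h₁ h₂ (hf y) (hg (z + y)) hc hz fun h => hy.1 (by rw [h]; rfl)).trans ?_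
  refine mul_le_mul_of_nonneg_left (min_rpow_gauge_le_planeTail h₁ h₂ hQ hy.1 hy.2) ?_
  exact mul_nonneg (mul_nonneg hC0 hC0') (le_max_of_le_left zero_le_one)

theorem integrable_mul_weight (h₁ : 0 < q₁) (h₂ : 0 < q₂) (hQ : 1 < bigQ q₁ q₂)
    (hQ' : bigQ q₁ q₂ < 2) {f g : ℝ × ℝ → ℝ} {C C' : ℝ} {z : ℝ × ℝ} (hz : z ≠ 0)
    (hfm : AEStronglyMeasurable f) (hgm : AEStronglyMeasurable g)
    (hf : ∀ y, |f y| * gauge q₁ q₂ y ^ q₁ ≤ C) (hg : ∀ y, |g y| * gauge q₁ q₂ y ^ q₁ ≤ C') :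
    Integrable fun y => f y * g (z + y) * weight q₁ q₂ y (z + y) :=
  Integrable.mono' ((integrable_planeTail hQ hQ').const_mul _)
    ((hfm.mul (aestronglyMeasurable_translate hgm z)).mul
      (measurable_weight_translate h₁ h₂ z).aestronglyMeasurable)
    (norm_mul_weight_le_planeTail h₁ h₂ hQ hf hg (gauge_pos hz) le_rfl)

/-- The two halves of a convolution. -/
theorem mul_eq_weight_add_weight {f g : ℝ × ℝ → ℝ} {z : ℝ × ℝ} (hz : z ≠ 0) (y : ℝ × ℝ) :
    f y * g (z + y) = f y * g (z + y) * weight q₁ q₂ y (z + y) +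
      (fun u => g u * f (-z + u) * weight q₁ q₂ u (-z + u)) (z + y) := by
  have h := weight_add_weight (q₁ := q₁) (q₂ := q₂) (x := y) (y := z + y) (by simpa using hz)
  simp only [neg_add_cancel_left]
  linear_combination -(f y * g (z + y)) * h

theorem integrable_mul_translate (h₁ : 0 < q₁) (h₂ : 0 < q₂) (hQ : 1 < bigQ q₁ q₂)
    (hQ' : bigQ q₁ q₂ < 2) {f g : ℝ × ℝ → ℝ} {C C' : ℝ} {z : ℝ × ℝ} (hz : z ≠ 0)
    (hfm : AEStronglyMeasurable f) (hgm : AEStronglyMeasurable g)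
    (hf : ∀ y, |f y| * gauge q₁ q₂ y ^ q₁ ≤ C) (hg : ∀ y, |g y| * gauge q₁ q₂ y ^ q₁ ≤ C') :
    Integrable fun y => f y * g (z + y) := by
  have h1 := integrable_mul_weight h₁ h₂ hQ hQ' hz hfm hgm hf hg
  have h2 := (integrable_mul_weight h₁ h₂ hQ hQ' (neg_ne_zero.2 hz) hgm hfm hg hf).comp_add_left z
  refine (h1.add h2).congr (Eventually.of_forall fun y => ?_)
  exact (mul_eq_weight_add_weight hz y).symm

/-- Translating the second half by `z` gives an integral of the first kind with `f`, `g` exchanged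
and `z` replaced by `-z`; both halves are then singular only at the origin. -/
theorem integral_mul_translate_eq (h₁ : 0 < q₁) (h₂ : 0 < q₂) (hQ : 1 < bigQ q₁ q₂)
    (hQ' : bigQ q₁ q₂ < 2) {f g : ℝ × ℝ → ℝ} {C C' : ℝ} {z : ℝ × ℝ} (hz : z ≠ 0)
    (hfm : AEStronglyMeasurable f) (hgm : AEStronglyMeasurable g)
    (hf : ∀ y, |f y| * gauge q₁ q₂ y ^ q₁ ≤ C) (hg : ∀ y, |g y| * gauge q₁ q₂ y ^ q₁ ≤ C') :
    ∫ y, f y * g (z + y) = (∫ y, f y * g (z + y) * weight q₁ q₂ y (z + y)) +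
      ∫ u, g u * f (-z + u) * weight q₁ q₂ u (-z + u) := by
  have h1 := integrable_mul_weight h₁ h₂ hQ hQ' hz hfm hgm hf hg
  have h2 := integrable_mul_weight h₁ h₂ hQ hQ' (neg_ne_zero.2 hz) hgm hfm hg hf
  rw [← integral_add_left_eq_self (fun u => g u * f (-z + u) * weight q₁ q₂ u (-z + u)) z,
    ← integral_add h1 (h2.comp_add_left z)]
  exact integral_congr_ae (Eventually.of_forall fun y => mul_eq_weight_add_weight hz y)

theorem tendsto_weight (h₁ : 0 < q₁) (h₂ : 0 < q₂) {ι : Type*} {l : Filter ι}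
    {z : ι → ℝ × ℝ} {z₀ : ℝ × ℝ} (hz₀ : z₀ ≠ 0) (hz : Tendsto z l (𝓝 z₀)) (y : ℝ × ℝ) :
    Tendsto (fun n => weight q₁ q₂ y (z n + y)) l (𝓝 (weight q₁ q₂ y (z₀ + y))) := by
  have h := gauge_rpow_add_pos (q₁ := q₁) (q₂ := q₂) (x := y) (y := z₀ + y) (by simpa using hz₀)
  have hg : Tendsto (fun n => gauge q₁ q₂ (z n + y) ^ q₁) l (𝓝 (gauge q₁ q₂ (z₀ + y) ^ q₁)) :=
    (((continuous_gauge h₁ h₂).tendsto _).comp (hz.add_const y)).rpow_const (Or.inr h₁.le)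
  exact hg.div (tendsto_const_nhds.add hg) h.ne'

/-- Dominated convergence. The convergence hypotheses are joint in the index and the point because
`g n` is evaluated at the moving point `z n + y`. -/
theorem tendsto_integral_mul_weight (h₁ : 0 < q₁) (h₂ : 0 < q₂) (hQ : 1 < bigQ q₁ q₂)
    (hQ' : bigQ q₁ q₂ < 2) {ι : Type*} {l : Filter ι} [l.IsCountablyGenerated]
    {f g : ι → ℝ × ℝ → ℝ} {f₀ g₀ : ℝ × ℝ → ℝ} {z : ι → ℝ × ℝ} {z₀ : ℝ × ℝ} {C C' : ℝ}
    (hz₀ : z₀ ≠ 0) (hz : Tendsto z l (𝓝 z₀))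
    (hfm : ∀ n, AEStronglyMeasurable (f n)) (hgm : ∀ n, AEStronglyMeasurable (g n))
    (hfC : ∀ᶠ n in l, ∀ y, |f n y| * gauge q₁ q₂ y ^ q₁ ≤ C)
    (hgC : ∀ᶠ n in l, ∀ y, |g n y| * gauge q₁ q₂ y ^ q₁ ≤ C')
    (hf : ∀ᵐ y : ℝ × ℝ, Tendsto (fun p : ι × (ℝ × ℝ) => f p.1 p.2) (l ×ˢ 𝓝 y) (𝓝 (f₀ y)))
    (hg : ∀ᵐ y : ℝ × ℝ, Tendsto (fun p : ι × (ℝ × ℝ) => g p.1 p.2) (l ×ˢ 𝓝 y) (𝓝 (g₀ y))) :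
    Tendsto (fun n => ∫ y, f n y * g n (z n + y) * weight q₁ q₂ y (z n + y)) l
      (𝓝 (∫ y, f₀ y * g₀ (z₀ + y) * weight q₁ q₂ y (z₀ + y))) := by
  have hc : 0 < gauge q₁ q₂ z₀ / 2 := half_pos (gauge_pos hz₀)
  have hzc : ∀ᶠ n in l, gauge q₁ q₂ z₀ / 2 ≤ gauge q₁ q₂ (z n) :=
    (((continuous_gauge h₁ h₂).tendsto z₀).comp hz).eventually_const_le
      (half_lt_self (gauge_pos hz₀))
  refine tendsto_integral_filter_of_dominated_convergence
    (fun y => C * C' * max 1 ((gauge q₁ q₂ z₀ / 2 / (2 * gaugeConst q₁ q₂)) ^ (-q₁)) *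
      planeTail q₁ q₂ y) (Eventually.of_forall fun n => ?_) ?_
    ((integrable_planeTail hQ hQ').const_mul _) ?_
  · exact ((hfm n).mul (aestronglyMeasurable_translate (hgm n) (z n))).mul
      (measurable_weight_translate h₁ h₂ (z n)).aestronglyMeasurable
  · filter_upwards [hzc, hfC, hgC] with n h3 h4 h5
    exact norm_mul_weight_le_planeTail h₁ h₂ hQ h4 h5 hc h3
  -- Translation by `z₀` preserves null sets, so the exceptional set for `g` may be pulled back.
  · have hg' : ∀ᵐ y : ℝ × ℝ, Tendsto (fun p : ι × (ℝ × ℝ) => g p.1 p.2) (l ×ˢ 𝓝 (z₀ + y))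
        (𝓝 (g₀ (z₀ + y))) :=
      (measurePreserving_add_left volume z₀).quasiMeasurePreserving.ae hg
    filter_upwards [hf, hg'] with y h3 h4
    refine Tendsto.mul (Tendsto.mul ?_ ?_) (tendsto_weight h₁ h₂ hz₀ hz y)
    · exact h3.comp (tendsto_id.prodMk tendsto_const_nhds)
    · exact h4.comp (tendsto_id.prodMk (hz.add_const y))

theorem tendsto_integral_mul_translate (h₁ : 0 < q₁) (h₂ : 0 < q₂) (hQ : 1 < bigQ q₁ q₂)
    (hQ' : bigQ q₁ q₂ < 2) {ι : Type*} {l : Filter ι} [l.IsCountablyGenerated]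
    {f : ι → ℝ × ℝ → ℝ} {f₀ : ℝ × ℝ → ℝ} {z : ι → ℝ × ℝ} {z₀ : ℝ × ℝ} {C : ℝ}
    (hz₀ : z₀ ≠ 0) (hz : Tendsto z l (𝓝 z₀))
    (hfm : ∀ n, AEStronglyMeasurable (f n)) (hfm₀ : AEStronglyMeasurable f₀)
    (hfC : ∀ᶠ n in l, ∀ y, |f n y| * gauge q₁ q₂ y ^ q₁ ≤ C)
    (hfC₀ : ∀ y, |f₀ y| * gauge q₁ q₂ y ^ q₁ ≤ C)
    (hf : ∀ᵐ y : ℝ × ℝ, Tendsto (fun p : ι × (ℝ × ℝ) => f p.1 p.2) (l ×ˢ 𝓝 y) (𝓝 (f₀ y))) :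
    Tendsto (fun n => ∫ y, f n y * f n (z n + y)) l (𝓝 (∫ y, f₀ y * f₀ (z₀ + y))) := by
  rw [integral_mul_translate_eq h₁ h₂ hQ hQ' hz₀ hfm₀ hfm₀ hfC₀ hfC₀]
  have h1 := tendsto_integral_mul_weight h₁ h₂ hQ hQ' hz₀ hz hfm hfm hfC hfC hf hf
  have h2 := tendsto_integral_mul_weight h₁ h₂ hQ hQ' (neg_ne_zero.2 hz₀) hz.neg hfm hfm hfC hfC
    hf hf
  refine (h1.add h2).congr' ?_
  filter_upwards [hz.eventually_ne hz₀, hfC] with n h3 h4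
  exact (integral_mul_translate_eq h₁ h₂ hQ hQ' h3 (hfm n) (hfm n) h4 h4).symm

end Convolution

/-! ### The limiting coefficient and its convolution square -/

section Limit

variable {q₁ q₂ : ℝ} {L₀ : ℝ → ℝ} {a : ℤ × ℤ → ℝ}

theorem aInf_eq (q₁ q₂ : ℝ) (L₀ : ℝ → ℝ) (x : ℝ × ℝ) :
    aInf q₁ q₂ L₀ x = gauge q₁ q₂ x ^ (-q₁) * L₀ (x.1 / gauge q₁ q₂ x) := rfl

theorem abs_aInf_mul_le (h₁ : 0 < q₁) {C : ℝ} (hC : 0 ≤ C)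
    (hL : ∀ u ∈ Set.Icc (-1 : ℝ) 1, |L₀ u| ≤ C) (y : ℝ × ℝ) :
    |aInf q₁ q₂ L₀ y| * gauge q₁ q₂ y ^ q₁ ≤ C := by
  rcases (gauge_nonneg q₁ q₂ y).eq_or_lt with h | h
  · rw [← h, Real.zero_rpow h₁.ne', mul_zero]; exact hC
  · rw [aInf_eq, abs_mul, abs_of_pos (Real.rpow_pos_of_pos h _), mul_comm, ← mul_assoc,
      ← Real.rpow_add h, add_neg_cancel, Real.rpow_zero, one_mul]
    exact hL _ (fst_div_gauge_mem_Icc q₁ q₂ y)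

theorem aInf_dil (h₁ : 0 < q₁) (h₂ : 0 < q₂) {r : ℝ} (hr : 0 < r) (x : ℝ × ℝ) :
    aInf q₁ q₂ L₀ (dil q₁ q₂ r x) = r ^ (-q₁) * aInf q₁ q₂ L₀ x := by
  rw [aInf_eq, aInf_eq, gauge_dil h₁ h₂ hr.le, Real.mul_rpow hr.le (gauge_nonneg _ _ _), dil]
  simp only
  rw [mul_div_mul_left _ _ hr.ne', mul_assoc]

theorem aInf_neg_snd (q₁ q₂ : ℝ) (L₀ : ℝ → ℝ) (t s : ℝ) :
    aInf q₁ q₂ L₀ (t, -s) = aInf q₁ q₂ L₀ (t, s) := by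
  rw [aInf_eq, aInf_eq, gauge_neg_snd]

/-- Points off the horizontal axis whose angle avoids `F`. -/
def regularCone (q₁ q₂ : ℝ) (F : Set ℝ) : Set (ℝ × ℝ) :=
  {y | y.2 ≠ 0} ∩ (fun y => y.1 / gauge q₁ q₂ y) ⁻¹' Fᶜ

theorem continuousAt_angle (h₁ : 0 < q₁) (h₂ : 0 < q₂) {y : ℝ × ℝ} (hy : y ≠ 0) :
    ContinuousAt (fun y : ℝ × ℝ => y.1 / gauge q₁ q₂ y) y :=
  continuousAt_fst.div (continuous_gauge h₁ h₂).continuousAt (gauge_pos hy).ne'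

theorem ne_zero_of_snd_ne_zero {y : ℝ × ℝ} (hy : y.2 ≠ 0) : y ≠ 0 := fun h => hy (by rw [h]; rfl)

theorem isOpen_regularCone (h₁ : 0 < q₁) (h₂ : 0 < q₂) {F : Set ℝ} (hF : F.Finite) :
    IsOpen (regularCone q₁ q₂ F) := by
  refine ContinuousOn.isOpen_inter_preimage (fun y hy => ?_)
    (isOpen_ne_fun continuous_snd continuous_const) hF.isClosed.isOpen_compl
  exact (continuousAt_angle h₁ h₂ (ne_zero_of_snd_ne_zero hy)).continuousWithinAt

/-- On a horizontal line off the axis the angle determines the point. Finitely many excluded angles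
therefore meet almost every horizontal line in a finite set. -/
theorem injective_angle {s : ℝ} (hs : s ≠ 0) :
    Function.Injective fun t : ℝ => t / gauge q₁ q₂ (t, s) := by
  have hpos : ∀ t : ℝ, 0 < gauge q₁ q₂ (t, s) := fun t =>
    gauge_pos (ne_zero_of_snd_ne_zero (y := (t, s)) hs)
  intro t t' h
  simp only at h
  have hS : 0 < |s| ^ (2 * q₂ / q₁) := Real.rpow_pos_of_pos (abs_pos.2 hs) _
  have h1 := gauge_sq q₁ q₂ (t, s)
  have h2 := gauge_sq q₁ q₂ (t', s)
  rw [div_eq_div_iff (hpos t).ne' (hpos t').ne'] at h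
  have h3 : t ^ 2 = t' ^ 2 := by
    have := congrArg (· ^ 2) h
    simp only [mul_pow, h1, h2] at this
    have h4 : (t ^ 2 - t' ^ 2) * |s| ^ (2 * q₂ / q₁) = 0 := by linarith
    rcases mul_eq_zero.1 h4 with h5 | h5
    · linarith
    · exact absurd h5 hS.ne'
  have h4 : gauge q₁ q₂ (t, s) = gauge q₁ q₂ (t', s) := by
    refine (sq_eq_sq₀ (hpos t).le (hpos t').le).1 ?_
    rw [h1, h2]; simp only [h3]
  rw [h4] at h
  exact mul_right_cancel₀ (hpos t').ne' h

theorem ae_mem_regularCone (h₁ : 0 < q₁) (h₂ : 0 < q₂) {F : Set ℝ} (hF : F.Finite) :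
    ∀ᵐ y : ℝ × ℝ, y ∈ regularCone q₁ q₂ F := by
  rw [ae_iff]
  change (volume : Measure (ℝ × ℝ)) (regularCone q₁ q₂ F)ᶜ = 0
  rw [Measure.volume_eq_prod,
    Measure.prod_apply_symm (isOpen_regularCone h₁ h₂ hF).measurableSet.compl,
    lintegral_eq_zero_iff'
      (measurable_measure_prodMk_right
        (isOpen_regularCone h₁ h₂ hF).measurableSet.compl).aemeasurable]
  have h : ∀ᵐ t : ℝ, t ≠ 0 := by simp [ae_iff]
  filter_upwards [h] with s hs
  refine Set.Finite.measure_zero ((hF.preimage ((injective_angle (q₁ := q₁) (q₂ := q₂)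
    hs).injOn)).subset fun t ht => ?_) _
  by_contra hF'
  exact ht ⟨hs, hF'⟩

/-- Off the horizontal axis the angle lies strictly inside `[-1, 1]`, so continuity of `L₀` relative
to `[-1, 1]` without `F` is continuity at the angle. -/
theorem continuousAt_aInf (h₁ : 0 < q₁) (h₂ : 0 < q₂) {F : Set ℝ} (hF : F.Finite)
    (hL : ContinuousOn L₀ (Set.Icc (-1 : ℝ) 1 \ F)) {y : ℝ × ℝ} (hy : y ∈ regularCone q₁ q₂ F) :
    ContinuousAt (aInf q₁ q₂ L₀) y := by
  have hy0 := ne_zero_of_snd_ne_zero hy.1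
  have hmem : Set.Icc (-1 : ℝ) 1 \ F ∈ 𝓝 (y.1 / gauge q₁ q₂ y) := by
    refine inter_mem (Icc_mem_nhds ?_ ?_) (hF.isClosed.isOpen_compl.mem_nhds hy.2)
    · have := (abs_lt.1 (abs_fst_lt_gauge (q₁ := q₁) (q₂ := q₂) hy.1)).1
      rw [lt_div_iff₀ (gauge_pos hy0)]; linarith
    · have := (abs_lt.1 (abs_fst_lt_gauge (q₁ := q₁) (q₂ := q₂) hy.1)).2
      rw [div_lt_iff₀ (gauge_pos hy0)]; linarith
  exact ((continuous_gauge h₁ h₂).continuousAt.rpow_const (Or.inl (gauge_pos hy0).ne')).mul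
    (ContinuousAt.comp (f := fun y : ℝ × ℝ => y.1 / gauge q₁ q₂ y) (hL.continuousAt hmem)
      (continuousAt_angle h₁ h₂ hy0))

theorem IsLRDCoefficient.ae_continuousAt_aInf (ha : IsLRDCoefficient q₁ q₂ L₀ a) :
    ∀ᵐ y : ℝ × ℝ, ContinuousAt (aInf q₁ q₂ L₀) y := by
  obtain ⟨F, hF, hL⟩ := ha.L₀_regular.2
  filter_upwards [ae_mem_regularCone ha.q₁_pos ha.q₂_pos hF] with y hy
  exact continuousAt_aInf ha.q₁_pos ha.q₂_pos hF hL hy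

theorem IsLRDCoefficient.aestronglyMeasurable_aInf (ha : IsLRDCoefficient q₁ q₂ L₀ a) :
    AEStronglyMeasurable (aInf q₁ q₂ L₀) := by
  obtain ⟨F, hF, hL⟩ := ha.L₀_regular.2
  have h1 : ContinuousOn (aInf q₁ q₂ L₀) (regularCone q₁ q₂ F) := fun y hy =>
    (continuousAt_aInf ha.q₁_pos ha.q₂_pos hF hL hy).continuousWithinAt
  have h2 := h1.aestronglyMeasurable (μ := volume)
    (isOpen_regularCone ha.q₁_pos ha.q₂_pos hF).measurableSet
  rwa [Measure.restrict_eq_self_of_ae_mem (ae_mem_regularCone ha.q₁_pos ha.q₂_pos hF)] at h2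

theorem IsLRDCoefficient.continuousAt_star (ha : IsLRDCoefficient q₁ q₂ L₀ a) {z₀ : ℝ × ℝ}
    (hz₀ : z₀ ≠ 0) : ContinuousAt (star (aInf q₁ q₂ L₀) (aInf q₁ q₂ L₀)) z₀ := by
  obtain ⟨C, hC, hL⟩ := ha.exists_abs_L₀_le
  have hb := abs_aInf_mul_le (q₂ := q₂) ha.q₁_pos hC hL
  refine tendsto_integral_mul_translate (f := fun _ => aInf q₁ q₂ L₀) ha.q₁_pos ha.q₂_pos
    ha.one_lt_Q ha.Q_lt_two hz₀ tendsto_id (fun _ => ha.aestronglyMeasurable_aInf)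
    ha.aestronglyMeasurable_aInf (Eventually.of_forall fun _ => hb) hb ?_
  filter_upwards [ha.ae_continuousAt_aInf] with y hy
  exact hy.tendsto.comp tendsto_snd

/-- `a_∞` is even in `s`. Hence the convolution square on the sphere depends only on the angle,
although `L_X` is defined through the upper half. -/
theorem star_neg_snd (q₁ q₂ : ℝ) (L₀ : ℝ → ℝ) (t s : ℝ) :
    star (aInf q₁ q₂ L₀) (aInf q₁ q₂ L₀) (t, -s) = star (aInf q₁ q₂ L₀) (aInf q₁ q₂ L₀) (t, s) := by
  let e : ℝ × ℝ ≃ᵐ ℝ × ℝ := (MeasurableEquiv.refl ℝ).prodCongr (MeasurableEquiv.neg ℝ)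
  have he : MeasurePreserving e :=
    (MeasurePreserving.id volume).prod (Measure.measurePreserving_neg volume)
  rw [star, ← he.integral_comp']
  refine integral_congr_ae (Eventually.of_forall fun y => ?_)
  change aInf q₁ q₂ L₀ (y.1, -y.2) * aInf q₁ q₂ L₀ (t + y.1, -s + -y.2) =
    aInf q₁ q₂ L₀ (y.1, y.2) * aInf q₁ q₂ L₀ (t + y.1, s + y.2)
  rw [← neg_add, aInf_neg_snd, aInf_neg_snd]

/-- The point of angle `x` on the upper half of the unit sphere of the gauge. -/
noncomputable def spherePoint (q₁ q₂ x : ℝ) : ℝ × ℝ := (x, (1 - x ^ 2) ^ (gamma0 q₁ q₂ / 2))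

theorem LX_eq (q₁ q₂ : ℝ) (L₀ : ℝ → ℝ) (k : ℕ) (x : ℝ) : LX q₁ q₂ L₀ k x =
    k.factorial * star (aInf q₁ q₂ L₀) (aInf q₁ q₂ L₀) (spherePoint q₁ q₂ x) ^ k := rfl

theorem gauge_spherePoint (h₁ : 0 < q₁) (h₂ : 0 < q₂) {x : ℝ} (hx : x ∈ Set.Icc (-1 : ℝ) 1) :
    gauge q₁ q₂ (spherePoint q₁ q₂ x) = 1 := by
  have h : 0 ≤ 1 - x ^ 2 := by nlinarith [hx.1, hx.2]
  refine (sq_eq_sq₀ (gauge_nonneg _ _ _) zero_le_one).1 ?_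
  rw [gauge_sq, spherePoint]
  simp only
  rw [abs_of_nonneg (Real.rpow_nonneg h _), ← Real.rpow_mul h, gamma0]
  have : q₁ / q₂ / 2 * (2 * q₂ / q₁) = 1 := by field_simp
  rw [this, Real.rpow_one]; ring

theorem spherePoint_ne_zero (h₁ : 0 < q₁) (h₂ : 0 < q₂) {x : ℝ} (hx : x ∈ Set.Icc (-1 : ℝ) 1) :
    spherePoint q₁ q₂ x ≠ 0 := by
  intro h
  have := gauge_spherePoint h₁ h₂ hx
  rw [h, gauge_zero h₁ h₂] at this
  exact zero_ne_one this

theorem continuous_spherePoint (h₁ : 0 < q₁) (h₂ : 0 < q₂) :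
    Continuous (spherePoint q₁ q₂) := by
  have : 0 ≤ gamma0 q₁ q₂ / 2 := by rw [gamma0]; positivity
  exact continuous_id.prodMk ((continuous_const.sub (continuous_pow 2)).rpow_const
    fun _ => Or.inr this)

theorem eq_spherePoint_or (h₁ : 0 < q₁) (h₂ : 0 < q₂) {y : ℝ × ℝ} (hy : gauge q₁ q₂ y = 1) :
    y = spherePoint q₁ q₂ y.1 ∨ y = ((spherePoint q₁ q₂ y.1).1, -(spherePoint q₁ q₂ y.1).2) := by
  have h := gauge_sq q₁ q₂ y
  rw [hy] at h
  have h3 : |y.2| = (1 - y.1 ^ 2) ^ (gamma0 q₁ q₂ / 2) := by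
    have e : 1 - y.1 ^ 2 = |y.2| ^ (2 * q₂ / q₁) := by linarith
    rw [e, ← Real.rpow_mul (abs_nonneg _), gamma0]
    have : 2 * q₂ / q₁ * (q₁ / q₂ / 2) = 1 := by field_simp
    rw [this, Real.rpow_one]
  rcases abs_choice y.2 with h4 | h4
  · exact Or.inl (Prod.ext rfl (by rw [spherePoint, ← h3, h4]))
  · exact Or.inr (Prod.ext rfl (by rw [spherePoint, ← h3, h4, neg_neg]))

theorem star_eq_star_spherePoint (h₁ : 0 < q₁) (h₂ : 0 < q₂) {y : ℝ × ℝ}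
    (hy : gauge q₁ q₂ y = 1) : star (aInf q₁ q₂ L₀) (aInf q₁ q₂ L₀) y =
      star (aInf q₁ q₂ L₀) (aInf q₁ q₂ L₀) (spherePoint q₁ q₂ y.1) := by
  rcases eq_spherePoint_or h₁ h₂ hy with h | h
  · exact congrArg _ h
  · exact (congrArg _ h).trans (star_neg_snd q₁ q₂ L₀ _ _)

theorem IsLRDCoefficient.continuousOn_LX (ha : IsLRDCoefficient q₁ q₂ L₀ a) (k : ℕ) :
    ContinuousOn (LX q₁ q₂ L₀ k) (Set.Icc (-1) 1) := by
  intro x hx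
  have h := ContinuousAt.comp (f := spherePoint q₁ q₂)
    (ha.continuousAt_star (spherePoint_ne_zero ha.q₁_pos ha.q₂_pos hx))
    (continuous_spherePoint ha.q₁_pos ha.q₂_pos).continuousAt
  exact (continuousAt_const.mul (h.pow k)).continuousWithinAt

theorem IsLRDCoefficient.aInf_nonneg (ha : IsLRDCoefficient q₁ q₂ L₀ a) (y : ℝ × ℝ) :
    0 ≤ aInf q₁ q₂ L₀ y :=
  mul_nonneg (Real.rpow_nonneg (gauge_nonneg q₁ q₂ y) _)
    (ha.L₀_nonneg _ (fst_div_gauge_mem_Icc q₁ q₂ y))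

/-- The discontinuities and the endpoints `±1` form a null set, so some angle with `L₀ ≠ 0` avoids
them; there `L₀ > 0` and `a_∞` is continuous. -/
theorem IsLRDCoefficient.exists_eventually_aInf_pos (ha : IsLRDCoefficient q₁ q₂ L₀ a)
    (hL : volume {u : ℝ | u ∈ Set.Icc (-1 : ℝ) 1 ∧ L₀ u ≠ 0} ≠ 0) :
    ∃ y₀, ∀ᶠ y in 𝓝 y₀, 0 < aInf q₁ q₂ L₀ y := by
  obtain ⟨F, hF, hLF⟩ := ha.L₀_regular.2
  have h₁ := ha.q₁_pos
  have h₂ := ha.q₂_pos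
  obtain ⟨u, hu, huF⟩ : ∃ u ∈ {u : ℝ | u ∈ Set.Icc (-1 : ℝ) 1 ∧ L₀ u ≠ 0}, u ∉ F ∪ {-1, 1} := by
    by_contra! h
    exact hL (measure_mono_null h ((hF.union (Set.toFinite _)).measure_zero _))
  simp only [Set.mem_union, Set.mem_insert_iff, Set.mem_singleton_iff, not_or] at huF
  have hu1 : 0 < 1 - u ^ 2 := by
    have h3 := lt_of_le_of_ne hu.1.1 (Ne.symm huF.2.1)
    have h4 := lt_of_le_of_ne hu.1.2 huF.2.2
    nlinarith
  have hg := gauge_spherePoint h₁ h₂ hu.1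
  have he : aInf q₁ q₂ L₀ (spherePoint q₁ q₂ u) = L₀ u := by
    rw [aInf_eq, hg, Real.one_rpow, one_mul, div_one]; rfl
  refine ⟨spherePoint q₁ q₂ u, Tendsto.eventually_const_lt
    (v := aInf q₁ q₂ L₀ (spherePoint q₁ q₂ u)) ?_
    (continuousAt_aInf h₁ h₂ hF hLF ⟨(Real.rpow_pos_of_pos hu1 _).ne', ?_⟩)⟩
  · rw [he]
    exact lt_of_le_of_ne (ha.L₀_nonneg u hu.1) (Ne.symm hu.2)
  · simp only [Set.mem_preimage, hg, div_one]
    exact huF.1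

/-! ### Dilations and positivity of the convolution square -/

theorem dil_dil_inv {r : ℝ} (hr : 0 < r) (x : ℝ × ℝ) :
    dil q₁ q₂ r (dil q₁ q₂ r⁻¹ x) = x := by
  have := (Real.rpow_pos_of_pos hr (gamma0 q₁ q₂)).ne'
  simp only [dil, Real.inv_rpow hr.le]
  exact Prod.ext (mul_inv_cancel_left₀ hr.ne' _) (mul_inv_cancel_left₀ this _)

theorem dil_inv_dil {r : ℝ} (hr : 0 < r) (x : ℝ × ℝ) :
    dil q₁ q₂ r⁻¹ (dil q₁ q₂ r x) = x := by
  have := dil_dil_inv (q₁ := q₁) (q₂ := q₂) (inv_pos.2 hr) x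
  rwa [inv_inv] at this

theorem continuous_dil (q₁ q₂ r : ℝ) : Continuous (dil q₁ q₂ r) := by
  unfold dil; fun_prop

theorem tendsto_dil_inv_atTop (h₁ : 0 < q₁) (h₂ : 0 < q₂) (z : ℝ × ℝ) :
    Tendsto (fun r : ℝ => dil q₁ q₂ r⁻¹ z) atTop (𝓝 0) := by
  have hγ : 0 < gamma0 q₁ q₂ := div_pos h₁ h₂
  have h1 := (tendsto_inv_atTop_zero (𝕜 := ℝ)).mul_const z.1
  have h2 := ((tendsto_inv_atTop_zero (𝕜 := ℝ)).rpow_const (p := gamma0 q₁ q₂)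
    (Or.inr hγ.le)).mul_const z.2
  rw [Real.zero_rpow hγ.ne', zero_mul] at h2
  rw [zero_mul] at h1
  exact h1.prodMk_nhds h2

/-- Positivity of `a_∞` is invariant under dilations. Seen at a large scale `r`, the translate by
`z` is small, so near the dilate of `y₀` by `r` both factors of the nonnegative integrand are
positive on an open set. -/
theorem IsLRDCoefficient.star_pos (ha : IsLRDCoefficient q₁ q₂ L₀ a)
    (hL : volume {u : ℝ | u ∈ Set.Icc (-1 : ℝ) 1 ∧ L₀ u ≠ 0} ≠ 0) {z : ℝ × ℝ} (hz : z ≠ 0) :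
    0 < star (aInf q₁ q₂ L₀) (aInf q₁ q₂ L₀) z := by
  obtain ⟨C, hC, hLC⟩ := ha.exists_abs_L₀_le
  have h₁ := ha.q₁_pos
  have h₂ := ha.q₂_pos
  have hb := abs_aInf_mul_le (q₂ := q₂) h₁ hC hLC
  obtain ⟨y₀, hy₀⟩ := ha.exists_eventually_aInf_pos hL
  obtain ⟨r, hr, hr0⟩ : ∃ r : ℝ, (∀ᶠ y in 𝓝 (dil q₁ q₂ r⁻¹ z + y₀), 0 < aInf q₁ q₂ L₀ y) ∧
      0 < r := by
    have h := (tendsto_dil_inv_atTop h₁ h₂ z).add_const y₀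
    rw [zero_add] at h
    exact ((h.eventually (eventually_eventually_nhds.2 hy₀)).and (eventually_gt_atTop 0)).exists
  have hpos : ∀ y, 0 < aInf q₁ q₂ L₀ (dil q₁ q₂ r⁻¹ y) → 0 < aInf q₁ q₂ L₀ y := by
    intro y hy
    rw [aInf_dil h₁ h₂ (inv_pos.2 hr0)] at hy
    exact (mul_pos_iff_of_pos_left (Real.rpow_pos_of_pos (inv_pos.2 hr0) _)).1 hy
  have hc := (continuous_dil q₁ q₂ r⁻¹).tendsto (dil q₁ q₂ r y₀)
  rw [dil_inv_dil hr0] at hc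
  have hev : ∀ᶠ y in 𝓝 (dil q₁ q₂ r y₀), 0 < aInf q₁ q₂ L₀ y * aInf q₁ q₂ L₀ (z + y) := by
    filter_upwards [hc.eventually hy₀, (hc.const_add (dil q₁ q₂ r⁻¹ z)).eventually hr]
      with y h3 h4
    rw [← dil_add] at h4
    exact mul_pos (hpos _ h3) (hpos _ h4)
  have hint := integrable_mul_translate h₁ h₂ ha.one_lt_Q ha.Q_lt_two hz
    ha.aestronglyMeasurable_aInf ha.aestronglyMeasurable_aInf hb hb
  rw [star, integral_pos_iff_support_of_nonneg
    (fun y => mul_nonneg (ha.aInf_nonneg y) (ha.aInf_nonneg (z + y))) hint]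
  refine Measure.measure_pos_of_mem_nhds volume (x := dil q₁ q₂ r y₀) ?_
  filter_upwards [hev] with y hy using hy.ne'

theorem IsLRDCoefficient.LX_pos (ha : IsLRDCoefficient q₁ q₂ L₀ a)
    (hL : volume {u : ℝ | u ∈ Set.Icc (-1 : ℝ) 1 ∧ L₀ u ≠ 0} ≠ 0) (k : ℕ) {x : ℝ}
    (hx : x ∈ Set.Icc (-1 : ℝ) 1) : 0 < LX q₁ q₂ L₀ k x := by
  rw [LX_eq]
  exact mul_pos (by exact_mod_cast k.factorial_pos)
    (pow_pos (ha.star_pos hL (spherePoint_ne_zero ha.q₁_pos ha.q₂_pos hx)) k)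

end Limit

/-! ### Lattice sums as integrals of rescaled step functions -/

section Rescaling

variable {q₁ q₂ : ℝ} {L₀ : ℝ → ℝ} {a : ℤ × ℤ → ℝ}

/-- The lattice point below the dilated point. -/
noncomputable def latticeFloor (q₁ q₂ r : ℝ) (y : ℝ × ℝ) : ℤ × ℤ :=
  (⌊r * y.1⌋, ⌊r ^ gamma0 q₁ q₂ * y.2⌋)

/-- The coefficients as a rescaled step function on the plane. -/
noncomputable def rescaled (q₁ q₂ : ℝ) (a : ℤ × ℤ → ℝ) (r : ℝ) (y : ℝ × ℝ) : ℝ :=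
  r ^ q₁ * a (latticeFloor q₁ q₂ r y)

theorem measurable_latticeFloor (q₁ q₂ r : ℝ) : Measurable (latticeFloor q₁ q₂ r) := by
  unfold latticeFloor
  exact (Int.measurable_floor.comp (measurable_fst.const_mul r)).prodMk
    (Int.measurable_floor.comp (measurable_snd.const_mul _))

theorem measurable_rescaled (q₁ q₂ : ℝ) (a : ℤ × ℤ → ℝ) (r : ℝ) :
    Measurable (rescaled q₁ q₂ a r) :=
  ((measurable_of_countable a).comp (measurable_latticeFloor q₁ q₂ r)).const_mul _

theorem latticeFloor_add {r : ℝ} (hr : 0 < r) (z : ℤ × ℤ) (y : ℝ × ℝ) :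
    latticeFloor q₁ q₂ r (dil q₁ q₂ r⁻¹ (toPlane z) + y) = z + latticeFloor q₁ q₂ r y := by
  have h := (Real.rpow_pos_of_pos hr (gamma0 q₁ q₂)).ne'
  refine Prod.ext ?_ ?_
  · simp only [latticeFloor, dil, toPlane, Prod.fst_add]
    rw [mul_add, mul_inv_cancel_left₀ hr.ne', Int.floor_intCast_add]
  · simp only [latticeFloor, dil, toPlane, Prod.snd_add]
    rw [mul_add, Real.inv_rpow hr.le, mul_inv_cancel_left₀ h, Int.floor_intCast_add]

/-- The fractional parts form a vector of gauge at most `2`, and the quasi-triangle inequality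
compares the dilated point with the corner of its cell. -/
theorem gauge_dil_le_latticeFloor (h₁ : 0 < q₁) (h₂ : 0 < q₂) (r : ℝ) (y : ℝ × ℝ) :
    gauge q₁ q₂ (dil q₁ q₂ r y) ≤
      2 * gaugeConst q₁ q₂ * (1 + rhoZ q₁ q₂ (latticeFloor q₁ q₂ r y)) := by
  set v : ℝ × ℝ := (Int.fract (r * y.1), Int.fract (r ^ gamma0 q₁ q₂ * y.2)) with hv
  have e : dil q₁ q₂ r y = toPlane (latticeFloor q₁ q₂ r y) + v :=
    Prod.ext (Int.floor_add_fract _).symm (Int.floor_add_fract _).symm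
  have hK := gaugeConst_pos q₁ q₂
  have h3 : gauge q₁ q₂ v ≤ 2 := by
    refine (gauge_le_add q₁ q₂ v).trans ?_
    rw [hv]
    simp only
    rw [abs_of_nonneg (Int.fract_nonneg _), abs_of_nonneg (Int.fract_nonneg _)]
    have h4 := (Int.fract_lt_one (r * y.1)).le
    have h5 := Real.rpow_le_one (Int.fract_nonneg (r ^ gamma0 q₁ q₂ * y.2))
      (Int.fract_lt_one _).le (show 0 ≤ q₂ / q₁ by positivity)
    linarith
  have h6 := gauge_add_le h₁ h₂ (toPlane (latticeFloor q₁ q₂ r y)) v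
  have h7 := gauge_nonneg q₁ q₂ (toPlane (latticeFloor q₁ q₂ r y))
  rw [e, rhoZ_eq]
  nlinarith

/-- Uniformity in `r` and `y`, including the cell at the origin, comes from the bound on `a` by `(1
+ ρ)^{-q₁}`; it feeds the dominated convergence. -/
theorem IsLRDCoefficient.exists_abs_rescaled_le (ha : IsLRDCoefficient q₁ q₂ L₀ a) :
    ∃ C : ℝ, 0 ≤ C ∧ ∀ r, 0 < r → ∀ y, |rescaled q₁ q₂ a r y| * gauge q₁ q₂ y ^ q₁ ≤ C := by
  obtain ⟨C, hC, haC⟩ := ha.exists_abs_le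
  have h₁ := ha.q₁_pos
  have hK := gaugeConst_pos q₁ q₂
  refine ⟨C * (2 * gaugeConst q₁ q₂) ^ q₁, by positivity, fun r hr y => ?_⟩
  have h3 := gauge_dil_le_latticeFloor h₁ ha.q₂_pos r y
  rw [gauge_dil h₁ ha.q₂_pos hr.le] at h3
  set w := latticeFloor q₁ q₂ r y with hw
  have h0 : 0 < 1 + rhoZ q₁ q₂ w := by
    have := gauge_nonneg q₁ q₂ (toPlane w)
    rw [rhoZ_eq]; linarith
  have hg := gauge_nonneg q₁ q₂ y
  have h4 := Real.rpow_le_rpow (mul_nonneg hr.le hg) h3 h₁.le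
  rw [Real.mul_rpow hr.le hg, Real.mul_rpow (by positivity) h0.le] at h4
  have hr' := Real.rpow_pos_of_pos hr q₁
  have hn : 0 ≤ C * (1 + rhoZ q₁ q₂ w) ^ (-q₁) := mul_nonneg hC (Real.rpow_nonneg h0.le _)
  rw [rescaled, ← hw, abs_mul, abs_of_pos hr']
  calc r ^ q₁ * |a w| * gauge q₁ q₂ y ^ q₁ = |a w| * (r ^ q₁ * gauge q₁ q₂ y ^ q₁) := by ring
    _ ≤ C * (1 + rhoZ q₁ q₂ w) ^ (-q₁) *
        ((2 * gaugeConst q₁ q₂) ^ q₁ * (1 + rhoZ q₁ q₂ w) ^ q₁) :=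
      mul_le_mul (haC w) h4 (mul_nonneg hr'.le (Real.rpow_nonneg hg _)) hn
    _ = C * (2 * gaugeConst q₁ q₂) ^ q₁ *
        ((1 + rhoZ q₁ q₂ w) ^ (-q₁) * (1 + rhoZ q₁ q₂ w) ^ q₁) := by ring
    _ = _ := by rw [← Real.rpow_add h0, neg_add_cancel, Real.rpow_zero, mul_one]

theorem tendsto_inv_mul_floor (t : ℝ) :
    Tendsto (fun p : ℝ × ℝ => p.1⁻¹ * (⌊p.1 * p.2⌋ : ℝ)) (atTop ×ˢ 𝓝 t) (𝓝 t) := by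
  have h1 : Tendsto (fun p : ℝ × ℝ => p.1⁻¹ * Int.fract (p.1 * p.2)) (atTop ×ˢ 𝓝 t) (𝓝 0) := by
    have hinv : Tendsto (fun p : ℝ × ℝ => p.1⁻¹) (atTop ×ˢ 𝓝 t) (𝓝 0) :=
      tendsto_inv_atTop_zero.comp tendsto_fst
    refine squeeze_zero' ?_ ?_ hinv
    · filter_upwards [tendsto_fst.eventually (eventually_gt_atTop (0 : ℝ))] with p hp
      exact mul_nonneg (inv_pos.2 hp).le (Int.fract_nonneg _)
    · filter_upwards [tendsto_fst.eventually (eventually_gt_atTop (0 : ℝ))] with p hp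
      exact mul_le_of_le_one_right (inv_pos.2 hp).le (Int.fract_lt_one _).le
  have h2 := (tendsto_snd (f := (atTop : Filter ℝ)) (g := 𝓝 t)).sub h1
  rw [sub_zero] at h2
  refine h2.congr' ?_
  filter_upwards [tendsto_fst.eventually (eventually_gt_atTop (0 : ℝ))] with p hp
  rw [Int.fract]
  field_simp
  ring

theorem tendsto_dil_inv_latticeFloor (h₁ : 0 < q₁) (h₂ : 0 < q₂) (y : ℝ × ℝ) :
    Tendsto (fun p : ℝ × (ℝ × ℝ) => dil q₁ q₂ p.1⁻¹ (toPlane (latticeFloor q₁ q₂ p.1 p.2)))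
      (atTop ×ˢ 𝓝 y) (𝓝 y) := by
  have hγ : 0 < gamma0 q₁ q₂ := div_pos h₁ h₂
  refine Tendsto.prodMk_nhds (f := atTop ×ˢ 𝓝 y) (x := y.1) (y := y.2) ?_ ?_
  · exact (tendsto_inv_mul_floor y.1).comp
      (tendsto_fst.prodMk ((continuous_fst.tendsto y).comp tendsto_snd))
  · have h := (tendsto_inv_mul_floor y.2).comp
      (((tendsto_rpow_atTop hγ).comp (tendsto_fst (f := (atTop : Filter ℝ)) (g := 𝓝 y))).prodMk
        ((continuous_snd.tendsto y).comp tendsto_snd))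
    refine h.congr' ?_
    filter_upwards [tendsto_fst.eventually (eventually_gt_atTop (0 : ℝ))] with p hp
    simp only [Function.comp, Real.inv_rpow hp.le, toPlane, latticeFloor]

/-- The lattice corner scaled back tends to `y`. By homogeneity the rescaled coefficient there
equals `a_∞` at that corner plus an error that vanishes because the corner itself goes to infinity.
-/
theorem IsLRDCoefficient.tendsto_rescaled (ha : IsLRDCoefficient q₁ q₂ L₀ a) {y : ℝ × ℝ}
    (hy : y ≠ 0) (hc : ContinuousAt (aInf q₁ q₂ L₀) y) :
    Tendsto (fun p : ℝ × (ℝ × ℝ) => rescaled q₁ q₂ a p.1 p.2) (atTop ×ˢ 𝓝 y)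
      (𝓝 (aInf q₁ q₂ L₀ y)) := by
  have h₁ := ha.q₁_pos
  have h₂ := ha.q₂_pos
  obtain ⟨o, ho, hao⟩ := ha.asymptotics
  set u := fun p : ℝ × (ℝ × ℝ) => dil q₁ q₂ p.1⁻¹ (toPlane (latticeFloor q₁ q₂ p.1 p.2)) with hu
  have hut : Tendsto u (atTop ×ˢ 𝓝 y) (𝓝 y) := tendsto_dil_inv_latticeFloor h₁ h₂ y
  have hgu : Tendsto (fun p => gauge q₁ q₂ (u p)) (atTop ×ˢ 𝓝 y) (𝓝 (gauge q₁ q₂ y)) :=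
    ((continuous_gauge h₁ h₂).tendsto y).comp hut
  have hpos : ∀ᶠ p in (atTop ×ˢ 𝓝 y : Filter (ℝ × (ℝ × ℝ))), 0 < p.1 :=
    tendsto_fst.eventually (eventually_gt_atTop (0 : ℝ))
  have hdu : ∀ p : ℝ × (ℝ × ℝ), 0 < p.1 →
      toPlane (latticeFloor q₁ q₂ p.1 p.2) = dil q₁ q₂ p.1 (u p) := fun p hp =>
    (dil_dil_inv hp _).symm
  have hinf : Tendsto (fun p : ℝ × (ℝ × ℝ) => latticeFloor q₁ q₂ p.1 p.2) (atTop ×ˢ 𝓝 y)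
      atInfinity := by
    rw [tendsto_atInfinity_iff_rhoZ h₁ h₂]
    refine (tendsto_fst.atTop_mul_pos (gauge_pos hy) hgu).congr' ?_
    filter_upwards [hpos] with p hp
    rw [rhoZ_eq, hdu p hp, gauge_dil h₁ h₂ hp.le]
  have h3 : Tendsto (fun p => aInf q₁ q₂ L₀ (u p) +
      gauge q₁ q₂ (u p) ^ (-q₁) * o (latticeFloor q₁ q₂ p.1 p.2)) (atTop ×ˢ 𝓝 y)
      (𝓝 (aInf q₁ q₂ L₀ y)) := by
    have h4 := (hc.tendsto.comp hut).add
      ((hgu.rpow_const (p := -q₁) (Or.inl (gauge_pos hy).ne')).mul (ho.comp hinf))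
    rwa [mul_zero, add_zero] at h4
  refine h3.congr' ?_
  filter_upwards [hpos, hinf.eventually hao] with p hp h5
  have hr : p.1 ^ q₁ * p.1 ^ (-q₁) = 1 := by
    rw [← Real.rpow_add hp, add_neg_cancel, Real.rpow_zero]
  have h6 := aInf_dil (L₀ := L₀) h₁ h₂ hp (u p)
  rw [← hdu p hp, aInf_eq, ← rhoZ_eq] at h6
  simp only [toPlane] at h6
  have h7 : rhoZ q₁ q₂ (latticeFloor q₁ q₂ p.1 p.2) ^ (-q₁) =
      p.1 ^ (-q₁) * gauge q₁ q₂ (u p) ^ (-q₁) := by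
    rw [rhoZ_eq, hdu p hp, gauge_dil h₁ h₂ hp.le, Real.mul_rpow hp.le (gauge_nonneg _ _ _)]
  rw [rescaled, h5, mul_add, h6, h7]
  linear_combination (-(aInf q₁ q₂ L₀ (u p)) -
    gauge q₁ q₂ (u p) ^ (-q₁) * o (latticeFloor q₁ q₂ p.1 p.2)) * hr

theorem preimage_floor_mul {r : ℝ} (hr : 0 < r) (n : ℤ) :
    {t : ℝ | ⌊r * t⌋ = n} = Set.Ico (n / r) ((n + 1) / r) := by
  ext t
  rw [Set.mem_ofPred_eq, Int.floor_eq_iff, Set.mem_Ico, div_le_iff₀ hr, lt_div_iff₀ hr, mul_comm]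

theorem measureReal_latticeFloor_preimage {r : ℝ} (hr : 0 < r) (w : ℤ × ℤ) :
    ((volume : Measure (ℝ × ℝ)).map (latticeFloor q₁ q₂ r)).real {w} =
      (r ^ (1 + gamma0 q₁ q₂))⁻¹ := by
  have hγ := Real.rpow_pos_of_pos hr (gamma0 q₁ q₂)
  have e : latticeFloor q₁ q₂ r ⁻¹' {w} = Set.Ico ((w.1 : ℝ) / r) ((w.1 + 1) / r) ×ˢ
      Set.Ico ((w.2 : ℝ) / r ^ gamma0 q₁ q₂) ((w.2 + 1) / r ^ gamma0 q₁ q₂) := by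
    rw [← preimage_floor_mul hr, ← preimage_floor_mul hγ]
    ext y
    simp [latticeFloor, Prod.ext_iff]
  have h : ∀ (n : ℤ) {c : ℝ}, 0 < c →
      (volume : Measure ℝ).real (Set.Ico ((n : ℝ) / c) ((n + 1) / c)) = c⁻¹ := by
    intro n c hc
    rw [Real.volume_real_Ico_of_le (by gcongr; linarith)]
    field_simp
    ring
  rw [map_measureReal_apply (measurable_latticeFloor q₁ q₂ r) (measurableSet_singleton w), e,
    Measure.volume_eq_prod, measureReal_prod_prod, h _ hr, h _ hγ, Real.rpow_add hr, Real.rpow_one,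
    mul_inv]

theorem integral_comp_latticeFloor {r : ℝ} (hr : 0 < r) {G : ℤ × ℤ → ℝ}
    (hG : Integrable fun y => G (latticeFloor q₁ q₂ r y)) :
    ∫ y, G (latticeFloor q₁ q₂ r y) = (r ^ (1 + gamma0 q₁ q₂))⁻¹ * ∑' w, G w := by
  have hm := measurable_latticeFloor q₁ q₂ r
  have hGm : AEStronglyMeasurable G ((volume : Measure (ℝ × ℝ)).map (latticeFloor q₁ q₂ r)) :=
    (measurable_of_countable G).aestronglyMeasurable
  rw [← integral_map hm.aemeasurable hGm, integral_countable
    ((integrable_map_measure hGm hm.aemeasurable).2 hG), ← tsum_mul_left]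
  exact tsum_congr fun w => by rw [measureReal_latticeFloor_preimage hr, smul_eq_mul]

theorem IsLRDCoefficient.rpow_mul_tsum_eq (ha : IsLRDCoefficient q₁ q₂ L₀ a) {r : ℝ}
    (hr : 0 < r) {z : ℤ × ℤ} (hz : z ≠ 0) :
    r ^ p1 q₁ q₂ * ∑' w, a w * a (z + w) =
      ∫ y, rescaled q₁ q₂ a r y * rescaled q₁ q₂ a r (dil q₁ q₂ r⁻¹ (toPlane z) + y) := by
  obtain ⟨C, -, hC⟩ := ha.exists_abs_rescaled_le
  have h₁ := ha.q₁_pos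
  have h₂ := ha.q₂_pos
  have hz' : dil q₁ q₂ r⁻¹ (toPlane z) ≠ 0 := by
    intro h
    have h3 := dil_dil_inv (q₁ := q₁) (q₂ := q₂) hr (toPlane z)
    rw [h] at h3
    refine hz (Prod.ext ?_ ?_)
    · have := congrArg Prod.fst h3
      simpa [dil, toPlane] using this.symm
    · have := congrArg Prod.snd h3
      simpa [dil, toPlane] using this.symm
  have hint := integrable_mul_translate h₁ h₂ ha.one_lt_Q ha.Q_lt_two hz'
    (measurable_rescaled q₁ q₂ a r).aestronglyMeasurable
    (measurable_rescaled q₁ q₂ a r).aestronglyMeasurable (hC r hr) (hC r hr)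
  have e : (fun y => rescaled q₁ q₂ a r y * rescaled q₁ q₂ a r (dil q₁ q₂ r⁻¹ (toPlane z) + y)) =
      fun y => (fun w => r ^ (2 * q₁) * (a w * a (z + w))) (latticeFloor q₁ q₂ r y) := by
    funext y
    simp only [rescaled, latticeFloor_add hr]
    rw [two_mul, Real.rpow_add hr]
    ring
  rw [e] at hint ⊢
  refine Eq.trans ?_ (integral_comp_latticeFloor (G := fun w => r ^ (2 * q₁) * (a w * a (z + w)))
    hr hint).symm
  rw [tsum_mul_left, ← mul_assoc, ← Real.rpow_neg hr.le,
    ← Real.rpow_add hr]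
  congr 2
  -- The two coefficients give `r^{2q₁}` and a cell has area `r^{-(1+γ₀)} = r^{-q₁Q}`; the product
  -- is `r^{p₁}`.
  rw [p1, ← bigQ_mul h₁ h₂]
  ring

theorem isCompact_gauge_sphere (h₁ : 0 < q₁) (h₂ : 0 < q₂) :
    IsCompact {y : ℝ × ℝ | gauge q₁ q₂ y = 1} := by
  refine (isCompact_Icc (a := ((-1 : ℝ), (-1 : ℝ))) (b := (1, 1))).of_isClosed_subset
    (isClosed_eq (continuous_gauge h₁ h₂) continuous_const) fun y hy => ?_
  rw [Set.mem_ofPred_eq] at hy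
  have h3 := abs_fst_le_gauge q₁ q₂ y
  have h4 := abs_snd_rpow_le_gauge q₁ q₂ y
  rw [hy] at h3 h4
  have h5 : |y.2| ≤ 1 := by
    by_contra! h
    exact absurd h4 (not_le.2 (Real.one_lt_rpow h (div_pos h₂ h₁)))
  exact ⟨⟨(abs_le.1 h3).1, (abs_le.1 h5).1⟩, ⟨(abs_le.1 h3).2, (abs_le.1 h5).2⟩⟩

instance : (atInfinity).IsCountablyGenerated := by
  unfold atInfinity; infer_instance

/-- The lattice convolution square is asymptotic to the continuous one. -/
theorem IsLRDCoefficient.tendsto_rpow_mul_tsum (ha : IsLRDCoefficient q₁ q₂ L₀ a) :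
    Tendsto (fun z => rhoZ q₁ q₂ z ^ p1 q₁ q₂ * ∑' w, a w * a (z + w) -
      star (aInf q₁ q₂ L₀) (aInf q₁ q₂ L₀) (spherePoint q₁ q₂ (z.1 / rhoZ q₁ q₂ z)))
      atInfinity (𝓝 0) := by
  have h₁ := ha.q₁_pos
  have h₂ := ha.q₂_pos
  obtain ⟨C₀, hC₀, hL⟩ := ha.exists_abs_L₀_le
  obtain ⟨C, hC, hCr⟩ := ha.exists_abs_rescaled_le
  -- The angles need not converge. Dilating `z` by `1/ρ(z)` puts it on the compact unit sphere, and
  -- along a convergent subsequence the integral and the continuous `a_∞ ⋆ a_∞` have the same limit.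
  refine tendsto_of_subseq_tendsto fun z hz => ?_
  have hρ := (tendsto_atInfinity_iff_rhoZ h₁ h₂).1 hz
  set x := fun n => dil q₁ q₂ (rhoZ q₁ q₂ (z n))⁻¹ (toPlane (z n)) with hx
  have hx1 : ∀ᶠ n in atTop, gauge q₁ q₂ (x n) = 1 := by
    filter_upwards [hρ.eventually_gt_atTop 0] with n hn
    rw [hx, gauge_dil h₁ h₂ (inv_pos.2 hn).le, ← rhoZ_eq, inv_mul_cancel₀ hn.ne']
  obtain ⟨x₀, hx₀, φ, hφ, hxφ⟩ := (isCompact_gauge_sphere h₁ h₂).tendsto_subseq' hx1.frequently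
  refine ⟨φ, ?_⟩
  have hx₀0 : x₀ ≠ 0 := by
    rintro rfl
    exact zero_ne_one ((gauge_zero h₁ h₂).symm.trans hx₀)
  have hρφ := hρ.comp hφ.tendsto_atTop
  have hlim : Tendsto (fun n => ∫ y, rescaled q₁ q₂ a (rhoZ q₁ q₂ (z (φ n))) y *
      rescaled q₁ q₂ a (rhoZ q₁ q₂ (z (φ n))) (x (φ n) + y)) atTop
      (𝓝 (star (aInf q₁ q₂ L₀) (aInf q₁ q₂ L₀) x₀)) := by
    refine tendsto_integral_mul_translate (C := max C C₀) h₁ h₂ ha.one_lt_Q ha.Q_lt_two hx₀0 hxφ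
      (fun n => (measurable_rescaled q₁ q₂ a _).aestronglyMeasurable)
      ha.aestronglyMeasurable_aInf ?_
      (fun y => (abs_aInf_mul_le h₁ hC₀ hL y).trans (le_max_right _ _)) ?_
    · filter_upwards [hρφ.eventually_gt_atTop 0] with n hn y
      exact (hCr _ hn y).trans (le_max_left _ _)
    · filter_upwards [ha.ae_continuousAt_aInf, ae_coord_ne_zero] with y hy hy0
      exact (ha.tendsto_rescaled (ne_zero_of_snd_ne_zero hy0.2) hy).comp
        (hρφ.prodMap tendsto_id)
  have hstar := (ha.continuousAt_star hx₀0).tendsto.comp hxφ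
  have h3 := hlim.sub hstar
  rw [sub_self] at h3
  refine h3.congr' ?_
  filter_upwards [hρφ.eventually_gt_atTop 0, hφ.tendsto_atTop.eventually hx1] with n hn h4
  have hz0 : z (φ n) ≠ 0 := by
    intro h
    have : rhoZ q₁ q₂ (z (φ n)) = 0 := by
      rw [h, rhoZ_eq]
      exact (congrArg _ (by simp [toPlane])).trans (gauge_zero h₁ h₂)
    exact hn.ne' this
  simp only [Function.comp] at hn h4 ⊢
  rw [ha.rpow_mul_tsum_eq hn hz0, star_eq_star_spherePoint h₁ h₂ h4]
  congr 4
  rw [hx]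
  simp only [dil, toPlane]
  rw [div_eq_inv_mul]

end Rescaling

/-! ### Covariances of the off-diagonal and diagonal parts -/

section Covariance

variable {Ω : Type*} [MeasurableSpace Ω] {μ : Measure Ω} [IsProbabilityMeasure μ]
  {ε Y : ℤ × ℤ → Ω → ℝ} {k : ℕ} {a : ℤ × ℤ → ℝ} {q₁ q₂ : ℝ} {L₀ : ℝ → ℝ}

/-- The off-diagonal part at `z` as an element of `L²`. -/
noncomputable def offDiagLp (h : ∀ w : Fin k → ℤ × ℤ, MemLp (wick μ ε w) 2 μ)
    (a : ℤ × ℤ → ℝ) (z : ℤ × ℤ) : Lp ℝ 2 μ :=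
  partLp h {w | Function.Injective w} fun w => a (z - w)

/-- The diagonal part at `z` as an element of `L²`. -/
noncomputable def diagLp (h : ∀ w : Fin k → ℤ × ℤ, MemLp (wick μ ε w) 2 μ)
    (a : ℤ × ℤ → ℝ) (z : ℤ × ℤ) : Lp ℝ 2 μ :=
  partLp h {w | Function.Injective w}ᶜ fun w => a (z - w)

theorem IsMovingAverage.summable_sq (hY : IsMovingAverage μ a ε Y) (hε : IsStandardNoise μ ε)
    (z : ℤ × ℤ) : Summable fun w => a (z - w) ^ 2 :=
  hε.summable_sq (hY z)

theorem tsum_sq_sub_eq (a : ℤ × ℤ → ℝ) (z : ℤ × ℤ) :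
    ∑' w, a (z - w) ^ 2 = ∑' w, a w ^ 2 :=
  (Equiv.subLeft z).tsum_eq fun w => a w ^ 2

theorem tsum_mul_sub_eq (a : ℤ × ℤ → ℝ) (z : ℤ × ℤ) :
    ∑' w, a (0 - w) * a (z - w) = ∑' w, a w * a (z + w) := by
  rw [← (Equiv.neg (ℤ × ℤ)).tsum_eq]
  exact tsum_congr fun w => by simp

theorem isOffDiagonalPart_offDiagLp (hε : IsStandardNoise μ ε) (hk : k ≠ 0)
    (hmom : Integrable (fun ω => |ε 0 ω| ^ (2 * k)) μ) (hY : IsMovingAverage μ a ε Y) :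
    IsOffDiagonalPart μ a ε k fun z => offDiagLp (hε.memLp_wick hk hmom) a z := by
  intro z
  have h := hε.hasL2Sum_partLp hk hmom (hY.summable_sq hε z) {w | Function.Injective w}
  have e : (fun (w : {w : Fin k → ℤ × ℤ // Function.Injective w}) ω =>
      (∏ j, a (z - w.1 j)) * ∏ j, ε (w.1 j) ω) =
      fun (w : {w : Fin k → ℤ × ℤ // Function.Injective w}) ω =>
        (∏ j, a (z - w.1 j)) * wick μ ε w.1 ω := by
    funext w ω
    rw [hε.wick_of_injective hk hmom w.2 ω]
  rw [e]
  exact h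

theorem isDiagonalPart_diagLp (hε : IsStandardNoise μ ε) (hk : k ≠ 0)
    (hmom : Integrable (fun ω => |ε 0 ω| ^ (2 * k)) μ) (hY : IsMovingAverage μ a ε Y) :
    IsDiagonalPart μ a ε k fun z => diagLp (hε.memLp_wick hk hmom) a z :=
  fun z => hε.hasL2Sum_partLp hk hmom (hY.summable_sq hε z) {w | Function.Injective w}ᶜ

theorem appellOf_ae_eq_offDiagLp_add_diagLp (hε : IsStandardNoise μ ε) (hk : k ≠ 0)
    (hmom : Integrable (fun ω => |ε 0 ω| ^ (2 * k)) μ) (hY : IsMovingAverage μ a ε Y)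
    (z : ℤ × ℤ) : appellOf μ k (Y z) =ᵐ[μ]
      (offDiagLp (hε.memLp_wick hk hmom) a z + diagLp (hε.memLp_wick hk hmom) a z : Lp ℝ 2 μ) := by
  have h := hε.appellOf_ae_eq hk hmom (c := fun w => a (z - w)) (hY z)
  rw [← hε.partLp_add_compl hk hmom (hY.summable_sq hε z) {w | Function.Injective w}] at h
  exact h

theorem integral_appellOf_movingAverage (hε : IsStandardNoise μ ε) (hk : k ≠ 0)
    (hmom : Integrable (fun ω => |ε 0 ω| ^ (2 * k)) μ) (hY : IsMovingAverage μ a ε Y)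
    (z : ℤ × ℤ) : ∫ ω, appellOf μ k (Y z) ω ∂μ = 0 := by
  have hint : ∀ G : Lp ℝ 2 μ, Integrable G μ := fun G =>
    (Lp.memLp G).integrable one_le_two
  rw [integral_congr_ae ((appellOf_ae_eq_offDiagLp_add_diagLp hε hk hmom hY z).trans
    (Lp.coeFn_add _ _)), integral_add' (hint _) (hint _), offDiagLp, diagLp,
    hε.integral_partLp hk hmom (hY.summable_sq hε z),
    hε.integral_partLp hk hmom (hY.summable_sq hε z), add_zero]

theorem covFun_appellOf_eq (hε : IsStandardNoise μ ε) (hk : k ≠ 0)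
    (hmom : Integrable (fun ω => |ε 0 ω| ^ (2 * k)) μ) (hY : IsMovingAverage μ a ε Y)
    (z : ℤ × ℤ) : covFun μ (fun z => appellOf μ k (Y z)) z =
      inner ℝ (offDiagLp (hε.memLp_wick hk hmom) a 0) (offDiagLp (hε.memLp_wick hk hmom) a z) +
      inner ℝ (diagLp (hε.memLp_wick hk hmom) a 0) (diagLp (hε.memLp_wick hk hmom) a z) := by
  have h0 := hY.summable_sq hε 0
  have hz := hY.summable_sq hε z
  have e : covFun μ (fun z => appellOf μ k (Y z)) z =
      inner ℝ (offDiagLp (hε.memLp_wick hk hmom) a 0 + diagLp (hε.memLp_wick hk hmom) a 0)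
        (offDiagLp (hε.memLp_wick hk hmom) a z + diagLp (hε.memLp_wick hk hmom) a z) := by
    rw [covFun, inner_coe_Lp]
    refine integral_congr_ae ?_
    filter_upwards [appellOf_ae_eq_offDiagLp_add_diagLp hε hk hmom hY 0,
      appellOf_ae_eq_offDiagLp_add_diagLp hε hk hmom hY z] with ω h1 h2
    rw [h1, h2]
  have h1 : inner ℝ (offDiagLp (hε.memLp_wick hk hmom) a 0)
      (diagLp (hε.memLp_wick hk hmom) a z) = 0 :=
    hε.inner_partLp_injective_not_injective hk hmom h0 hz
  have h2 : inner ℝ (diagLp (hε.memLp_wick hk hmom) a 0)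
      (offDiagLp (hε.memLp_wick hk hmom) a z) = 0 := by
    rw [real_inner_comm]
    exact hε.inner_partLp_injective_not_injective hk hmom hz h0
  rw [e, inner_add_left, inner_add_right, inner_add_right, h1, h2, add_zero, zero_add]

/-- The abstract covariance bound with `δ = D ρ(z)^{-q₁}`. The two coefficient families are
translates of one sequence, so the bound on their sums of squares does not depend on `z`. -/
theorem exists_abs_covFun_le (hε : IsStandardNoise μ ε) (hk : k ≠ 0)
    (hmom : Integrable (fun ω => |ε 0 ω| ^ (2 * k)) μ) (hY : IsMovingAverage μ a ε Y)
    (ha : IsLRDCoefficient q₁ q₂ L₀ a) :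
    ∃ C : ℝ, ∀ᶠ z in atInfinity,
      |covFun μ (fun z => diagLp (hε.memLp_wick hk hmom) a z) z| ≤
        C * rhoZ q₁ q₂ z ^ (-(2 * q₁)) ∧
      |covFun μ (fun z => appellOf μ k (Y z)) z - k.factorial * (∑' w, a w * a (z + w)) ^ k| ≤
        C * rhoZ q₁ q₂ z ^ (-(2 * q₁)) := by
  obtain ⟨C, hC, hCb⟩ := hε.exists_covariance_bounds hk hmom
    (le_max_left 1 (∑' w, a w ^ 2))
  obtain ⟨D, hD, hDb⟩ := ha.exists_min_le
  have h₁ := ha.q₁_pos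
  have hρ := tendsto_rhoZ_atInfinity h₁ ha.q₂_pos
  have hδ : Tendsto (fun z => D * rhoZ q₁ q₂ z ^ (-q₁)) atInfinity (𝓝 0) := by
    have := ((tendsto_rpow_neg_atTop h₁).comp hρ).const_mul D
    rwa [mul_zero] at this
  -- The factor `2` adds the off-diagonal error and the covariance of the diagonal part.
  refine ⟨2 * (C * D ^ 2), ?_⟩
  filter_upwards [hρ.eventually_gt_atTop 0, hδ.eventually_le_const one_pos] with z hz hδ1
  have hpos := Real.rpow_nonneg hz.le (-q₁)
  have h0 := hY.summable_sq hε 0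
  have hzs := hY.summable_sq hε z
  obtain ⟨h3, h4⟩ := hCb (fun w => a (0 - w)) (fun w => a (z - w)) (D * rhoZ q₁ q₂ z ^ (-q₁)) h0 hzs
    ((tsum_sq_sub_eq a 0).le.trans (le_max_right _ _))
    ((tsum_sq_sub_eq a z).le.trans (le_max_right _ _)) (mul_nonneg hD hpos) hδ1
    (fun w => by simpa using hDb z hz w)
  have e : C * (D * rhoZ q₁ q₂ z ^ (-q₁)) ^ 2 = C * D ^ 2 * rhoZ q₁ q₂ z ^ (-(2 * q₁)) := by
    rw [mul_pow, ← Real.rpow_natCast (rhoZ q₁ q₂ z ^ (-q₁)), ← Real.rpow_mul hz.le, ← mul_assoc]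
    congr 2
    push_cast
    ring
  rw [e] at h3 h4
  rw [tsum_mul_sub_eq] at h4
  have hn : 0 ≤ C * D ^ 2 * rhoZ q₁ q₂ z ^ (-(2 * q₁)) := (abs_nonneg _).trans h3
  constructor
  · rw [covFun, ← inner_coe_Lp]
    refine (h3 : |inner ℝ (diagLp (hε.memLp_wick hk hmom) a 0)
      (diagLp (hε.memLp_wick hk hmom) a z)| ≤ _).trans ?_
    linarith
  · rw [covFun_appellOf_eq hε hk hmom hY z, add_sub_right_comm]
    refine (abs_add_le _ _).trans ((add_le_add h4 h3).trans ?_)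
    linarith

end Covariance

/-! ### Asymptotics of the covariance function -/

section Asymptotics

variable {q₁ q₂ : ℝ} {L₀ : ℝ → ℝ} {a : ℤ × ℤ → ℝ} {k : ℕ}

/-- Here `P = Q/(2 - Q)`, so `P p₁ = q₁ Q < 2q₁`: below the threshold `P` the main term dominates
the diagonal error. -/
theorem IsLRDCoefficient.natCast_mul_p1_lt (ha : IsLRDCoefficient q₁ q₂ L₀ a)
    (hk : (k : ℝ) < bigP q₁ q₂) : k * p1 q₁ q₂ < 2 * q₁ := by
  have h₁ := ha.q₁_pos
  have h₂ := ha.q₂_pos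
  have hQ := ha.Q_lt_two
  have h3 : 0 < 2 - bigQ q₁ q₂ := by linarith
  have hp : 0 < p1 q₁ q₂ := mul_pos h₁ h3
  have e : bigP q₁ q₂ * p1 q₁ q₂ = q₁ * bigQ q₁ q₂ := by
    rw [bigP, p1, p2]
    have e2 : bigQ q₁ q₂ = 1 / q₁ + 1 / q₂ := rfl
    generalize hg : 2 - bigQ q₁ q₂ = d at *
    rw [e2]
    field_simp
  have h4 := mul_lt_mul_of_pos_right hk hp
  rw [e] at h4
  exact h4.trans (by nlinarith)

theorem tendsto_pow_sub_pow {ι : Type*} {l : Filter ι} {A B : ι → ℝ} {M : ℝ}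
    (h : Tendsto (fun i => A i - B i) l (𝓝 0)) (hB : ∀ i, |B i| ≤ M) (k : ℕ) :
    Tendsto (fun i => A i ^ k - B i ^ k) l (𝓝 0) := by
  have hb : Tendsto (fun i => |A i - B i| * k * (M + 1) ^ (k - 1)) l (𝓝 0) := by
    have := (h.abs.mul_const (k : ℝ)).mul_const ((M + 1) ^ (k - 1))
    rwa [abs_zero, zero_mul, zero_mul] at this
  refine squeeze_zero_norm' ?_ hb
  have h1 : ∀ᶠ i in l, |A i - B i| < 1 := by
    have := h.abs
    rw [abs_zero] at this
    exact this.eventually_lt_const one_pos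
  filter_upwards [h1] with i hi
  refine (abs_pow_sub_pow_le (A i) (B i) k).trans ?_
  have h2 : max |A i| |B i| ≤ M + 1 := by
    refine max_le ?_ (by linarith [hB i])
    have h3 := abs_add_le (A i - B i) (B i)
    rw [sub_add_cancel] at h3
    linarith [hB i]
  gcongr

theorem IsLRDCoefficient.exists_abs_star_spherePoint_le (ha : IsLRDCoefficient q₁ q₂ L₀ a) :
    ∃ M : ℝ, ∀ z, |star (aInf q₁ q₂ L₀) (aInf q₁ q₂ L₀)
      (spherePoint q₁ q₂ ((z : ℤ × ℤ).1 / rhoZ q₁ q₂ z))| ≤ M := by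
  have h : ContinuousOn (fun x => star (aInf q₁ q₂ L₀) (aInf q₁ q₂ L₀) (spherePoint q₁ q₂ x))
      (Set.Icc (-1) 1) := fun x hx =>
    (ContinuousAt.comp (f := spherePoint q₁ q₂)
      (ha.continuousAt_star (spherePoint_ne_zero ha.q₁_pos ha.q₂_pos hx))
      (continuous_spherePoint ha.q₁_pos ha.q₂_pos).continuousAt).continuousWithinAt
  obtain ⟨M, hM⟩ := isCompact_Icc.exists_bound_of_continuousOn h
  exact ⟨M, fun z => hM _ (fst_div_gauge_mem_Icc q₁ q₂ (toPlane z))⟩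

/-- After multiplication by `ρ^{k p₁}` the error is of order `ρ^{k p₁ - 2q₁}` and vanishes, while
the main term becomes the `k`-th power of a quantity close to the bounded function `a_∞ ⋆ a_∞` of
the angle. -/
theorem IsLRDCoefficient.hasAngularAsymptotics_of_sub_pow (ha : IsLRDCoefficient q₁ q₂ L₀ a)
    (hk : (k : ℝ) < bigP q₁ q₂) {R : ℤ × ℤ → ℝ} {C : ℝ}
    (hR : ∀ᶠ z in atInfinity, |R z - k.factorial * (∑' w, a w * a (z + w)) ^ k| ≤
      C * rhoZ q₁ q₂ z ^ (-(2 * q₁))) :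
    HasAngularAsymptotics q₁ q₂ R (k * p1 q₁ q₂) (LX q₁ q₂ L₀ k) := by
  have h₁ := ha.q₁_pos
  have hρ := tendsto_rhoZ_atInfinity h₁ ha.q₂_pos
  have hlt := ha.natCast_mul_p1_lt hk
  obtain ⟨M, hM⟩ := ha.exists_abs_star_spherePoint_le
  have hinv : ∀ z, 0 < rhoZ q₁ q₂ z →
      rhoZ q₁ q₂ z ^ (-(k * p1 q₁ q₂)) * rhoZ q₁ q₂ z ^ (k * p1 q₁ q₂) = 1 := fun z hz => by
    rw [← Real.rpow_add hz, neg_add_cancel, Real.rpow_zero]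
  -- The remainder is forced by the required identity wherever `ρ(z) > 0`; only its convergence to
  -- zero has content.
  refine ⟨fun z => rhoZ q₁ q₂ z ^ (k * p1 q₁ q₂) * R z - LX q₁ q₂ L₀ k (z.1 / rhoZ q₁ q₂ z), ?_, ?_⟩
  · have h3 : Tendsto (fun z => rhoZ q₁ q₂ z ^ (k * p1 q₁ q₂) *
        (R z - k.factorial * (∑' w, a w * a (z + w)) ^ k)) atInfinity (𝓝 0) := by
      have h4 : Tendsto (fun z => C * rhoZ q₁ q₂ z ^ (-(2 * q₁ - k * p1 q₁ q₂))) atInfinity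
          (𝓝 0) := by
        have := ((tendsto_rpow_neg_atTop (sub_pos.2 hlt)).comp hρ).const_mul C
        rwa [mul_zero] at this
      refine squeeze_zero_norm' ?_ h4
      filter_upwards [hR, hρ.eventually_gt_atTop 0] with z h5 hz
      have hp := Real.rpow_pos_of_pos hz (k * p1 q₁ q₂)
      rw [Real.norm_eq_abs, abs_mul, abs_of_pos hp]
      refine (mul_le_mul_of_nonneg_left h5 hp.le).trans_eq ?_
      rw [mul_left_comm, ← Real.rpow_add hz]
      congr 2; ring
    have h4 := (tendsto_pow_sub_pow ha.tendsto_rpow_mul_tsum hM k).const_mul (k.factorial : ℝ)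
    have h5 := h3.add h4
    rw [mul_zero, add_zero] at h5
    refine h5.congr' ?_
    filter_upwards [hρ.eventually_gt_atTop 0] with z hz
    rw [LX_eq, mul_pow, ← Real.rpow_natCast (rhoZ q₁ q₂ z ^ p1 q₁ q₂), ← Real.rpow_mul hz.le,
      mul_comm (p1 q₁ q₂)]
    ring
  · filter_upwards [hρ.eventually_gt_atTop 0] with z hz
    linear_combination -(R z) * hinv z hz

/-- Boundedness of `ρ^{p₁} r_Y` gives `r_Y^k = O(ρ^{-k p₁})`; since `ρ → ∞`, the smaller of the two
decay exponents decides. -/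
theorem IsLRDCoefficient.isBigO_of_sub_pow (ha : IsLRDCoefficient q₁ q₂ L₀ a)
    {R : ℤ × ℤ → ℝ} {C : ℝ}
    (hR : ∀ᶠ z in atInfinity, |R z - k.factorial * (∑' w, a w * a (z + w)) ^ k| ≤
      C * rhoZ q₁ q₂ z ^ (-(2 * q₁))) :
    R =O[atInfinity] fun z => rhoZ q₁ q₂ z ^ (-(min (k * p1 q₁ q₂) (2 * q₁))) := by
  have hρ := tendsto_rhoZ_atInfinity ha.q₁_pos ha.q₂_pos
  obtain ⟨M, hM⟩ := ha.exists_abs_star_spherePoint_le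
  have hexp : ∀ {s : ℝ}, min (k * p1 q₁ q₂) (2 * q₁) ≤ s →
      (fun z => rhoZ q₁ q₂ z ^ (-s)) =O[atInfinity]
        fun z => rhoZ q₁ q₂ z ^ (-(min (k * p1 q₁ q₂) (2 * q₁))) := by
    intro s hs
    refine IsBigO.of_bound' ?_
    filter_upwards [hρ.eventually_ge_atTop 1] with z hz
    have hz0 : 0 ≤ rhoZ q₁ q₂ z := zero_le_one.trans hz
    rw [Real.norm_eq_abs, Real.norm_eq_abs, abs_of_nonneg (Real.rpow_nonneg hz0 _),
      abs_of_nonneg (Real.rpow_nonneg hz0 _)]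
    exact Real.rpow_le_rpow_of_exponent_le hz (neg_le_neg hs)
  have h1 : (fun z => R z - k.factorial * (∑' w, a w * a (z + w)) ^ k) =O[atInfinity]
      fun z => rhoZ q₁ q₂ z ^ (-(2 * q₁)) := by
    refine IsBigO.of_bound C ?_
    filter_upwards [hR, hρ.eventually_gt_atTop 0] with z h hz
    rwa [Real.norm_eq_abs, Real.norm_eq_abs, abs_of_nonneg (Real.rpow_nonneg hz.le _)]
  have h2 : (fun z => k.factorial * (∑' w, a w * a (z + w)) ^ k) =O[atInfinity]
      fun z => rhoZ q₁ q₂ z ^ (-(k * p1 q₁ q₂)) := by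
    refine IsBigO.const_mul_left ?_ _
    have h3 : ∀ᶠ z in atInfinity, |rhoZ q₁ q₂ z ^ p1 q₁ q₂ * ∑' w, a w * a (z + w)| ≤ M + 1 := by
      have := ha.tendsto_rpow_mul_tsum.abs
      rw [abs_zero] at this
      filter_upwards [this.eventually_lt_const one_pos] with z hz
      have h4 := abs_add_le (rhoZ q₁ q₂ z ^ p1 q₁ q₂ * ∑' w, a w * a (z + w) -
        star (aInf q₁ q₂ L₀) (aInf q₁ q₂ L₀) (spherePoint q₁ q₂ (z.1 / rhoZ q₁ q₂ z)))
        (star (aInf q₁ q₂ L₀) (aInf q₁ q₂ L₀) (spherePoint q₁ q₂ (z.1 / rhoZ q₁ q₂ z)))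
      rw [sub_add_cancel] at h4
      linarith [hM z]
    have h4 : (fun z => ∑' w, a w * a (z + w)) =O[atInfinity]
        fun z => rhoZ q₁ q₂ z ^ (-p1 q₁ q₂) := by
      refine IsBigO.of_bound (M + 1) ?_
      filter_upwards [h3, hρ.eventually_gt_atTop 0] with z h hz
      have hp := Real.rpow_pos_of_pos hz (p1 q₁ q₂)
      rw [Real.norm_eq_abs, Real.norm_eq_abs, abs_of_nonneg (Real.rpow_nonneg hz.le _),
        Real.rpow_neg hz.le, ← div_eq_mul_inv, le_div_iff₀ hp, mul_comm]
      rwa [abs_mul, abs_of_pos hp] at h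
    refine (h4.pow k).congr' (Eventually.of_forall fun z => rfl) ?_
    filter_upwards [hρ.eventually_gt_atTop 0] with z hz
    rw [← Real.rpow_natCast, ← Real.rpow_mul hz.le]
    congr 1; ring
  have h3 := (h1.trans (hexp (min_le_right _ _))).add (h2.trans (hexp (min_le_left _ _)))
  simpa only [sub_add_cancel] using h3

theorem isLittleO_rhoZ_rpow (h₁ : 0 < q₁) (h₂ : 0 < q₂) {s t : ℝ} (h : s < t) :
    (fun z => rhoZ q₁ q₂ z ^ (-t)) =o[atInfinity] fun z => rhoZ q₁ q₂ z ^ (-s) := by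
  have hρ := tendsto_rhoZ_atInfinity h₁ h₂
  have hne : ∀ᶠ z in atInfinity, rhoZ q₁ q₂ z ^ (-s) = 0 → rhoZ q₁ q₂ z ^ (-t) = 0 := by
    filter_upwards [hρ.eventually_gt_atTop 0] with z hz h3
    exact absurd h3 (Real.rpow_pos_of_pos hz _).ne'
  rw [isLittleO_iff_tendsto' hne]
  refine ((tendsto_rpow_neg_atTop (sub_pos.2 h)).comp hρ).congr' ?_
  filter_upwards [hρ.eventually_gt_atTop 0] with z hz
  rw [Function.comp, ← Real.rpow_sub hz]
  congr 1; ring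

end Asymptotics

end AnisoField

/-! ### Both regimes from the common covariance estimate -/

theorem mainTheorem7 {Ω : Type*} [MeasurableSpace Ω] (μ : Measure Ω) [IsProbabilityMeasure μ]
    (q₁ q₂ : ℝ) (L₀ : ℝ → ℝ) (a : ℤ × ℤ → ℝ) (ε Y X : ℤ × ℤ → Ω → ℝ) (k : ℕ) (hk : 1 ≤ k)
    (hε : AnisoField.IsStandardNoise μ ε)
    (ha : AnisoField.IsLRDCoefficient q₁ q₂ L₀ a)
    (hY : AnisoField.IsMovingAverage μ a ε Y)
    (hmom : Integrable (fun ω => |ε 0 ω| ^ (2 * k)) μ)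
    (hX : ∀ z, X z = AnisoField.appellOf μ k (Y z)) :
    (∀ z, MemLp (X z) 2 μ ∧ ∫ ω, X z ω ∂μ = 0) ∧
    ((k : ℝ) < AnisoField.bigP q₁ q₂ →
      AnisoField.HasAngularAsymptotics q₁ q₂ (AnisoField.covFun μ X)
        (k * AnisoField.p1 q₁ q₂) (AnisoField.LX q₁ q₂ L₀ k) ∧
      ContinuousOn (AnisoField.LX q₁ q₂ L₀ k) (Set.Icc (-1) 1) ∧
      (volume {u : ℝ | u ∈ Set.Icc (-1 : ℝ) 1 ∧ L₀ u ≠ 0} ≠ 0 →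
        ∀ x ∈ Set.Icc (-1 : ℝ) 1, 0 < AnisoField.LX q₁ q₂ L₀ k x) ∧
      ∃ U Z : ℤ × ℤ → Ω → ℝ,
        AnisoField.IsOffDiagonalPart μ a ε k U ∧
        AnisoField.IsDiagonalPart μ a ε k Z ∧
        (∀ z, X z =ᵐ[μ] fun ω => U z ω + Z z ω) ∧
        (∀ z, ∫ ω, Z z ω ∂μ = 0) ∧
        AnisoField.covFun μ Z =O[AnisoField.atInfinity]
          (fun z => AnisoField.rhoZ q₁ q₂ z ^ (-(2 * q₁))) ∧
        AnisoField.covFun μ Z =o[AnisoField.atInfinity]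
          (fun z => AnisoField.rhoZ q₁ q₂ z ^ (-(k * AnisoField.p1 q₁ q₂)))) ∧
    (AnisoField.bigP q₁ q₂ < (k : ℝ) →
      AnisoField.covFun μ X =O[AnisoField.atInfinity]
        (fun z => AnisoField.rhoZ q₁ q₂ z ^ (-(min (k * AnisoField.p1 q₁ q₂) (2 * q₁))))) := by
  have hk0 : k ≠ 0 := by omega
  obtain rfl : X = fun z => AnisoField.appellOf μ k (Y z) := funext hX
  obtain ⟨C, hC⟩ := AnisoField.exists_abs_covFun_le hε hk0 hmom hY ha
  have hCZ := hC.mono fun z h => h.1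
  have hCX := hC.mono fun z h => h.2
  refine ⟨fun z => ⟨(Lp.memLp _).ae_eq
    (AnisoField.appellOf_ae_eq_offDiagLp_add_diagLp hε hk0 hmom hY z).symm,
    AnisoField.integral_appellOf_movingAverage hε hk0 hmom hY z⟩, fun hkP => ?_,
    fun _ => ha.isBigO_of_sub_pow hCX⟩
  have hO : AnisoField.covFun μ
      (fun z => AnisoField.diagLp (hε.memLp_wick hk0 hmom) a z) =O[AnisoField.atInfinity]
        fun z => AnisoField.rhoZ q₁ q₂ z ^ (-(2 * q₁)) := by
    refine IsBigO.of_bound C ?_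
    filter_upwards [hCZ] with z h
    rwa [Real.norm_eq_abs, Real.norm_eq_abs, abs_of_nonneg (a := AnisoField.rhoZ q₁ q₂ z ^ _)
      (Real.rpow_nonneg (AnisoField.gauge_nonneg q₁ q₂ (AnisoField.toPlane z)) _)]
  refine ⟨ha.hasAngularAsymptotics_of_sub_pow hkP hCX, ha.continuousOn_LX k,
    fun hL x hx => ha.LX_pos hL k hx,
    fun z => AnisoField.offDiagLp (hε.memLp_wick hk0 hmom) a z,
    fun z => AnisoField.diagLp (hε.memLp_wick hk0 hmom) a z,
    AnisoField.isOffDiagonalPart_offDiagLp hε hk0 hmom hY,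
    AnisoField.isDiagonalPart_diagLp hε hk0 hmom hY,
    fun z => (AnisoField.appellOf_ae_eq_offDiagLp_add_diagLp hε hk0 hmom hY z).trans
      (Lp.coeFn_add _ _),
    fun z => hε.integral_partLp hk0 hmom (hY.summable_sq hε z) _, hO,
    hO.trans_isLittleO (AnisoField.isLittleO_rhoZ_rpow ha.q₁_pos ha.q₂_pos
      (ha.natCast_mul_p1_lt hkP))⟩
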